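/- Let $n\ge 1$ and let $G$ be $SO(2n+1)$ or $SO(2n,1)=\{A\in GL_{2n+1}(\mathbb R): A^{T}\eta A=\eta,\ \det A=1\}$, $\eta=\mathrm{diag}(1,\dots,1,-1)$, with Lie algebra $\mathfrak g$ and Killing form $B$. Embed $SO(2n)\subset G$ as the upper left block, and let $J\in\mathfrak{so}(2n)$ be the block diagonal matrix with $n$ blocks $\begin{pmatrix}0&-1\\1&0\end{pmatrix}$; let $U(n)\subset SO(2n)$ be the subgroup of elements commuting with $J$. The canonical connection of the principal bundle $SO(2n)\to G\to G/SO(2n)$ is the left invariant connection whose horizontal space at the identity is the $B$-orthogonal complement of $\mathfrak{so}(2n)$ in $\mathfrak g$; its connection form $\theta$ is the $\mathfrak{so}(2n)$-part of $g^{-1}dg$, and its curvature form is $\Theta=d\theta+\tfrac12[\theta\wedge\theta]$. A covector $u\in\mathfrak{so}(2n)^*$ is called fat if at every point of $G$ the two-form $(X,Y)\mapsto\langle\Theta(X,Y),u\rangle$ is nondegenerate on the horizontal space. (1) The covector $u=B(J,-)\in\mathfrak{so}(2n)^*$ is fat for the canonical connection. A closed nondegenerate smooth two-form on the total space of a bundle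 is called a fibrewise symplectic structure if it restricts to a symplectic form on every fibre. The coupling form of the canonical connection on an associated bundle $SO(2n)/U(n)\to G/U(n)\to G/SO(2n)$, where $SO(2n)/U(n)$ is regarded as the coadjoint orbit of $u$, is the two-form whose pull-back to $G$ along $g\mapsto gU(n)$ is $-\langle u,[\theta(X),\theta(Y)]\rangle$ on vertical vectors $X,Y$, $\langle u,\Theta(X,Y)\rangle$ on horizontal vectors, and zero on pairs of a vertical and a horizontal vector; it is invariant under $G$, and so descends to quotients by discrete subgroups of $G$ acting freely. (2) (Reznikov) The twistor bundle of the even dimensional sphere, $SO(2n)/U(n)\to SO(2n+1)/U(n)\to S^{2n}$, is symplectically fat: the coupling form of the canonical connection is a fibrewise symplectic structure on it. (3) (Reznikov) Let $\Gamma\subset SO(2n,1)$ be a discrete subgroup such that $\Gamma\cap g\,SO(2n)\,g^{-1}=\{1\}$ for all $g\in SO(2n,1)$ (for instance a torsion-free lattice, cocompact or not). The twistor bundle $SO(2n)/U(n)\to\Gamma\backslash SO(2n,1)/U(n)\to\Gamma\backslash SO(2n,1)/SO(2n)$ of the even dimensional hyperbolic manifold $\Gamma\backslash SO(2n,1)/SO(2n)$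 is symplectically fat: the coupling form of the canonical connection is a fibrewise symplectic structure on it. -/

import Mathlib

open scoped Manifold ContDiff Matrix
attribute [local instance 100] LieRing.ofAssociativeRing

namespace TwistorFat

/-! ### The groups `SO(2n+1)`, `SO(2n,1)`, `SO(2n)`, `U(n)` and their Lie algebras -/

/-- Coordinates of `ℝ²ⁿ`, arranged in `n` blocks of size two: `(i, k)` is entry `i` of block `k`. -/
abbrev Idx (n : ℕ) : Type := Fin 2 × Fin n

/-- Real square matrices of size `2n + 1`, with the last coordinate singled out. -/
abbrev Mat (n : ℕ) : Type := Matrix (Idx n ⊕ Unit) (Idx n ⊕ Unit) ℝ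

/-- The Gram matrix `diag(1, …, 1, s)`: the Euclidean form on `ℝ²ⁿ⁺¹` for `s = 1`, the Lorentz form
of signature `(2n, 1)` for `s = -1`. -/
def gram (n : ℕ) (s : ℝ) : Mat n := Matrix.diagonal (Sum.elim (fun _ => 1) (fun _ => s))

/-- The special isometry group of `gram n s`: it is `SO(2n+1)` for `s = 1` and `SO(2n,1)` for
`s = -1`, with the topology induced from the space of matrices. -/
def grp (n : ℕ) (s : ℝ) : Subgroup (Matrix.SpecialLinearGroup (Idx n ⊕ Unit) ℝ) where
  carrier := {A | (A : Mat n)ᵀ * gram n s * (A : Mat n) = gram n s}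
  one_mem' := by simp
  mul_mem' := by
    intro A B hA hB
    simp only [Set.mem_ofPred_eq, Matrix.SpecialLinearGroup.coe_mul, Matrix.transpose_mul] at *
    calc (B : Mat n)ᵀ * (A : Mat n)ᵀ * gram n s * ((A : Mat n) * (B : Mat n))
        = (B : Mat n)ᵀ * ((A : Mat n)ᵀ * gram n s * (A : Mat n)) * (B : Mat n) := by
          simp only [Matrix.mul_assoc]
      _ = gram n s := by rw [hA, hB]
  inv_mem' := by
    intro A hA
    simp only [Set.mem_ofPred_eq] at *
    have h1 : (A : Mat n) * ((A⁻¹ : Matrix.SpecialLinearGroup (Idx n ⊕ Unit) ℝ) : Mat n) = 1 := by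
      rw [← Matrix.SpecialLinearGroup.coe_mul, mul_inv_cancel, Matrix.SpecialLinearGroup.coe_one]
    set C : Mat n := ((A⁻¹ : Matrix.SpecialLinearGroup (Idx n ⊕ Unit) ℝ) : Mat n)
    have h2 : Cᵀ * (A : Mat n)ᵀ = 1 := by
      rw [← Matrix.transpose_mul, h1, Matrix.transpose_one]
    calc Cᵀ * gram n s * C = Cᵀ * ((A : Mat n)ᵀ * gram n s * (A : Mat n)) * C := by rw [hA]
      _ = (Cᵀ * (A : Mat n)ᵀ) * gram n s * ((A : Mat n) * C) := by simp only [Matrix.mul_assoc]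
      _ = gram n s := by rw [h1, h2]; simp

/-- The underlying matrix of a group element. -/
def toMat {n : ℕ} {s : ℝ} (g : grp n s) : Mat n := (g : Matrix.SpecialLinearGroup (Idx n ⊕ Unit) ℝ)

@[simp] theorem toMat_one {n : ℕ} {s : ℝ} : toMat (1 : grp n s) = 1 := rfl

theorem toMat_mul {n : ℕ} {s : ℝ} (g h : grp n s) : toMat (g * h) = toMat g * toMat h := by
  simp [toMat]

theorem toMat_inv_mul {n : ℕ} {s : ℝ} (g : grp n s) : toMat g⁻¹ * toMat g = 1 := by
  rw [← toMat_mul, inv_mul_cancel, toMat_one]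

/-- The group as a subset of the space of matrices. -/
def grpSet (n : ℕ) (s : ℝ) : Set (Mat n) := Set.range (toMat : grp n s → Mat n)

/-- The Lie algebra of `grp n s`: `so(2n+1)` for `s = 1` and `so(2n,1)` for `s = -1`. -/
abbrev lieAlg (n : ℕ) (s : ℝ) : LieSubalgebra ℝ (Mat n) := skewAdjointMatricesLieSubalgebra (gram n s)

/-- The Lie algebra `so(2n)`. -/
abbrev so2n (n : ℕ) : LieSubalgebra ℝ (Matrix (Idx n) (Idx n) ℝ) :=
  LieAlgebra.Orthogonal.so (Idx n) ℝ

/-- The obvious inclusion of `SO(2n)` in `SO(2n+1)` or `SO(2n,1)`, on matrices. -/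
def blockIncl {n : ℕ} (B : Matrix (Idx n) (Idx n) ℝ) : Mat n := Matrix.fromBlocks B 0 0 1

/-- The subgroup `SO(2n)` of `grp n s`. -/
def subSO (n : ℕ) (s : ℝ) : Subgroup (grp n s) where
  carrier := {g | ∃ B ∈ Matrix.specialOrthogonalGroup (Idx n) ℝ, toMat g = blockIncl B}
  one_mem' := ⟨1, one_mem _, by simp [blockIncl]⟩
  mul_mem' := by
    rintro g h ⟨B, hB, hg⟩ ⟨C, hC, hh⟩
    exact ⟨B * C, mul_mem hB hC, by
      simp [toMat_mul, hg, hh, blockIncl, Matrix.fromBlocks_multiply]⟩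
  inv_mem' := by
    rintro g ⟨B, hB, hg⟩
    have hB' := Matrix.mem_specialOrthogonalGroup_iff.1 hB
    have hBB : B * Bᵀ = 1 := (Matrix.mem_orthogonalGroup_iff (Idx n) ℝ).1 hB'.1
    have hBB' : Bᵀ * B = 1 := (Matrix.mem_orthogonalGroup_iff' (Idx n) ℝ).1 hB'.1
    refine ⟨Bᵀ, Matrix.mem_specialOrthogonalGroup_iff.2 ⟨?_, ?_⟩, ?_⟩
    · rw [Matrix.mem_orthogonalGroup_iff]
      simpa using hBB'
    · rw [Matrix.det_transpose]; exact hB'.2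
    · calc toMat g⁻¹ = toMat g⁻¹ * (toMat g * blockIncl Bᵀ) := by
            rw [hg]; simp [blockIncl, Matrix.fromBlocks_multiply, hBB]
        _ = blockIncl Bᵀ := by rw [← Matrix.mul_assoc, toMat_inv_mul, Matrix.one_mul]

/-- The standard complex structure: blocks `(0, -1; 1, 0)` on the diagonal and zeros elsewhere. -/
def matJ (n : ℕ) : Matrix (Idx n) (Idx n) ℝ :=
  Matrix.blockDiagonal (fun _ : Fin n => !![0, -1; 1, 0])

/-- The standard complex structure as an element of `so(2n)`. -/
def stdJ (n : ℕ) : so2n n := ⟨matJ n, by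
  rw [LieAlgebra.Orthogonal.mem_so, matJ, Matrix.blockDiagonal_transpose,
    ← Matrix.blockDiagonal_neg]
  congr 1
  funext k
  ext i j
  fin_cases i <;> fin_cases j <;> simp⟩

/-- The inclusion of `so(2n)` in `so(2n+1)` or `so(2n,1)`. -/
def lieIncl (n : ℕ) (s : ℝ) : so2n n →ₗ[ℝ] lieAlg n s where
  toFun Y := ⟨Matrix.fromBlocks (Y : Matrix (Idx n) (Idx n) ℝ) 0 0 0, by
    have hY := (LieAlgebra.Orthogonal.mem_so (Idx n) ℝ _).1 Y.2
    have hg : gram n s = Matrix.fromBlocks 1 0 0 (Matrix.diagonal (fun _ => s)) := by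
      rw [← Matrix.diagonal_one, Matrix.fromBlocks_diagonal]; rfl
    rw [mem_skewAdjointMatricesLieSubalgebra, mem_skewAdjointMatricesSubmodule]
    simp [Matrix.IsSkewAdjoint, Matrix.IsAdjointPair, hg, Matrix.fromBlocks_transpose,
      Matrix.fromBlocks_multiply, Matrix.fromBlocks_neg, hY]⟩
  map_add' Y Z := by
    ext i j; rcases i with i | i <;> rcases j with j | j <;> simp
  map_smul' c Y := by
    ext i j; rcases i with i | i <;> rcases j with j | j <;> simp

/-- The subgroup `U(n)` of `SO(2n)`: the elements that commute with the complex structure. -/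
def subU (n : ℕ) (s : ℝ) : Subgroup (grp n s) where
  carrier := {g | ∃ B ∈ Matrix.specialOrthogonalGroup (Idx n) ℝ,
    B * matJ n = matJ n * B ∧ toMat g = blockIncl B}
  one_mem' := ⟨1, one_mem _, by simp, by simp [blockIncl]⟩
  mul_mem' := by
    rintro g h ⟨B, hB, hBJ, hg⟩ ⟨C, hC, hCJ, hh⟩
    refine ⟨B * C, mul_mem hB hC, ?_, by
      simp [toMat_mul, hg, hh, blockIncl, Matrix.fromBlocks_multiply]⟩
    rw [Matrix.mul_assoc, hCJ, ← Matrix.mul_assoc, hBJ, Matrix.mul_assoc]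
  inv_mem' := by
    rintro g ⟨B, hB, hBJ, hg⟩
    have hBB' : Bᵀ * B = 1 := (Matrix.mem_orthogonalGroup_iff' (Idx n) ℝ).1
      (Matrix.mem_specialOrthogonalGroup_iff.1 hB).1
    have hBB : B * Bᵀ = 1 := (Matrix.mem_orthogonalGroup_iff (Idx n) ℝ).1
      (Matrix.mem_specialOrthogonalGroup_iff.1 hB).1
    obtain ⟨C, hC, hgC⟩ := (subSO n s).inv_mem ⟨B, hB, hg⟩
    have h1 : blockIncl C * blockIncl B = 1 := by rw [← hgC, ← hg, toMat_inv_mul]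
    have h2 : C * B = 1 := by
      have := congrArg Matrix.toBlocks₁₁ h1
      rw [← Matrix.fromBlocks_one] at this
      simpa only [blockIncl, Matrix.fromBlocks_multiply, Matrix.toBlocks_fromBlocks₁₁,
        Matrix.mul_zero, add_zero] using this
    have h3 : C = Bᵀ := by
      calc C = C * (B * Bᵀ) := by rw [hBB, Matrix.mul_one]
        _ = Bᵀ := by rw [← Matrix.mul_assoc, h2, Matrix.one_mul]
    refine ⟨C, hC, ?_, hgC⟩
    calc C * matJ n = C * matJ n * (B * C) := by rw [h3, hBB, Matrix.mul_one]
      _ = C * (matJ n * B) * C := by simp only [Matrix.mul_assoc]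
      _ = (C * B) * matJ n * C := by rw [← hBJ]; simp only [Matrix.mul_assoc]
      _ = matJ n * C := by rw [h2, Matrix.one_mul]

/-- The covector `B(J, -)` on `so(2n)`, where `B` is the Killing form of the Lie algebra of
`grp n s` and `J` is the standard complex structure. -/
noncomputable def covec (n : ℕ) (s : ℝ) : Module.Dual ℝ (so2n n) :=
  (killingForm ℝ (lieAlg n s) (lieIncl n s (stdJ n))).comp (lieIncl n s)

/-! ### The canonical connection, its curvature, fat covectors -/

/-- The tangent space at `p` of an embedded submanifold `S` of the space of matrices: the velocities
at time zero of the smooth curves in `S` that start at `p`. -/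
def tangentSet {n : ℕ} (S : Set (Mat n)) (p : Mat n) : Set (Mat n) :=
  {v | ∃ c : ℝ → Mat n, (∀ i j, ContDiff ℝ ∞ fun t => c t i j) ∧ (∀ t, c t ∈ S) ∧ c 0 = p ∧
    ∀ i j, deriv (fun t => c t i j) 0 = v i j}

/-- The space of matrices as a normed space (sup norm of the entries; only its smooth structure
matters). -/
abbrev Amb (n : ℕ) : Type := (Idx n ⊕ Unit) → (Idx n ⊕ Unit) → ℝ

/-- The `so(2n)`-part of a matrix: the skew part of its upper left block. On the Lie algebra of
`grp n s` it is just the upper left block. -/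
noncomputable def soPart (n : ℕ) : Mat n →ₗ[ℝ] so2n n where
  toFun X := ⟨(1 / 2 : ℝ) • (X.toBlocks₁₁ - X.toBlocks₁₁ᵀ), by
    rw [LieAlgebra.Orthogonal.mem_so, Matrix.transpose_smul, Matrix.transpose_sub,
      Matrix.transpose_transpose, ← smul_neg, neg_sub]⟩
  map_add' X Y := by
    ext i j; simp [Matrix.toBlocks₁₁]; ring
  map_smul' c X := by
    ext i j; simp [Matrix.toBlocks₁₁]; ring

/-- The canonical connection form of `SO(2n) → G → G/SO(2n)`: the `so(2n)`-part of the left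
invariant Maurer-Cartan form `g⁻¹ dg`. The formula makes sense near `G` in the space of matrices. -/
noncomputable def canonicalForm (n : ℕ) (A : Mat n) : Mat n →ₗ[ℝ] so2n n :=
  (soPart n).comp (LinearMap.mulLeft ℝ A⁻¹)

/-- `θ` is the canonical invariant connection form of the principal bundle
`SO(2n) → G → G/SO(2n)`: it reproduces the generators of the right action, it is equivariant for the
right action of `SO(2n)`, it is invariant under left translations by `G`, and its horizontal space
at the identity is the Killing-orthogonal complement of `so(2n)` in the Lie algebra of `G`. -/
structure IsCanonicalConnection (n : ℕ) (s : ℝ) (θ : Mat n → Mat n →ₗ[ℝ] so2n n) : Prop where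
  smooth : ∃ W : Set (Amb n), IsOpen W ∧ (∀ g : grp n s, Matrix.of.symm (toMat g) ∈ W) ∧
    ∀ v i j, ContDiffOn ℝ ∞ (fun A => (θ (Matrix.of A) v : Matrix (Idx n) (Idx n) ℝ) i j) W
  reproducing : ∀ g : grp n s, ∀ Y : so2n n,
    θ (toMat g) (toMat g * (lieIncl n s Y : Mat n)) = Y
  equivariant : ∀ g h : grp n s, ∀ B ∈ Matrix.specialOrthogonalGroup (Idx n) ℝ,
    toMat h = blockIncl B → ∀ v ∈ tangentSet (grpSet n s) (toMat g),
      (θ (toMat (g * h)) (v * toMat h) : Matrix (Idx n) (Idx n) ℝ) =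
        B⁻¹ * (θ (toMat g) v : Matrix (Idx n) (Idx n) ℝ) * B
  left_invariant : ∀ a g : grp n s, ∀ v ∈ tangentSet (grpSet n s) (toMat g),
    θ (toMat (a * g)) (toMat a * v) = θ (toMat g) v
  horizontal : ∀ X : lieAlg n s, θ 1 (X : Mat n) = 0 ↔
    ∀ Y : so2n n, killingForm ℝ (lieAlg n s) X (lieIncl n s Y) = 0

/-- The pairing `⟨Θ(v, w), u⟩` of a covector `u` with the curvature form `Θ = dθ + ½[θ ∧ θ]` of a
connection form, that is `d⟨θ, u⟩(v, w) + ⟨[θ(v), θ(w)], u⟩`, where for a one-form `α` on an open set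
of a vector space `dα(v, w) = ∂ᵥ(α(w)) - ∂_w(α(v))`. -/
noncomputable def curvaturePairing {n : ℕ} (θ : Mat n → Mat n →ₗ[ℝ] so2n n)
    (u : Module.Dual ℝ (so2n n)) (p v w : Mat n) : ℝ :=
  (lineDeriv ℝ (fun A => u (θ A w)) p v - lineDeriv ℝ (fun A => u (θ A v)) p w) +
    u ⁅θ p v, θ p w⁆

/-- The covector `u` is fat: at every point of the total space `P` the two-form `⟨Θ(v, w), u⟩` is
nondegenerate on the horizontal space. -/
def IsFat {n : ℕ} (P : Set (Mat n)) (θ : Mat n → Mat n →ₗ[ℝ] so2n n)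
    (u : Module.Dual ℝ (so2n n)) : Prop :=
  ∀ p ∈ P, ∀ v ∈ tangentSet P p, θ p v = 0 →
    (∀ w ∈ tangentSet P p, θ p w = 0 → curvaturePairing θ u p v w = 0) → v = 0

/-- The pull-back to `P`, along `p ↦ [p, u]`, of the coupling form of `θ` on `P ×_H (H·u)`, where
`H·u` is the coadjoint orbit of `u` with the Kirillov-Kostant-Souriau form `-⟨u, [·, ·]⟩`: it is that
form on vertical vectors and `⟨u, Θ⟩` on horizontal ones, and vertical and horizontal vectors are
orthogonal to each other. -/
noncomputable def couplingLift {n : ℕ} (θ : Mat n → Mat n →ₗ[ℝ] so2n n)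
    (u : Module.Dual ℝ (so2n n)) (p v w : Mat n) : ℝ :=
  curvaturePairing θ u p v w - u ⁅θ p v, θ p w⁆

/-! ### Symplectic forms on manifolds -/

/-- The model space of `d`-dimensional manifolds. -/
abbrev Euc (d : ℕ) : Type := EuclideanSpace ℝ (Fin d)

section Forms

variable {d e : ℕ} {X : Type*} [TopologicalSpace X] [ChartedSpace (Euc d) X]
  {B : Type*} [TopologicalSpace B] [ChartedSpace (Euc e) B]

/-- A two-form on `X`, not necessarily continuous. -/
abbrev TwoForm (d : ℕ) (X : Type*) [TopologicalSpace X] [ChartedSpace (Euc d) X] : Type _ :=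
  (x : X) → (TangentSpace 𝓘(ℝ, Euc d) x) [⋀^Fin 2]→L[ℝ] ℝ

/-- The expression of a two-form in a chart. -/
noncomputable def inChart (Ω : TwoForm d X) (c : OpenPartialHomeomorph X (Euc d)) (y : Euc d) :
    (Euc d) [⋀^Fin 2]→L[ℝ] ℝ :=
  ContinuousAlternatingMap.compContinuousLinearMap (Ω (c.symm y))
    (mfderiv 𝓘(ℝ, Euc d) 𝓘(ℝ, Euc d) c.symm y)

/-- A symplectic form: a smooth, closed, nondegenerate two-form. -/
structure IsSymplecticForm (Ω : TwoForm d X) : Prop where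
  smooth : ∀ c ∈ atlas (Euc d) X, ContDiffOn ℝ ∞ (inChart Ω c) c.target
  closed : ∀ c ∈ atlas (Euc d) X, ∀ y ∈ c.target, extDeriv (inChart Ω c) y = 0
  nondegenerate : ∀ x (v : TangentSpace 𝓘(ℝ, Euc d) x),
    (∀ w : TangentSpace 𝓘(ℝ, Euc d) x, Ω x ![v, w] = 0) → v = 0

/-- A fibrewise symplectic form for the surjective submersion `π : X → B`: a symplectic form on `X`
whose restriction to every fibre is symplectic. The tangent spaces of the fibres are the kernels of
`dπ`, and the restriction of a closed form to a fibre is closed. -/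
structure IsFibrewiseSymplectic (π : X → B) (Ω : TwoForm d X) : Prop where
  smooth_proj : ContMDiff 𝓘(ℝ, Euc d) 𝓘(ℝ, Euc e) ∞ π
  surjective_proj : Function.Surjective π
  submersion : ∀ x, Function.Surjective (mfderiv 𝓘(ℝ, Euc d) 𝓘(ℝ, Euc e) π x)
  symplectic : IsSymplecticForm Ω
  fibre_nondegenerate : ∀ x (v : TangentSpace 𝓘(ℝ, Euc d) x),
    mfderiv 𝓘(ℝ, Euc d) 𝓘(ℝ, Euc e) π x v = 0 →
    (∀ w : TangentSpace 𝓘(ℝ, Euc d) x,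
      mfderiv 𝓘(ℝ, Euc d) 𝓘(ℝ, Euc e) π x w = 0 → Ω x ![v, w] = 0) → v = 0

/-! ### Quotients of the groups, and twistor bundles -/

variable {n : ℕ} {s : ℝ}

/-- `σ` is a smooth local section, over the open set `W`, of the map `q` from the group to `X`. -/
structure IsLocalSection (q : grp n s → X) (W : Set X) (σ : X → Mat n) : Prop where
  isOpen : IsOpen W
  smooth : ∀ i j, ContMDiffOn 𝓘(ℝ, Euc d) 𝓘(ℝ, ℝ) ∞ (fun x => σ x i j) W
  isSection : ∀ x ∈ W, ∃ g : grp n s, toMat g = σ x ∧ q g = x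

/-- `q` presents the smooth manifold `X` as the quotient `Γ \ G / V`: it is onto, its fibres are the
double cosets, it is smooth (locally the restriction of a smooth map on an open set of matrices), and
it has smooth local sections through every point of `G`. In other words, `q` is a smooth surjective
submersion whose fibres are the double cosets; this determines the smooth structure of `X`. -/
structure IsSmoothQuotient (Γ V : Subgroup (grp n s)) (q : grp n s → X) : Prop where
  isManifold : IsManifold 𝓘(ℝ, Euc d) ∞ X
  surjective : Function.Surjective q
  fibres : ∀ g g' : grp n s, q g = q g' ↔ ∃ γ ∈ Γ, ∃ h ∈ V, g' = γ * g * h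
  smooth : ∀ g : grp n s, ∃ (W : Set (Amb n)) (Q : Amb n → X), IsOpen W ∧ Matrix.of.symm (toMat g) ∈ W ∧
    ContMDiffOn 𝓘(ℝ, Amb n) 𝓘(ℝ, Euc d) ∞ Q W ∧
    ∀ g' : grp n s, Matrix.of.symm (toMat g') ∈ W → Q (Matrix.of.symm (toMat g')) = q g'
  sections : ∀ g : grp n s, ∃ W σ, IsLocalSection (d := d) q W σ ∧ q g ∈ W ∧ σ (q g) = toMat g

/-- The differential of a matrix valued map, applied to a tangent vector. -/
noncomputable def matDeriv (σ : X → Mat n) (x : X) (v : TangentSpace 𝓘(ℝ, Euc d) x) : Mat n :=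
  Matrix.of fun i j => mfderiv 𝓘(ℝ, Euc d) 𝓘(ℝ, ℝ) (fun y => σ y i j) x v

/-- `Ω` is the coupling form, for the canonical connection, on the quotient `q : G → X`: along every
local section of `q` it is given by `couplingLift`. -/
def IsCouplingForm (q : grp n s → X) (Ω : TwoForm d X) : Prop :=
  ∀ W σ, IsLocalSection (d := d) q W σ → ∀ x ∈ W, ∀ v w : TangentSpace 𝓘(ℝ, Euc d) x,
    Ω x ![v, w] = couplingLift (canonicalForm n) (covec n s) (σ x)
      (matDeriv σ x v) (matDeriv σ x w)

/-- The bundle `SO(2n)/U(n) → X → B`, where `q : G → X` and `p : G → B` are the quotients by `U(n)`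
and `SO(2n)` (and by `Γ` on the left), is symplectically fat: the coupling form of the canonical
connection is a fibrewise symplectic form. -/
def IsSymplecticallyFat (q : grp n s → X) (p : grp n s → B) : Prop :=
  ∃ π : X → B, (∀ g, π (q g) = p g) ∧
    ∃ Ω : TwoForm d X, IsFibrewiseSymplectic (e := e) π Ω ∧ IsCouplingForm q Ω

end Forms

/-- The double coset space `Γ \ G / V` with the quotient topology. -/
def Biquotient {n : ℕ} {s : ℝ} (Γ V : Subgroup (grp n s)) : Type :=
  Quotient (DoubleCoset.setoid (Γ : Set (grp n s)) (V : Set (grp n s)))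

instance {n : ℕ} {s : ℝ} (Γ V : Subgroup (grp n s)) : TopologicalSpace (Biquotient Γ V) :=
  inferInstanceAs (TopologicalSpace
    (Quotient (DoubleCoset.setoid (Γ : Set (grp n s)) (V : Set (grp n s)))))

/-- The projection `G → Γ \ G / V`. -/
def biquotientMk {n : ℕ} {s : ℝ} (Γ V : Subgroup (grp n s)) (g : grp n s) : Biquotient Γ V :=
  Quotient.mk _ g

instance (n : ℕ) : Fact (Module.finrank ℝ (EuclideanSpace ℝ (Idx n ⊕ Unit)) = 2 * n + 1) :=
  ⟨by simp⟩

/-- The unit sphere `S²ⁿ` in `ℝ²ⁿ⁺¹`. -/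
abbrev Sph (n : ℕ) : Type := Metric.sphere (0 : EuclideanSpace ℝ (Idx n ⊕ Unit)) 1

/-- The projection `SO(2n+1) → S²ⁿ`, which sends `g` to the image of the last basis vector. -/
noncomputable def toSphere (n : ℕ) (g : grp n 1) : Sph n :=
  ⟨WithLp.toLp 2 (fun i => toMat g i (Sum.inr ())), by
    have hg : (toMat g)ᵀ * gram n 1 * toMat g = gram n 1 := g.2
    have h1 : gram n 1 = 1 := by
      rw [gram, ← Matrix.diagonal_one]
      congr 1
      funext i
      rcases i with i | i <;> rfl
    rw [h1, Matrix.mul_one] at hg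
    have h2 := congrFun (congrFun hg (Sum.inr ())) (Sum.inr ())
    rw [Matrix.mul_apply, Matrix.one_apply_eq] at h2
    have h3 : ∑ i, ‖toMat g i (Sum.inr ())‖ ^ 2 = 1 := by
      refine Eq.trans (Finset.sum_congr rfl fun i _ => ?_) h2
      rw [Matrix.transpose_apply, Real.norm_eq_abs, sq_abs, sq]
    rw [mem_sphere_zero_iff_norm, EuclideanSpace.norm_eq, Real.sqrt_eq_one]
    exact h3⟩

end TwistorFat

/-!
Let `G` be `SO(2n+1)` or `SO(2n,1)`, as the group of isometries `g` of `diag(1, …, 1, s)` with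
`s = ±1`, and write `A*` for the adjoint of a matrix, so that `g⁻¹ = g*` on `G` and the Lie algebra
is `A* = -A`. The argument is the same for both signs of `s`.

*The form.* The Killing form is `(2n - 1) tr(XY)` (`killingForm_eq`). The lift of the coupling form to
`G` is `⟨u, Θ⟩ - ⟨u, [θ, θ]⟩ = d⟨u, θ⟩`, and by the Maurer-Cartan equation its value at the vectors
`gξ`, `gζ` is `-B(J, [ξ, ζ])` (`couplingLift_eq`). By the invariance of the trace this is `-B([J, ξ], ζ)`, so that its radical is the centralizer of `J`, which
is the Lie algebra of `U(n)` (`mul_lastProj_eq_zero`: a skew matrix that commutes with `J` kills the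
last basis vector). This makes the coupling form nondegenerate on a quotient by `U(n)`; on the
horizontal space and on the Lie algebra of `SO(2n)` it remains so since `ad J` preserves both.

*Descent.* On `G` the lifted form is the restriction of a constant form on the space of matrices,
the antisymmetrization of `(v, w) ↦ B(J, v* w)` (`ambForm_eq_kks`). The coupling form on a quotient
is defined as its pull-back by local sections. It is independent of the section, since two sections
differ locally by an element of `Γ` that is constant and a function with values in `U(n)`
(`ambForm_section_congr`), and it is closed and smooth because the pull-back of a constant form is.
That the element of `Γ` is locally constant is proper discontinuity, which follows from discreteness
and from the compactness of `SO(2n)` (`exists_nhds_eq_one`). Together these facts give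
`isSymplecticallyFat_of_isSmoothQuotient`.

*The quotients.* A smooth structure on `Γ \ G / V` is obtained from a slice for the cosets of `V` at
the identity, moved around by left translations (`CosetSlice.isSmoothQuotient`). The slice is the
Cayley transform of a complement of the Lie algebra of `V`; the smooth projection onto it comes from
the inverse function theorem for the map `(X, Y, Z) ↦ cay X * cay Y * (1 + Z)`, where `X` is in the
complement, `Y` in the Lie algebra of `V` and `Z` is self-adjoint
(`IsSliceProjection.nonempty_cosetSlice`). For the sphere, local sections of `SO(2n+1) → S²ⁿ` are
given by the rotations that take one unit vector to another, as products of two reflections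
(`isSmoothQuotient_toSphere`).
-/

namespace TwistorFat

variable {n : ℕ} {s : ℝ}

/-! ### Matrix algebra of the isometry groups -/

/-- The adjoint of a matrix for the bilinear form `gram n s`, when `s * s = 1`. -/
def adj (s : ℝ) : Mat n →ₗ[ℝ] Mat n where
  toFun A := gram n s * Aᵀ * gram n s
  map_add' A B := by simp [Matrix.mul_add, Matrix.add_mul]
  map_smul' c A := by simp

theorem adj_apply (A : Mat n) : adj s A = gram n s * Aᵀ * gram n s := rfl

theorem gram_mul_gram (hs : s * s = 1) : gram n s * gram n s = 1 := by
  rw [gram, Matrix.diagonal_mul_diagonal, ← Matrix.diagonal_one]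
  congr 1
  funext i
  rcases i with i | i <;> simp [hs]

theorem gram_transpose : (gram n s)ᵀ = gram n s := by simp [gram]

theorem adj_one (hs : s * s = 1) : adj s (1 : Mat n) = 1 := by
  simp [adj_apply, gram_mul_gram hs]

theorem adj_mul (hs : s * s = 1) (A B : Mat n) : adj s (A * B) = adj s B * adj s A := by
  simp only [adj_apply, Matrix.transpose_mul]
  calc gram n s * (Bᵀ * Aᵀ) * gram n s = gram n s * Bᵀ * 1 * Aᵀ * gram n s := by
        simp only [Matrix.mul_assoc, Matrix.one_mul]
    _ = _ := by rw [← gram_mul_gram hs]; simp only [Matrix.mul_assoc]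

theorem adj_adj (hs : s * s = 1) (A : Mat n) : adj s (adj s A) = A := by
  simp only [adj_apply, Matrix.transpose_mul, gram_transpose, Matrix.transpose_transpose]
  calc gram n s * (gram n s * (A * gram n s)) * gram n s
      = (gram n s * gram n s) * A * (gram n s * gram n s) := by simp only [Matrix.mul_assoc]
    _ = A := by simp [gram_mul_gram hs]

theorem trace_adj (hs : s * s = 1) (A : Mat n) : (adj s A).trace = A.trace := by
  rw [adj_apply, Matrix.trace_mul_comm, ← Matrix.mul_assoc, gram_mul_gram hs, Matrix.one_mul,
    Matrix.trace_transpose]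

theorem det_adj (hs : s * s = 1) (A : Mat n) : (adj s A).det = A.det := by
  have h : (gram n s).det * (gram n s).det = 1 := by
    rw [← Matrix.det_mul, gram_mul_gram hs, Matrix.det_one]
  rw [adj_apply, Matrix.det_mul, Matrix.det_mul, Matrix.det_transpose, mul_right_comm, h, one_mul]

theorem mem_lieAlg_iff (hs : s * s = 1) {X : Mat n} : X ∈ lieAlg n s ↔ adj s X = -X := by
  rw [mem_skewAdjointMatricesLieSubalgebra, mem_skewAdjointMatricesSubmodule,
    Matrix.IsSkewAdjoint, Matrix.IsAdjointPair, adj_apply]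
  constructor
  · intro h
    have := congrArg (gram n s * ·) h
    simp only [← Matrix.mul_assoc, gram_mul_gram hs, Matrix.one_mul] at this
    exact this
  · intro h
    rw [← h]
    simp only [← Matrix.mul_assoc, gram_mul_gram hs, Matrix.one_mul]

theorem toMat_injective : Function.Injective (toMat : grp n s → Mat n) := fun _ _ h =>
  Subtype.ext (Subtype.ext h)

theorem adj_toMat_mul (hs : s * s = 1) (g : grp n s) : adj s (toMat g) * toMat g = 1 := by
  have h : (toMat g)ᵀ * gram n s * toMat g = gram n s := g.2
  calc adj s (toMat g) * toMat g = gram n s * ((toMat g)ᵀ * gram n s * toMat g) := by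
        rw [adj_apply]; simp only [Matrix.mul_assoc]
    _ = 1 := by rw [h, gram_mul_gram hs]

theorem toMat_mul_adj (hs : s * s = 1) (g : grp n s) : toMat g * adj s (toMat g) = 1 :=
  mul_eq_one_comm.1 (adj_toMat_mul hs g)

theorem toMat_inv (hs : s * s = 1) (g : grp n s) : toMat g⁻¹ = adj s (toMat g) := by
  calc toMat g⁻¹ = toMat g⁻¹ * (toMat g * adj s (toMat g)) := by
        rw [toMat_mul_adj hs, Matrix.mul_one]
    _ = _ := by rw [← Matrix.mul_assoc, toMat_inv_mul, Matrix.one_mul]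

theorem toMat_mul_inv (g : grp n s) : toMat g * toMat g⁻¹ = 1 := by
  rw [← toMat_mul, mul_inv_cancel, toMat_one]

theorem inv_toMat (g : grp n s) : (toMat g)⁻¹ = toMat g⁻¹ :=
  Matrix.inv_eq_left_inv (toMat_inv_mul g)

theorem det_toMat (g : grp n s) : (toMat g).det = 1 :=
  (g : Matrix.SpecialLinearGroup (Idx n ⊕ Unit) ℝ).2

/-- The element of `grp n s` with a given matrix. -/
def mkGrp (hs : s * s = 1) (A : Mat n) (h : adj s A * A = 1) (hd : A.det = 1) : grp n s :=
  ⟨⟨A, hd⟩, by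
    change Aᵀ * gram n s * A = gram n s
    calc Aᵀ * gram n s * A = gram n s * gram n s * Aᵀ * gram n s * A := by
          rw [gram_mul_gram hs, Matrix.one_mul]
      _ = gram n s * (adj s A * A) := by rw [adj_apply]; simp only [Matrix.mul_assoc]
      _ = gram n s := by rw [h, Matrix.mul_one]⟩

@[simp] theorem toMat_mkGrp (hs : s * s = 1) (A : Mat n) (h : adj s A * A = 1) (hd : A.det = 1) :
    toMat (mkGrp hs A h hd) = A := rfl

/-- The complex structure of `ℝ²ⁿ`, as a matrix of size `2n + 1`. -/
def Jhat (n : ℕ) : Mat n := Matrix.fromBlocks (matJ n) 0 0 0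

/-- The projection onto the last coordinate axis. -/
def lastProj (n : ℕ) : Mat n := Matrix.fromBlocks 0 0 0 1

theorem gram_eq_fromBlocks : gram n s = Matrix.fromBlocks 1 0 0 (s • (1 : Matrix Unit Unit ℝ)) := by
  have : s • (1 : Matrix Unit Unit ℝ) = Matrix.diagonal fun _ => s := by
    rw [← Matrix.diagonal_one, ← Matrix.diagonal_smul]
    congr 1; ext; simp
  rw [this, ← Matrix.diagonal_one, Matrix.fromBlocks_diagonal]; rfl

theorem adj_fromBlocks (A : Matrix (Idx n) (Idx n) ℝ) (B : Matrix (Idx n) Unit ℝ)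
    (C : Matrix Unit (Idx n) ℝ) (D : Matrix Unit Unit ℝ) (hs : s * s = 1) :
    adj s (Matrix.fromBlocks A B C D) = Matrix.fromBlocks Aᵀ (s • Cᵀ) (s • Bᵀ) Dᵀ := by
  rw [adj_apply, gram_eq_fromBlocks, Matrix.fromBlocks_transpose, Matrix.fromBlocks_multiply,
    Matrix.fromBlocks_multiply]
  simp [smul_smul, hs]

theorem matJ_transpose : (matJ n)ᵀ = -matJ n :=
  (LieAlgebra.Orthogonal.mem_so (Idx n) ℝ _).1 (stdJ n).2

theorem matJ_mul_matJ : matJ n * matJ n = -1 := by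
  rw [matJ, ← Matrix.blockDiagonal_mul, ← Matrix.blockDiagonal_one, ← Matrix.blockDiagonal_neg]
  congr 1
  funext k
  ext i j
  fin_cases i <;> fin_cases j <;> simp

theorem adj_Jhat (hs : s * s = 1) : adj s (Jhat n) = -Jhat n := by
  rw [Jhat, adj_fromBlocks _ _ _ _ hs, matJ_transpose, Matrix.fromBlocks_neg]; simp

theorem adj_lastProj (hs : s * s = 1) : adj s (lastProj n) = lastProj n := by
  rw [lastProj, adj_fromBlocks _ _ _ _ hs]; simp

theorem Jhat_mul_Jhat : Jhat n * Jhat n = lastProj n - 1 := by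
  rw [Jhat, Matrix.fromBlocks_multiply, lastProj, ← Matrix.fromBlocks_one, sub_eq_add_neg,
    Matrix.fromBlocks_neg, Matrix.fromBlocks_add]
  simp [matJ_mul_matJ]

theorem Jhat_mul_lastProj : Jhat n * lastProj n = 0 := by
  simp [Jhat, lastProj, Matrix.fromBlocks_multiply]

theorem lastProj_mul_Jhat : lastProj n * Jhat n = 0 := by
  simp [Jhat, lastProj, Matrix.fromBlocks_multiply]

theorem lastProj_mul_self : lastProj n * lastProj n = lastProj n := by
  simp [lastProj, Matrix.fromBlocks_multiply]

/-- A skew-adjoint matrix has no component in the corner of the last coordinate. -/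
theorem lastProj_mul_mul_lastProj (hs : s * s = 1) {X : Mat n} (hX : adj s X = -X) :
    lastProj n * X * lastProj n = 0 := by
  rw [← Matrix.fromBlocks_toBlocks X] at hX ⊢
  rw [adj_fromBlocks _ _ _ _ hs, Matrix.fromBlocks_neg, Matrix.fromBlocks_inj] at hX
  have h : X.toBlocks₂₂ = 0 := by
    ext i j
    have := congrFun (congrFun hX.2.2.2 i) j
    simp only [Matrix.transpose_apply, Matrix.neg_apply] at this
    rw [Subsingleton.elim j i] at *
    simp only [Matrix.zero_apply]
    linarith
  simp [lastProj, Matrix.fromBlocks_multiply, h]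

theorem eq_zero_of_trace_mul_transpose {X : Mat n} (h : (X * Xᵀ).trace = 0) : X = 0 := by
  rw [← Matrix.conjTranspose_eq_transpose_of_trivial] at h
  exact Matrix.trace_mul_conjTranspose_self_eq_zero_iff.1 h

theorem adj_transpose {X : Mat n} (hX : adj s X = -X) : adj s Xᵀ = -Xᵀ := by
  have := congrArg Matrix.transpose hX
  rw [← Matrix.transpose_neg, ← this]
  simp [adj_apply, gram_transpose, Matrix.mul_assoc]

/-- The trace form is nondegenerate on the Lie algebra. -/
theorem eq_zero_of_trace_mul {X : Mat n} (hX : adj s X = -X)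
    (h : ∀ Y : Mat n, adj s Y = -Y → (X * Y).trace = 0) : X = 0 :=
  eq_zero_of_trace_mul_transpose (h _ (adj_transpose hX))

theorem adj_commutator (hs : s * s = 1) {X Y : Mat n} (hX : adj s X = -X) (hY : adj s Y = -Y) :
    adj s (X * Y - Y * X) = -(X * Y - Y * X) := by
  rw [map_sub, adj_mul hs, adj_mul hs, hX, hY]; simp

theorem commute_lastProj_of_Jhat {A : Mat n} (h : A * Jhat n = Jhat n * A) :
    A * lastProj n = lastProj n * A := by
  have : lastProj n = Jhat n * Jhat n + 1 := by rw [Jhat_mul_Jhat]; simp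
  rw [this, Matrix.mul_add, Matrix.add_mul, ← Matrix.mul_assoc, h, Matrix.mul_assoc, h,
    Matrix.mul_assoc]
  simp

theorem mul_lastProj_eq_zero (hs : s * s = 1) {X : Mat n} (hX : adj s X = -X)
    (h : X * Jhat n = Jhat n * X) : X * lastProj n = 0 := by
  have h1 := commute_lastProj_of_Jhat h
  rw [← lastProj_mul_self, ← Matrix.mul_assoc, h1, lastProj_mul_mul_lastProj hs hX]

/-- An isometry that fixes the last basis vector lies in `SO(2n)`. -/
theorem mem_subSO_of_fix (hs : s * s = 1) (g : grp n s) (h : toMat g * lastProj n = lastProj n) :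
    ∃ B ∈ Matrix.specialOrthogonalGroup (Idx n) ℝ, toMat g = blockIncl B := by
  have h' : lastProj n * toMat g = lastProj n := by
    have h1 : toMat g⁻¹ * lastProj n = lastProj n := by
      rw [← h, ← Matrix.mul_assoc, toMat_inv_mul, Matrix.one_mul, h]
    have h2 := congrArg (adj s) h1
    rwa [adj_mul hs, adj_lastProj hs, toMat_inv hs, adj_adj hs] at h2
  have h3 := adj_toMat_mul hs g
  have h4 := det_toMat g
  have h5 : toMat g = blockIncl (toMat g).toBlocks₁₁ := by
    rw [← Matrix.fromBlocks_toBlocks (toMat g)] at h h'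
    rw [lastProj, Matrix.fromBlocks_multiply, Matrix.fromBlocks_inj] at h h'
    nth_rewrite 1 [← Matrix.fromBlocks_toBlocks (toMat g)]
    rw [blockIncl, Matrix.fromBlocks_inj]
    simp at h h'
    exact ⟨rfl, h.1, h'.1, h.2⟩
  refine ⟨_, Matrix.mem_specialOrthogonalGroup_iff.2 ⟨?_, ?_⟩, h5⟩
  · rw [Matrix.mem_orthogonalGroup_iff']
    rw [h5, blockIncl, adj_fromBlocks _ _ _ _ hs, Matrix.fromBlocks_multiply,
      ← Matrix.fromBlocks_one, Matrix.fromBlocks_inj] at h3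
    simpa [Matrix.star_eq_conjTranspose] using h3.1
  · rw [h5, blockIncl, Matrix.det_fromBlocks_zero₂₁] at h4
    simpa using h4

theorem mem_subU_of_fix (hs : s * s = 1) (g : grp n s) (h : toMat g * lastProj n = lastProj n)
    (hJ : toMat g * Jhat n = Jhat n * toMat g) : g ∈ subU n s := by
  obtain ⟨B, hB, hg⟩ := mem_subSO_of_fix hs g h
  refine ⟨B, hB, ?_, hg⟩
  rw [hg, blockIncl, Jhat, Matrix.fromBlocks_multiply, Matrix.fromBlocks_multiply,
    Matrix.fromBlocks_inj] at hJ
  simpa using hJ.1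

theorem mul_lastProj_of_mem_subSO {g : grp n s} (h : g ∈ subSO n s) :
    toMat g * lastProj n = lastProj n := by
  obtain ⟨B, -, hg⟩ := h
  simp [hg, blockIncl, lastProj, Matrix.fromBlocks_multiply]

theorem mul_Jhat_of_mem_subU {g : grp n s} (h : g ∈ subU n s) :
    toMat g * Jhat n = Jhat n * toMat g := by
  obtain ⟨B, -, hJ, hg⟩ := h
  simp [hg, blockIncl, Jhat, Matrix.fromBlocks_multiply, hJ]

theorem subU_le_subSO : subU n s ≤ subSO n s := by
  rintro g ⟨B, hB, -, hg⟩
  exact ⟨B, hB, hg⟩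

/-! ### The Killing form -/

section Trace

variable {ι : Type*} [Fintype ι] [DecidableEq ι]

theorem trace_end_matrix (f : Matrix ι ι ℝ →ₗ[ℝ] Matrix ι ι ℝ) :
    LinearMap.trace ℝ _ f = ∑ i, ∑ j, f (Matrix.single i j 1) i j := by
  rw [LinearMap.trace_eq_matrix_trace ℝ (Matrix.stdBasis ℝ ι ι), Matrix.trace,
    Fintype.sum_prod_type]
  refine Finset.sum_congr rfl fun i _ => Finset.sum_congr rfl fun j _ => ?_
  rw [Matrix.diag_apply, LinearMap.toMatrix_apply, Matrix.stdBasis_eq_single]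
  rfl

theorem sum_mul_single_mul (A C : Matrix ι ι ℝ) :
    ∑ i, ∑ j, (A * Matrix.single i j (1 : ℝ) * C : Matrix ι ι ℝ) i j = A.trace * C.trace := by
  simp only [Matrix.trace, Matrix.diag_apply, Finset.sum_mul_sum]
  refine Finset.sum_congr rfl fun i _ => Finset.sum_congr rfl fun j _ => ?_
  rw [Matrix.mul_apply, Finset.sum_eq_single j]
  · simp
  · intro b _ hb
    simp [Matrix.mul_single_apply_of_ne _ _ _ _ _ hb]
  · simp

theorem sum_mul_single_transpose_mul (A C : Matrix ι ι ℝ) :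
    ∑ i, ∑ j, (A * (Matrix.single i j (1 : ℝ))ᵀ * C : Matrix ι ι ℝ) i j = (A * Cᵀ).trace := by
  simp only [Matrix.trace, Matrix.diag_apply, Matrix.mul_apply (M := A) (N := Cᵀ)]
  refine Finset.sum_congr rfl fun i _ => Finset.sum_congr rfl fun j _ => ?_
  rw [Matrix.transpose_single, Matrix.mul_apply, Finset.sum_eq_single i]
  · simp
  · intro b _ hb
    simp [Matrix.mul_single_apply_of_ne _ _ _ _ _ hb]
  · simp

end Trace

theorem trace_eq_zero_of_skew (hs : s * s = 1) {X : Mat n} (hX : adj s X = -X) : X.trace = 0 := by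
  have := trace_adj hs X
  rw [hX, Matrix.trace_neg] at this
  linarith

/-- The projection of the matrices onto the Lie algebra, along the self-adjoint matrices. -/
noncomputable def lieProj (hs : s * s = 1) : Mat n →ₗ[ℝ] lieAlg n s where
  toFun A := ⟨(1 / 2 : ℝ) • (A - adj s A), by
    rw [mem_lieAlg_iff hs, map_smul, map_sub, adj_adj hs, ← smul_neg, neg_sub]⟩
  map_add' A B := Subtype.ext <| by
    change (1 / 2 : ℝ) • (A + B - adj s (A + B))
      = (1 / 2 : ℝ) • (A - adj s A) + (1 / 2 : ℝ) • (B - adj s B)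
    rw [map_add]; module
  map_smul' c A := Subtype.ext <| by
    change (1 / 2 : ℝ) • (c • A - adj s (c • A)) = c • ((1 / 2 : ℝ) • (A - adj s A))
    rw [map_smul]; module

theorem coe_lieProj (hs : s * s = 1) (A : Mat n) :
    (lieProj hs A : Mat n) = (1 / 2 : ℝ) • (A - adj s A) := rfl

theorem lieProj_coe (hs : s * s = 1) (X : lieAlg n s) : lieProj hs (X : Mat n) = X := by
  ext1
  rw [coe_lieProj, (mem_lieAlg_iff hs).1 X.2, sub_neg_eq_add]
  module

/-- The double commutator `Z ↦ [X, [Y, Z]]` on all matrices. -/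
def adAd (X Y : Mat n) : Mat n →ₗ[ℝ] Mat n where
  toFun Z := X * (Y * Z - Z * Y) - (Y * Z - Z * Y) * X
  map_add' A B := by simp only [Matrix.mul_add, Matrix.add_mul, Matrix.mul_sub, Matrix.sub_mul]; abel
  map_smul' c A := by simp [Matrix.mul_sub, Matrix.sub_mul, smul_sub]

theorem adAd_apply (X Y Z : Mat n) :
    adAd X Y Z = X * (Y * Z - Z * Y) - (Y * Z - Z * Y) * X := rfl

/-- The Killing form of `so(2n+1)` and of `so(2n,1)` is `2n - 1` times the trace form. The trace of
`ad X ∘ ad Y` is computed on the space of all matrices, after composition with the projection onto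
the Lie algebra. -/
theorem killingForm_eq (hs : s * s = 1) (X Y : lieAlg n s) :
    killingForm ℝ (lieAlg n s) X Y = (2 * n - 1 : ℝ) * ((X : Mat n) * (Y : Mat n)).trace := by
  have hX := (mem_lieAlg_iff hs).1 X.2
  have hY := (mem_lieAlg_iff hs).1 Y.2
  set x : Mat n := (X : Mat n) with hx
  set y : Mat n := (Y : Mat n) with hy
  let incl : lieAlg n s →ₗ[ℝ] Mat n := (lieAlg n s).toSubmodule.subtype
  have h1 : LieAlgebra.ad ℝ (lieAlg n s) X ∘ₗ LieAlgebra.ad ℝ (lieAlg n s) Y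
      = lieProj hs ∘ₗ (adAd x y ∘ₗ incl) := by
    ext1 Z
    have : (adAd x y (Z : Mat n)) = ((⁅X, ⁅Y, Z⁆⁆ : lieAlg n s) : Mat n) := by
      rw [LieSubalgebra.coe_bracket, LieSubalgebra.coe_bracket]; rfl
    calc _ = ⁅X, ⁅Y, Z⁆⁆ := rfl
      _ = lieProj hs ((⁅X, ⁅Y, Z⁆⁆ : lieAlg n s) : Mat n) := (lieProj_coe hs _).symm
      _ = _ := by rw [← this]; rfl
  rw [killingForm_apply_apply, h1, LinearMap.trace_comp_comm', trace_end_matrix]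
  have h2 : ∀ Z : Mat n, ((adAd x y ∘ₗ incl) ∘ₗ lieProj hs) Z
      = (1 / 2 : ℝ) • (x * y * Z * 1 - x * Z * y - y * Z * x + 1 * Z * (y * x)
        - (x * y * gram n s) * Zᵀ * gram n s + (x * gram n s) * Zᵀ * (gram n s * y)
        + (y * gram n s) * Zᵀ * (gram n s * x) - gram n s * Zᵀ * (gram n s * y * x)) := by
    intro Z
    have : incl (lieProj hs Z) = (1 / 2 : ℝ) • (Z - gram n s * Zᵀ * gram n s) := rfl
    simp only [LinearMap.comp_apply, this, map_smul, adAd_apply]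
    congr 1
    simp only [Matrix.mul_sub, Matrix.sub_mul, Matrix.mul_assoc, Matrix.one_mul, Matrix.mul_one]
    abel
  simp only [h2, Matrix.smul_apply, Matrix.add_apply, Matrix.sub_apply, smul_eq_mul,
    ← Finset.mul_sum, Finset.sum_add_distrib, Finset.sum_sub_distrib, sum_mul_single_mul,
    sum_mul_single_transpose_mul]
  have tx := trace_eq_zero_of_skew hs hX
  have ty := trace_eq_zero_of_skew hs hY
  have e1 : (1 : Mat n).trace = 2 * n + 1 := by simp [Matrix.trace_one]
  have e2 : (y * x).trace = (x * y).trace := Matrix.trace_mul_comm _ _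
  have e3 : (x * y * gram n s * (gram n s)ᵀ).trace = (x * y).trace := by
    rw [gram_transpose, Matrix.mul_assoc (x * y), gram_mul_gram hs, Matrix.mul_one]
  have key : ∀ a b : Mat n, adj s b = -b →
      (a * gram n s * (gram n s * b)ᵀ).trace = -(a * b).trace := by
    intro a b hb
    rw [Matrix.transpose_mul, gram_transpose]
    calc (a * gram n s * (bᵀ * gram n s)).trace = (a * adj s b).trace := by
          rw [adj_apply]; simp only [Matrix.mul_assoc]
      _ = _ := by rw [hb, Matrix.mul_neg, Matrix.trace_neg]
  have e4 : (gram n s * (gram n s * y * x)ᵀ).trace = (x * y).trace := by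
    calc (gram n s * (gram n s * y * x)ᵀ).trace
        = ((gram n s * gram n s) * gram n s * (gram n s * y * x)ᵀ).trace := by
          rw [gram_mul_gram hs, Matrix.one_mul]
      _ = (adj s (y * x)).trace := by
          rw [adj_apply, Matrix.mul_assoc (gram n s) y x, Matrix.transpose_mul, gram_transpose,
            gram_mul_gram hs, Matrix.one_mul, Matrix.mul_assoc]
      _ = (x * y).trace := by rw [trace_adj hs, e2]
  rw [tx, ty, e1, e2, e3, key x y hY, key y x hX, e4, e2]
  ring

theorem coe_lieIncl (Y : so2n n) :
    (lieIncl n s Y : Mat n) = Matrix.fromBlocks (Y : Matrix (Idx n) (Idx n) ℝ) 0 0 0 := rfl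

theorem lieIncl_stdJ : (lieIncl n s (stdJ n) : Mat n) = Jhat n := rfl

theorem covec_apply (hs : s * s = 1) (Y : so2n n) :
    covec n s Y = (2 * n - 1 : ℝ) * (Jhat n * (lieIncl n s Y : Mat n)).trace := by
  rw [covec, LinearMap.comp_apply, killingForm_eq hs, lieIncl_stdJ]

theorem coe_soPart (X : Mat n) : (soPart n X : Matrix (Idx n) (Idx n) ℝ)
    = (1 / 2 : ℝ) • (X.toBlocks₁₁ - X.toBlocks₁₁ᵀ) := rfl

theorem covec_soPart (hs : s * s = 1) (X : Mat n) :
    covec n s (soPart n X) = (2 * n - 1 : ℝ) * (Jhat n * X).trace := by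
  rw [covec_apply hs, coe_lieIncl, coe_soPart]
  congr 1
  have h : (matJ n * X.toBlocks₁₁ᵀ).trace = -(matJ n * X.toBlocks₁₁).trace := by
    rw [← Matrix.trace_transpose, Matrix.transpose_mul, Matrix.transpose_transpose,
      matJ_transpose, Matrix.mul_neg, Matrix.trace_neg, Matrix.trace_mul_comm]
  nth_rewrite 3 [← Matrix.fromBlocks_toBlocks X]
  rw [Jhat, Matrix.fromBlocks_multiply, Matrix.fromBlocks_multiply]
  simp only [Matrix.trace, Matrix.diag_apply] at h
  simp only [Matrix.trace, Matrix.diag_apply, Fintype.sum_sum_type, Matrix.fromBlocks_apply₁₁,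
    Matrix.fromBlocks_apply₂₂]
  simp [Matrix.mul_sub, Finset.sum_sub_distrib, ← Finset.mul_sum, h]
  ring

theorem covec_const_ne_zero (hn : 1 ≤ n) : (2 * n - 1 : ℝ) ≠ 0 := by
  have : (1 : ℝ) ≤ n := by exact_mod_cast hn
  linarith

open Filter Topology

/- The entrywise sup norm, whose topology is the product topology of matrices. -/
attribute [local instance] Matrix.normedAddCommGroup Matrix.normedSpace

/-! ### Calculus with matrices -/

section Calculus

variable {E : Type*} [NormedAddCommGroup E] [NormedSpace ℝ E] {f g : E → Mat n} {x : E}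
  {k : WithTop ℕ∞}

theorem isBoundedBilinearMap_matMul :
    IsBoundedBilinearMap ℝ (fun p : Mat n × Mat n => p.1 * p.2) :=
  ((LinearMap.mul ℝ (Mat n)).toContinuousBilinearMap).isBoundedBilinearMap

theorem contDiffAt_mat_iff :
    ContDiffAt ℝ k f x ↔ ∀ i j, ContDiffAt ℝ k (fun y => f y i j) x :=
  (contDiffAt_pi (Φ := f)).trans (forall_congr' fun i => contDiffAt_pi (Φ := fun y => f y i))

theorem contDiff_mat_iff :
    ContDiff ℝ k f ↔ ∀ i j, ContDiff ℝ k (fun y => f y i j) :=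
  (contDiff_pi (Φ := f)).trans (forall_congr' fun i => contDiff_pi (Φ := fun y => f y i))

theorem hasDerivAt_mat_iff {f : ℝ → Mat n} {f' : Mat n} {t : ℝ} :
    HasDerivAt f f' t ↔ ∀ i j, HasDerivAt (fun y => f y i j) (f' i j) t :=
  (hasDerivAt_pi (φ := f)).trans (forall_congr' fun i => hasDerivAt_pi (φ := fun y => f y i))

theorem contDiffAt_matMul (hf : ContDiffAt ℝ k f x) (hg : ContDiffAt ℝ k g x) :
    ContDiffAt ℝ k (fun y => f y * g y) x :=
  (isBoundedBilinearMap_matMul.contDiff.contDiffAt).comp x (hf.prodMk hg)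

theorem contDiffAt_det {ι : Type*} [Fintype ι] [DecidableEq ι] {f : E → Matrix ι ι ℝ}
    (hf : ∀ i j, ContDiffAt ℝ k (fun y => f y i j) x) :
    ContDiffAt ℝ k (fun y => (f y).det) x := by
  simp only [Matrix.det_apply]
  exact ContDiffAt.sum fun σ _ => ContDiffAt.const_smul _ (contDiffAt_prod fun i _ => hf _ _)

theorem contDiffAt_matInv (hf : ContDiffAt ℝ k f x) (hx : (f x).det ≠ 0) :
    ContDiffAt ℝ k (fun y => (f y)⁻¹) x := by
  rw [contDiffAt_mat_iff] at hf ⊢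
  intro i j
  have h : ∀ y, (f y)⁻¹ i j = ((f y).det)⁻¹ * ((f y).updateRow j (Pi.single i 1)).det := by
    intro y
    rw [Matrix.inv_def, Matrix.smul_apply, Matrix.adjugate_apply, Ring.inverse_eq_inv', smul_eq_mul]
  simp only [h]
  refine ((contDiffAt_det hf).inv hx).mul (contDiffAt_det fun a b => ?_)
  by_cases ha : a = j
  · subst ha
    simpa using contDiffAt_const
  · simpa [Matrix.updateRow_ne ha] using hf a b

/-- The adjoint as a continuous linear map. -/
noncomputable def adjL (n : ℕ) (s : ℝ) : Mat n →L[ℝ] Mat n := LinearMap.toContinuousLinearMap (adj s)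

theorem hasDerivAt_matMul {f g : ℝ → Mat n} {f' g' : Mat n} {t : ℝ} (hf : HasDerivAt f f' t)
    (hg : HasDerivAt g g' t) : HasDerivAt (fun y => f y * g y) (f t * g' + f' * g t) t := by
  have := (isBoundedBilinearMap_matMul.hasFDerivAt (f t, g t)).comp_hasDerivAt t (hf.prodMk hg)
  exact this

theorem hasDerivAt_matAdj {f : ℝ → Mat n} {f' : Mat n} {t : ℝ} (hf : HasDerivAt f f' t) :
    HasDerivAt (fun y => adj s (f y)) (adj s f') t :=
  (adjL n s).hasFDerivAt.comp_hasDerivAt t hf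

theorem hasDerivAt_matInv {f : ℝ → Mat n} {f' : Mat n} {t : ℝ} (hf : HasDerivAt f f' t)
    (hd : ContDiffAt ℝ 1 f t) (ht : (f t).det ≠ 0) :
    HasDerivAt (fun y => (f y)⁻¹) (-((f t)⁻¹ * f' * (f t)⁻¹)) t := by
  have h1 : ∀ᶠ y in 𝓝 t, (f y).det ≠ 0 :=
    ((contDiffAt_det (contDiffAt_mat_iff.1 hd)).continuousAt).eventually_ne ht
  have h2 := ((contDiffAt_matInv hd ht).differentiableAt one_ne_zero).hasDerivAt
  set e := deriv (fun y => (f y)⁻¹) t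
  have h3 : HasDerivAt (fun y => (f y)⁻¹ * f y) 0 t := by
    refine (hasDerivAt_const t (1 : Mat n)).congr_of_eventuallyEq ?_
    filter_upwards [h1] with y hy using Matrix.nonsing_inv_mul _ (isUnit_iff_ne_zero.2 hy)
  have h4 := (hasDerivAt_matMul h2 hf).unique h3
  have h5 : e = -((f t)⁻¹ * f' * (f t)⁻¹) := by
    have h6 : e * f t = -((f t)⁻¹ * f') := eq_neg_of_add_eq_zero_right h4
    calc e = e * f t * (f t)⁻¹ := by
          rw [Matrix.mul_assoc, Matrix.mul_nonsing_inv _ (isUnit_iff_ne_zero.2 ht), Matrix.mul_one]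
      _ = _ := by rw [h6, Matrix.neg_mul]
  rwa [← h5]

end Calculus

/-! ### The Cayley transform -/

/-- The Cayley transform, normalized so that its differential at zero is the identity. -/
noncomputable def cay (X : Mat n) : Mat n := (1 + (1 / 2 : ℝ) • X) * (1 - (1 / 2 : ℝ) • X)⁻¹

/-- The domain of the Cayley transform. -/
def cayDom (n : ℕ) : Set (Mat n) := {X | (1 - (1 / 2 : ℝ) • X).det ≠ 0}

theorem isOpen_cayDom : IsOpen (cayDom n) := by
  have : Continuous fun X : Mat n => (1 - (1 / 2 : ℝ) • X).det := by fun_prop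
  exact isOpen_ne.preimage this

theorem zero_mem_cayDom : (0 : Mat n) ∈ cayDom n := by simp [cayDom]

@[simp] theorem cay_zero : cay (0 : Mat n) = 1 := by simp [cay]

theorem contDiffAt_cay {X : Mat n} (hX : X ∈ cayDom n) {k : WithTop ℕ∞} :
    ContDiffAt ℝ k (cay (n := n)) X :=
  contDiffAt_matMul (contDiffAt_const.add (contDiffAt_id.const_smul _))
    (contDiffAt_matInv (contDiffAt_const.sub (contDiffAt_id.const_smul _)) hX)

theorem cay_mul {X : Mat n} (hX : X ∈ cayDom n) :
    cay X * (1 - (1 / 2 : ℝ) • X) = 1 + (1 / 2 : ℝ) • X := by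
  rw [cay, Matrix.mul_assoc, Matrix.nonsing_inv_mul _ (isUnit_iff_ne_zero.2 hX), Matrix.mul_one]

theorem hasDerivAt_add_smul (A Y : Mat n) (t : ℝ) :
    HasDerivAt (fun t : ℝ => A + t • Y) Y t := by
  rw [hasDerivAt_mat_iff]
  intro i j
  simpa using ((hasDerivAt_id t).mul_const (Y i j)).const_add (A i j)

theorem contDiff_add_smul (A Y : Mat n) {k : WithTop ℕ∞} :
    ContDiff ℝ k (fun t : ℝ => A + t • Y) :=
  contDiff_const.add (contDiff_id.smul contDiff_const)

theorem hasDerivAt_cay_smul (X : Mat n) : HasDerivAt (fun t : ℝ => cay (t • X)) X 0 := by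
  have e : (fun t : ℝ => cay (t • X)) =
      fun t : ℝ => (1 + t • ((1 / 2 : ℝ) • X)) * (1 + t • (-((1 / 2 : ℝ) • X)))⁻¹ := by
    funext t
    rw [cay, smul_neg, ← sub_eq_add_neg, smul_comm t]
  rw [e]
  have h3 := hasDerivAt_matMul (hasDerivAt_add_smul 1 ((1 / 2 : ℝ) • X) 0)
    (hasDerivAt_matInv (hasDerivAt_add_smul 1 (-((1 / 2 : ℝ) • X)) 0)
      (contDiff_add_smul _ _).contDiffAt (by simp))
  convert h3 using 1
  simp only [zero_smul, add_zero, inv_one, Matrix.one_mul, Matrix.mul_one]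
  module

variable (hs : s * s = 1)

include hs in
theorem adj_cay_mul_cay {X : Mat n} (hX : X ∈ cayDom n) (h : adj s X = -X) :
    adj s (cay X) * cay X = 1 := by
  set P : Mat n := 1 + (1 / 2 : ℝ) • X
  set M : Mat n := 1 - (1 / 2 : ℝ) • X
  have hM : adj s M = P := by
    simp only [M, P, map_sub, map_smul, adj_one hs, h]; module
  have hP : adj s P = M := by
    simp only [M, P, map_add, map_smul, adj_one hs, h]; module
  have hcomm : M * P = P * M := by
    simp only [M, P, Matrix.mul_add, Matrix.add_mul, Matrix.mul_sub, Matrix.sub_mul,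
      Matrix.one_mul, Matrix.mul_one]
    abel
  have hMu : IsUnit M.det := isUnit_iff_ne_zero.2 hX
  have hPu : IsUnit P.det := by rwa [← hM, det_adj hs]
  have h1 : P * adj s (cay X) = M := by
    have := congrArg (adj s) (cay_mul hX)
    rwa [adj_mul hs, hM, hP] at this
  have h2 : P * (adj s (cay X) * cay X) * M = P * 1 * M := by
    rw [← Matrix.mul_assoc, h1, Matrix.mul_assoc, cay_mul hX, hcomm, Matrix.mul_one]
  have h3 := (Matrix.isUnit_iff_isUnit_det M |>.2 hMu).mul_right_cancel h2
  exact (Matrix.isUnit_iff_isUnit_det P |>.2 hPu).mul_left_cancel h3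

include hs in
theorem det_cay {X : Mat n} (hX : X ∈ cayDom n) (h : adj s X = -X) : (cay X).det = 1 := by
  have hM : adj s (1 - (1 / 2 : ℝ) • X) = 1 + (1 / 2 : ℝ) • X := by
    simp only [map_sub, map_smul, adj_one hs, h]; module
  have := congrArg Matrix.det (cay_mul hX)
  rw [Matrix.det_mul, ← hM, det_adj hs] at this
  exact mul_right_cancel₀ hX (this.trans (one_mul _).symm)

open Classical in
/-- The Cayley transform as a map to the group, with the value `1` where it does not apply. -/
noncomputable def cayGrp (X : Mat n) : grp n s :=
  if h : adj s X = -X ∧ X ∈ cayDom n then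
    mkGrp hs (cay X) (adj_cay_mul_cay hs h.2 h.1) (det_cay hs h.2 h.1) else 1

theorem toMat_cayGrp {X : Mat n} (h : adj s X = -X) (hX : X ∈ cayDom n) :
    toMat (cayGrp hs X) = cay X := by
  rw [cayGrp, dif_pos ⟨h, hX⟩, toMat_mkGrp]

@[simp] theorem cayGrp_zero : cayGrp hs (0 : Mat n) = 1 :=
  toMat_injective (by rw [toMat_cayGrp hs (by simp) zero_mem_cayDom]; simp)

theorem eventually_smul_mem_cayDom (X : Mat n) : ∀ᶠ t : ℝ in 𝓝 0, t • X ∈ cayDom n := by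
  have h : Continuous fun t : ℝ => t • X := by fun_prop
  exact h.continuousAt.eventually (isOpen_cayDom.mem_nhds (by simpa using zero_mem_cayDom))

theorem hasDerivAt_toMat_cayGrp {X : Mat n} (h : adj s X = -X) :
    HasDerivAt (fun t : ℝ => toMat (cayGrp hs (t • X))) X 0 := by
  refine (hasDerivAt_cay_smul X).congr_of_eventuallyEq ?_
  filter_upwards [eventually_smul_mem_cayDom X] with t ht
  exact toMat_cayGrp hs (by rw [map_smul, h, smul_neg]) ht

theorem cayGrp_mem_subSO {X : Mat n} (h : X * lastProj n = 0) : cayGrp hs X ∈ subSO n s := by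
  by_cases hX : adj s X = -X ∧ X ∈ cayDom n
  · refine mem_subSO_of_fix hs _ ?_
    rw [toMat_cayGrp hs hX.1 hX.2]
    have h1 : (1 - (1 / 2 : ℝ) • X) * lastProj n = lastProj n := by simp [Matrix.sub_mul, h]
    have h2 : (1 + (1 / 2 : ℝ) • X) * lastProj n = lastProj n := by simp [Matrix.add_mul, h]
    rw [← h1, ← Matrix.mul_assoc, cay_mul hX.2, h1, h2]
  · rw [cayGrp, dif_neg hX]; exact one_mem _

theorem cayGrp_mem_subU {X : Mat n} (h : X * Jhat n = Jhat n * X) : cayGrp hs X ∈ subU n s := by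
  by_cases hX : adj s X = -X ∧ X ∈ cayDom n
  · refine mem_subU_of_fix hs _ (mul_lastProj_of_mem_subSO (cayGrp_mem_subSO hs
      (mul_lastProj_eq_zero hs hX.1 h))) ?_
    rw [toMat_cayGrp hs hX.1 hX.2]
    have hu := Matrix.isUnit_iff_isUnit_det _ |>.2 (isUnit_iff_ne_zero.2 hX.2)
    refine hu.mul_right_cancel ?_
    rw [Matrix.mul_assoc, Matrix.mul_assoc, cay_mul hX.2, Matrix.mul_sub, Matrix.mul_smul, ← h]
    have h3 : Jhat n * 1 - (1 / 2 : ℝ) • (X * Jhat n) = (1 - (1 / 2 : ℝ) • X) * Jhat n := by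
      simp [Matrix.sub_mul]
    rw [h3, ← Matrix.mul_assoc, cay_mul hX.2, Matrix.mul_add, Matrix.mul_smul, ← h]
    simp [Matrix.add_mul]
  · rw [cayGrp, dif_neg hX]; exact one_mem _

/-! ### The canonical connection and its curvature -/

theorem adj_mul_skew_of_curve (hs : s * s = 1) {c : ℝ → Mat n} {c' : Mat n} {t : ℝ}
    (hc : HasDerivAt c c' t) (h : ∀ᶠ y in 𝓝 t, adj s (c y) * c y = 1) :
    adj s (adj s (c t) * c') = -(adj s (c t) * c') := by
  have h1 := hasDerivAt_matMul (hasDerivAt_matAdj (s := s) hc) hc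
  have h2 : HasDerivAt (fun y => adj s (c y) * c y) 0 t :=
    (hasDerivAt_const t (1 : Mat n)).congr_of_eventuallyEq h
  rw [adj_mul hs, adj_adj hs]
  exact eq_neg_of_add_eq_zero_right (h1.unique h2)

theorem skew_of_mem_tangentSet (hs : s * s = 1) (g : grp n s) {v : Mat n}
    (hv : v ∈ tangentSet (grpSet n s) (toMat g)) :
    adj s (toMat g⁻¹ * v) = -(toMat g⁻¹ * v) := by
  obtain ⟨c, hc, hS, h0, hd⟩ := hv
  have h1 : HasDerivAt c v 0 := by
    rw [hasDerivAt_mat_iff]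
    intro i j
    rw [← hd i j]
    exact ((hc i j).differentiable (by simp)).differentiableAt.hasDerivAt
  have h2 := adj_mul_skew_of_curve hs h1 (Eventually.of_forall fun t => by
    obtain ⟨k, hk⟩ := hS t
    rw [← hk, adj_toMat_mul hs])
  rwa [h0, ← toMat_inv hs] at h2

/-- Left translates of Lie algebra elements are tangent to the group. The curve is a Cayley
transform, with the time confined by a sine to the domain of that transform. -/
theorem mul_mem_tangentSet (hs : s * s = 1) (g : grp n s) {X : Mat n} (hX : adj s X = -X) :
    toMat g * X ∈ tangentSet (grpSet n s) (toMat g) := by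
  obtain ⟨ε, hε, hball⟩ := Metric.eventually_nhds_iff.1 (eventually_smul_mem_cayDom X)
  set φ : ℝ → ℝ := fun t => ε / 2 * Real.sin (t / (ε / 2))
  have hφs : ContDiff ℝ ∞ φ := contDiff_const.mul (Real.contDiff_sin.comp (contDiff_id.div_const _))
  have hφd : HasDerivAt φ 1 0 := by
    have h1 : HasDerivAt (fun t : ℝ => t / (ε / 2)) (1 / (ε / 2)) 0 := (hasDerivAt_id _).div_const _
    have h2 := ((Real.hasDerivAt_sin _).comp (0 : ℝ) h1).const_mul (ε / 2)
    have e : ε / 2 * (Real.cos (0 / (ε / 2)) * (1 / (ε / 2))) = 1 := by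
      rw [zero_div, Real.cos_zero]; field_simp
    rw [e] at h2
    exact h2
  have hφb : ∀ t, φ t • X ∈ cayDom n := by
    intro t
    refine hball ?_
    rw [Real.dist_eq, sub_zero, abs_mul, abs_of_pos (half_pos hε)]
    calc ε / 2 * |Real.sin (t / (ε / 2))| ≤ ε / 2 * 1 := by
          gcongr; exact Real.abs_sin_le_one _
      _ < ε := by linarith
  have hφ0 : φ 0 = 0 := by simp [φ]
  refine ⟨fun t => toMat g * cay (φ t • X), ?_, fun t => ⟨g * cayGrp hs (φ t • X), ?_⟩, ?_, ?_⟩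
  · rw [← contDiff_mat_iff, contDiff_iff_contDiffAt]
    intro t
    have h1 : ContDiffAt ℝ ∞ (fun t => φ t • X) t := hφs.contDiffAt.smul contDiffAt_const
    exact contDiffAt_matMul contDiffAt_const
      (ContDiffAt.comp (g := cay) t (contDiffAt_cay (hφb t)) h1)
  · rw [toMat_mul, toMat_cayGrp hs (by rw [map_smul, hX, smul_neg]) (hφb t)]
  · simp [hφ0]
  · intro i j
    have h1 : HasDerivAt (fun t => cay (φ t • X)) ((1 : ℝ) • X) 0 := by
      have := hasDerivAt_cay_smul X
      rw [← hφ0] at this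
      exact this.scomp (0 : ℝ) hφd
    have h2 := hasDerivAt_matMul (hasDerivAt_const (0 : ℝ) (toMat g)) h1
    rw [Matrix.zero_mul, add_zero, one_smul] at h2
    exact (hasDerivAt_mat_iff.1 h2 i j).deriv

theorem canonicalForm_apply (g : grp n s) (v : Mat n) :
    canonicalForm n (toMat g) v = soPart n (toMat g⁻¹ * v) := by
  rw [← inv_toMat]; rfl

theorem lineDeriv_canonicalForm (hs : s * s = 1) (g : grp n s) (v w : Mat n) :
    lineDeriv ℝ (fun A => covec n s (canonicalForm n A w)) (toMat g) v =
      -((2 * n - 1 : ℝ) * (Jhat n * ((toMat g⁻¹ * v) * (toMat g⁻¹ * w))).trace) := by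
  have h1 : ∀ A : Mat n, covec n s (canonicalForm n A w)
      = (2 * n - 1 : ℝ) * (Jhat n * (A⁻¹ * w)).trace := fun A => covec_soPart hs _
  have h2 := hasDerivAt_matInv (hasDerivAt_add_smul (toMat g) v 0)
    (contDiff_add_smul _ _).contDiffAt (by rw [zero_smul, add_zero, det_toMat]; exact one_ne_zero)
  have h3 := hasDerivAt_matMul h2 (hasDerivAt_const (0 : ℝ) w)
  let T : Mat n →L[ℝ] ℝ := LinearMap.toContinuousLinearMap
    ((2 * n - 1 : ℝ) • (Matrix.traceLinearMap (Idx n ⊕ Unit) ℝ ℝ).comp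
      (LinearMap.mulLeft ℝ (Jhat n)))
  have h4 : ∀ A : Mat n, T A = (2 * n - 1 : ℝ) * (Jhat n * A).trace := fun A => rfl
  have h5 := T.hasFDerivAt.comp_hasDerivAt (0 : ℝ) h3
  rw [lineDeriv]
  simp only [h1, ← h4]
  rw [← map_neg]
  refine h5.deriv.trans ?_
  congr 1
  simp only [zero_smul, add_zero, Matrix.mul_zero, zero_add, inv_toMat, Matrix.neg_mul,
    Matrix.mul_assoc]

/-- On `Θ(gξ, gζ)` the covector takes, up to the term that vanishes on horizontal vectors, the value
`-B(J, [ξ, ζ])`. -/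
theorem couplingLift_eq (hs : s * s = 1) (g : grp n s) (v w : Mat n) :
    couplingLift (canonicalForm n) (covec n s) (toMat g) v w =
      -((2 * n - 1 : ℝ) * (Jhat n * ((toMat g⁻¹ * v) * (toMat g⁻¹ * w)
        - (toMat g⁻¹ * w) * (toMat g⁻¹ * v))).trace) := by
  rw [couplingLift, curvaturePairing, lineDeriv_canonicalForm hs, lineDeriv_canonicalForm hs,
    Matrix.mul_sub, Matrix.trace_sub]
  ring

theorem blockIncl_inv {B : Matrix (Idx n) (Idx n) ℝ}
    (hB : B ∈ Matrix.specialOrthogonalGroup (Idx n) ℝ) :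
    B⁻¹ = Bᵀ ∧ ∀ h : grp n s, toMat h = blockIncl B → toMat h⁻¹ = blockIncl Bᵀ := by
  have hBB' : Bᵀ * B = 1 := (Matrix.mem_orthogonalGroup_iff' (Idx n) ℝ).1
    (Matrix.mem_specialOrthogonalGroup_iff.1 hB).1
  refine ⟨Matrix.inv_eq_left_inv hBB', fun h hh => ?_⟩
  rw [← inv_toMat, hh]
  refine Matrix.inv_eq_left_inv ?_
  rw [blockIncl, blockIncl, Matrix.fromBlocks_multiply]
  simp [hBB']

theorem toBlocks₁₁_skew (hs : s * s = 1) {X : Mat n} (hX : adj s X = -X) :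
    X.toBlocks₁₁ᵀ = -X.toBlocks₁₁ := by
  rw [← Matrix.fromBlocks_toBlocks X, adj_fromBlocks _ _ _ _ hs, Matrix.fromBlocks_neg,
    Matrix.fromBlocks_inj] at hX
  exact hX.1

theorem coe_soPart_of_skew (hs : s * s = 1) {X : Mat n} (hX : adj s X = -X) :
    (soPart n X : Matrix (Idx n) (Idx n) ℝ) = X.toBlocks₁₁ := by
  rw [coe_soPart, toBlocks₁₁_skew hs hX]
  module

theorem isCanonicalConnection_canonicalForm (hn : 1 ≤ n) (hs : s * s = 1) :
    IsCanonicalConnection n s (canonicalForm n) where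
  smooth := by
    refine ⟨{A | (Matrix.of A : Mat n).det ≠ 0}, ?_, fun g => ?_, fun v i j A hA => ?_⟩
    · have : Continuous fun A : Amb n => (Matrix.of A : Mat n).det :=
        (Continuous.matrix_det (A := fun A : Mat n => A) continuous_id)
      exact isOpen_ne.preimage this
    · change (toMat g).det ≠ 0
      rw [det_toMat]; exact one_ne_zero
    · refine ContDiffAt.contDiffWithinAt ?_
      have h1 : ContDiffAt ℝ ∞ (fun A : Mat n => A⁻¹ * v) (Matrix.of A) :=
        contDiffAt_matMul (contDiffAt_matInv contDiffAt_id hA) contDiffAt_const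
      rw [contDiffAt_mat_iff] at h1
      have h2 : ContDiffAt ℝ ∞ (fun A : Mat n => (1 / 2 : ℝ) *
          ((A⁻¹ * v) (Sum.inl i) (Sum.inl j) - (A⁻¹ * v) (Sum.inl j) (Sum.inl i))) (Matrix.of A) :=
        contDiffAt_const.mul ((h1 _ _).sub (h1 _ _))
      exact h2
  reproducing g Y := by
    rw [canonicalForm_apply, ← Matrix.mul_assoc, toMat_inv_mul, Matrix.one_mul]
    ext1
    rw [coe_soPart_of_skew hs ((mem_lieAlg_iff hs).1 (lieIncl n s Y).2), coe_lieIncl,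
      Matrix.toBlocks_fromBlocks₁₁]
  equivariant g h B hB hh v _ := by
    obtain ⟨hinv, hblock⟩ := blockIncl_inv (s := s) hB
    have e : toMat (g * h)⁻¹ * (v * toMat h)
        = blockIncl Bᵀ * (toMat g⁻¹ * v) * blockIncl B := by
      rw [mul_inv_rev, toMat_mul, hblock h hh, hh]; simp only [Matrix.mul_assoc]
    have e2 : ∀ X : Mat n, (blockIncl Bᵀ * X * blockIncl B).toBlocks₁₁
        = Bᵀ * X.toBlocks₁₁ * B := by
      intro X
      conv_lhs => rw [← Matrix.fromBlocks_toBlocks X, blockIncl, blockIncl,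
        Matrix.fromBlocks_multiply, Matrix.fromBlocks_multiply, Matrix.toBlocks_fromBlocks₁₁]
      simp
    rw [canonicalForm_apply, canonicalForm_apply, e, coe_soPart, coe_soPart, e2, hinv]
    simp only [Matrix.transpose_mul, Matrix.transpose_transpose, Matrix.mul_smul, Matrix.smul_mul,
      Matrix.mul_sub, Matrix.sub_mul, Matrix.mul_assoc]
  left_invariant a g v _ := by
    rw [canonicalForm_apply, canonicalForm_apply, mul_inv_rev, toMat_mul, Matrix.mul_assoc,
      ← Matrix.mul_assoc _ (toMat a), toMat_inv_mul, Matrix.one_mul]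
  horizontal X := by
    have hX := (mem_lieAlg_iff hs).1 X.2
    have h1 : canonicalForm n 1 (X : Mat n) = soPart n (X : Mat n) := by
      have := canonicalForm_apply (1 : grp n s) (X : Mat n)
      rwa [inv_one, toMat_one, Matrix.one_mul] at this
    have h2 : ∀ Y : so2n n, killingForm ℝ (lieAlg n s) X (lieIncl n s Y)
        = (2 * n - 1 : ℝ) * ((soPart n (X : Mat n) : Matrix (Idx n) (Idx n) ℝ)
          * (Y : Matrix (Idx n) (Idx n) ℝ)).trace := by
      intro Y
      rw [killingForm_eq hs, coe_soPart_of_skew hs hX, coe_lieIncl]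
      conv_lhs => rw [← Matrix.fromBlocks_toBlocks (X : Mat n)]
      rw [Matrix.fromBlocks_multiply]
      simp [Matrix.trace, Fintype.sum_sum_type]
    rw [h1]
    constructor
    · intro h Y
      rw [h2, h]; simp
    · intro h
      have h3 := (mul_eq_zero.1 ((h2 _).symm.trans (h (soPart n (X : Mat n))))).resolve_left
        (covec_const_ne_zero hn)
      have h4 := (LieAlgebra.Orthogonal.mem_so (Idx n) ℝ _).1 (soPart n (X : Mat n)).2
      set Y := (soPart n (X : Mat n) : Matrix (Idx n) (Idx n) ℝ) with hY
      have h5 : (Y * Yᴴ).trace = 0 := by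
        rw [Matrix.conjTranspose_eq_transpose_of_trivial, h4, Matrix.mul_neg, Matrix.trace_neg, h3,
          neg_zero]
      exact Subtype.ext (Matrix.trace_mul_conjTranspose_self_eq_zero_iff.1 h5)

theorem soPart_eq_zero_iff (hs : s * s = 1) {X : Mat n} (hX : adj s X = -X) :
    soPart n X = 0 ↔ X.toBlocks₁₁ = 0 := by
  rw [← coe_soPart_of_skew hs hX]
  exact ⟨fun h => by rw [h]; rfl, fun h => Subtype.ext h⟩

theorem toBlocks₂₂_skew (hs : s * s = 1) {X : Mat n} (hX : adj s X = -X) : X.toBlocks₂₂ = 0 := by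
  have h := lastProj_mul_mul_lastProj hs hX
  rw [← Matrix.fromBlocks_toBlocks X, lastProj, Matrix.fromBlocks_multiply,
    Matrix.fromBlocks_multiply, ← Matrix.fromBlocks_zero, Matrix.fromBlocks_inj] at h
  simpa using h.2.2.2

theorem commutator_trace (A X Y : Mat n) :
    (A * (X * Y - Y * X)).trace = ((A * X - X * A) * Y).trace := by
  rw [Matrix.mul_sub, Matrix.sub_mul, Matrix.trace_sub, Matrix.trace_sub, ← Matrix.mul_assoc,
    ← Matrix.mul_assoc A Y, Matrix.trace_mul_comm (A * Y) X]
  simp only [Matrix.mul_assoc]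

/-- For a horizontal `ξ` the commutator `ζ = [J, ξ]` is horizontal as well, and
`B(J, [ξ, ζ]) = B(ζ, ζ)` is definite. -/
theorem isFat_covec (hn : 1 ≤ n) (hs : s * s = 1) :
    IsFat (grpSet n s) (canonicalForm n) (covec n s) := by
  rintro _ ⟨g, rfl⟩ v hv hθ hall
  have hξ := skew_of_mem_tangentSet hs g hv
  set ξ := toMat g⁻¹ * v with hξdef
  have hv' : v = toMat g * ξ := by
    rw [hξdef, ← Matrix.mul_assoc, toMat_mul_inv, Matrix.one_mul]
  rw [canonicalForm_apply, ← hξdef, soPart_eq_zero_iff hs hξ] at hθ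
  have hξ22 := toBlocks₂₂_skew hs hξ
  have hξb := Matrix.fromBlocks_toBlocks ξ
  rw [hθ, hξ22] at hξb
  have hξadj := hξ
  rw [← hξb, adj_fromBlocks _ _ _ _ hs, Matrix.fromBlocks_neg, Matrix.fromBlocks_inj] at hξadj
  set b := ξ.toBlocks₁₂ with hb
  have hc : ξ.toBlocks₂₁ = -(s • bᵀ) := (neg_eq_iff_eq_neg.1 hξadj.2.2.1.symm)
  set ζ := Jhat n * ξ - ξ * Jhat n with hζdef
  have hζ : adj s ζ = -ζ := adj_commutator hs (adj_Jhat hs) hξ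
  have hζb : ζ = Matrix.fromBlocks 0 (matJ n * b) (s • (bᵀ * matJ n)) 0 := by
    rw [hζdef, ← hξb, Jhat, Matrix.fromBlocks_multiply, Matrix.fromBlocks_multiply,
      sub_eq_add_neg, Matrix.fromBlocks_neg, Matrix.fromBlocks_add, hc]
    simp
  have hζ11 : ζ.toBlocks₁₁ = 0 := by rw [hζb, Matrix.toBlocks_fromBlocks₁₁]
  have h1 := hall (toMat g * ζ) (mul_mem_tangentSet hs g hζ) (by
    rw [canonicalForm_apply, ← Matrix.mul_assoc, toMat_inv_mul, Matrix.one_mul,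
      soPart_eq_zero_iff hs hζ, hζ11])
  have h2 := couplingLift_eq hs g v (toMat g * ζ)
  have h3 : canonicalForm n (toMat g) v = 0 := by
    rw [canonicalForm_apply, ← hξdef, soPart_eq_zero_iff hs hξ, hθ]
  rw [couplingLift, h1, h3, zero_lie, map_zero, sub_zero, ← hξdef,
    ← Matrix.mul_assoc (toMat g⁻¹) (toMat g), toMat_inv_mul, Matrix.one_mul, commutator_trace, ← hζdef,
    eq_comm, neg_eq_zero] at h2
  have h4 := (mul_eq_zero.1 h2).resolve_left (covec_const_ne_zero hn)
  set a := matJ n * b with ha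
  have h5 : bᵀ * matJ n = -aᵀ := by
    rw [ha, Matrix.transpose_mul, matJ_transpose, Matrix.mul_neg, neg_neg]
  have h6 : (a * aᴴ).trace = 0 := by
    have e : (ζ * ζ).trace = -(2 * s) * (a * aᵀ).trace := by
      have e1 : ∑ i, (aᵀ * a) i i = ∑ i, (a * aᵀ) i i := Matrix.trace_mul_comm aᵀ a
      rw [hζb, h5, Matrix.fromBlocks_multiply]
      simp only [Matrix.trace, Matrix.diag_apply, Fintype.sum_sum_type,
        Matrix.fromBlocks_apply₁₁, Matrix.fromBlocks_apply₂₂]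
      simp [Finset.sum_neg_distrib, ← Finset.mul_sum] at e1 ⊢
      rw [e1]; ring
    rw [Matrix.conjTranspose_eq_transpose_of_trivial]
    have hs0 : -(2 * s) ≠ 0 := by
      intro h
      have : s = 0 := by linarith
      rw [this] at hs; norm_num at hs
    exact (mul_eq_zero.1 (e.symm.trans h4)).resolve_left hs0
  have h7 : a = 0 := Matrix.trace_mul_conjTranspose_self_eq_zero_iff.1 h6
  have h8 : b = 0 := by
    have := congrArg (matJ n * ·) h7
    simp only [ha, ← Matrix.mul_assoc, matJ_mul_matJ, Matrix.neg_mul, Matrix.one_mul,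
      Matrix.mul_zero, neg_eq_zero] at this
    exact this
  have h9 : ξ = 0 := by
    rw [← hξb, hc, h8]; simp
  rw [hv', h9, Matrix.mul_zero]

/-! ### Proper discontinuity of the action of the discrete group -/

theorem isInducing_toMat : IsInducing (toMat : grp n s → Mat n) :=
  IsInducing.comp (f := Subtype.val) (g := Subtype.val)
    (Y := Matrix.SpecialLinearGroup (Idx n ⊕ Unit) ℝ) ⟨rfl⟩ IsInducing.subtypeVal

theorem continuous_toMat : Continuous (toMat : grp n s → Mat n) := isInducing_toMat.continuous

theorem isCompact_subSO (hs : s * s = 1) : IsCompact (subSO n s : Set (grp n s)) := by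
  rw [isInducing_toMat.isCompact_iff]
  have h1 : IsCompact {B : Matrix (Idx n) (Idx n) ℝ |
      B ∈ Matrix.specialOrthogonalGroup (Idx n) ℝ} := by
    have hc : IsClosed {B : Matrix (Idx n) (Idx n) ℝ | Bᵀ * B = 1 ∧ B.det = 1} :=
      (isClosed_eq (by fun_prop) continuous_const).inter (isClosed_eq (by fun_prop) continuous_const)
    have he : {B : Matrix (Idx n) (Idx n) ℝ | B ∈ Matrix.specialOrthogonalGroup (Idx n) ℝ}
        = {B | Bᵀ * B = 1 ∧ B.det = 1} := by
      ext B
      rw [Set.mem_ofPred_eq, Set.mem_ofPred_eq, Matrix.mem_specialOrthogonalGroup_iff,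
        Matrix.mem_orthogonalGroup_iff']
    rw [← he] at hc
    refine Metric.isCompact_of_isClosed_isBounded hc
      (isBounded_iff_forall_norm_le.2 ⟨1, fun B hB => ?_⟩)
    rw [Matrix.norm_le_iff zero_le_one]
    intro i j
    exact entry_norm_bound_of_unitary (Matrix.mem_specialOrthogonalGroup_iff.1 hB).1 i j
  have h2 : Continuous (blockIncl (n := n)) := by
    unfold blockIncl
    fun_prop
  have h3 : toMat '' (subSO n s : Set (grp n s)) = blockIncl '' {B : Matrix (Idx n) (Idx n) ℝ |
      B ∈ Matrix.specialOrthogonalGroup (Idx n) ℝ} := by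
    ext A
    constructor
    · rintro ⟨g, ⟨B, hB, hg⟩, rfl⟩
      exact ⟨B, hB, hg.symm⟩
    · rintro ⟨B, hB, rfl⟩
      have hB' := Matrix.mem_specialOrthogonalGroup_iff.1 hB
      have hBB' : Bᵀ * B = 1 := (Matrix.mem_orthogonalGroup_iff' (Idx n) ℝ).1 hB'.1
      refine ⟨mkGrp hs (blockIncl B) ?_ ?_, ⟨B, hB, rfl⟩, rfl⟩
      · rw [blockIncl, adj_fromBlocks _ _ _ _ hs, Matrix.fromBlocks_multiply]
        simp [hBB']
      · rw [blockIncl, Matrix.det_fromBlocks_zero₂₁, hB'.2]; simp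
  rw [h3]
  exact h1.image h2

/-- A discrete group that acts freely on `G / SO(2n)` acts properly discontinuously: `gSO(2n)g⁻¹` is
compact and misses the closed set `Γ \ {1}`, so that a neighbourhood of it does. -/
theorem exists_nhds_eq_one (hs : s * s = 1) (Γ : Subgroup (grp n s)) (hΓ : DiscreteTopology Γ)
    (hfree : ∀ γ ∈ Γ, ∀ g : grp n s, g⁻¹ * γ * g ∈ subSO n s → γ = 1) (g : grp n s) :
    ∃ N ∈ 𝓝 g, ∀ a ∈ N, ∀ b ∈ N, ∀ γ ∈ Γ, ∀ h ∈ subSO n s, b = γ * a * h → γ = 1 := by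
  have hF : IsClosed ((Γ : Set (grp n s)) \ {1}) := by
    obtain ⟨U, hU, hU1⟩ := isOpen_induced_iff.1 (isOpen_discrete ({1} : Set Γ))
    have e : (Γ : Set (grp n s)) \ {1} = (Γ : Set (grp n s)) ∩ Uᶜ := by
      ext γ
      simp only [Set.mem_sdiff, Set.mem_singleton_iff, Set.mem_inter_iff, Set.mem_compl_iff,
        SetLike.mem_coe]
      refine and_congr_right fun hγ => not_congr ?_
      have := Set.ext_iff.1 hU1 ⟨γ, hγ⟩
      simp only [Set.mem_preimage, Set.mem_singleton_iff] at this
      rw [this]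
      exact ⟨fun h => Subtype.ext h, fun h => congrArg Subtype.val h⟩
    rw [e]
    exact (Subgroup.isClosed_of_discrete (H := Γ)).inter hU.isClosed_compl
  have hf : Continuous fun p : (grp n s × grp n s) × grp n s => p.1.2 * p.2⁻¹ * p.1.1⁻¹ := by
    fun_prop
  obtain ⟨u, v, hu, -, hgu, hKv, huv⟩ := generalized_tube_lemma
    (isCompact_singleton (x := (g, g))) (isCompact_subSO hs) (hF.isOpen_compl.preimage hf) (by
      rintro ⟨p, h⟩ ⟨hp, hh⟩
      rw [Set.mem_singleton_iff] at hp
      subst hp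
      rintro ⟨hγ, h1⟩
      refine h1 (hfree _ hγ g ?_)
      have : g⁻¹ * (g * h⁻¹ * g⁻¹) * g = h⁻¹ := by group
      change g⁻¹ * (g * h⁻¹ * g⁻¹) * g ∈ subSO n s
      rw [this]
      exact inv_mem hh)
  have hn : u ∈ 𝓝 (g, g) := hu.mem_nhds (hgu rfl)
  rw [nhds_prod_eq] at hn
  obtain ⟨A, hA, B, hB, hAB⟩ := Filter.mem_prod_iff.1 hn
  refine ⟨A ∩ B, inter_mem hA hB, fun a ha b hb γ hγ h hh e => ?_⟩
  by_contra hne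
  refine huv (Set.mk_mem_prod (hAB (Set.mk_mem_prod ha.1 hb.2)) (hKv hh)) ⟨?_, ?_⟩
  all_goals
    have e2 : b * h⁻¹ * a⁻¹ = γ := by rw [e]; group
    simp only [e2]
  exacts [hγ, hne]

/-! ### Smooth quotients of the groups: local sections and differentials -/

section Quotients

variable {d e : ℕ} {X : Type*} [TopologicalSpace X] [ChartedSpace (Euc d) X]
  {B : Type*} [TopologicalSpace B] [ChartedSpace (Euc e) B]
  {Γ V : Subgroup (grp n s)} {q : grp n s → X} {W : Set X} {σ : X → Mat n}

theorem IsSmoothQuotient.continuous (hq : IsSmoothQuotient (d := d) Γ V q) : Continuous q := by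
  rw [continuous_iff_continuousAt]
  intro g
  obtain ⟨U, Q, hU, hgU, hQ, hQq⟩ := hq.smooth g
  have h1 : Continuous fun g : grp n s => Matrix.of.symm (toMat g) := continuous_toMat
  have h2 : ContinuousAt Q (Matrix.of.symm (toMat g)) :=
    (hQ.continuousOn _ hgU).continuousAt (hU.mem_nhds hgU)
  have h3 : ContinuousAt (fun g' : grp n s => Q (Matrix.of.symm (toMat g'))) g :=
    ContinuousAt.comp (f := fun g : grp n s => Matrix.of.symm (toMat g)) h2 h1.continuousAt
  refine h3.congr ?_
  filter_upwards [h1.continuousAt (hU.mem_nhds hgU)] with g' hg' using hQq g' hg'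

theorem IsLocalSection.contMDiffAt (hσ : IsLocalSection (d := d) q W σ) {x : X} (hx : x ∈ W) :
    ContMDiffAt 𝓘(ℝ, Euc d) 𝓘(ℝ, Amb n) ∞ (fun x => Matrix.of.symm (σ x)) x := by
  have h1 : ∀ i j, ContMDiffAt 𝓘(ℝ, Euc d) 𝓘(ℝ, ℝ) ∞ (fun x => σ x i j) x := fun i j =>
    (hσ.smooth i j).contMDiffAt (hσ.isOpen.mem_nhds hx)
  exact contMDiffAt_pi_space.2 fun i => contMDiffAt_pi_space.2 (h1 i)

/-- The differential of a matrix valued map as a linear map. -/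
noncomputable def matDerivL (σ : X → Mat n) (x : X) : Euc d →L[ℝ] Amb n :=
  mfderiv 𝓘(ℝ, Euc d) 𝓘(ℝ, Amb n) (fun x => Matrix.of.symm (σ x)) x

theorem IsLocalSection.hasMFDerivAt (hσ : IsLocalSection (d := d) q W σ) {x : X} (hx : x ∈ W) :
    HasMFDerivAt 𝓘(ℝ, Euc d) 𝓘(ℝ, Amb n) (fun x => Matrix.of.symm (σ x)) x (matDerivL σ x) :=
  ((hσ.contMDiffAt hx).mdifferentiableAt (by simp)).hasMFDerivAt

theorem IsLocalSection.matDeriv_eq (hσ : IsLocalSection (d := d) q W σ) {x : X} (hx : x ∈ W)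
    (v : TangentSpace 𝓘(ℝ, Euc d) x) :
    matDeriv σ x v = Matrix.of (matDerivL (d := d) σ x v) := by
  ext i j
  let ev : Amb n →L[ℝ] ℝ := (ContinuousLinearMap.proj (R := ℝ) (φ := fun _ => ℝ) j).comp
    (ContinuousLinearMap.proj (R := ℝ) (φ := fun _ => (Idx n ⊕ Unit) → ℝ) i)
  have h2 : HasMFDerivAt 𝓘(ℝ, Amb n) 𝓘(ℝ, ℝ) (fun A : Amb n => A i j) (Matrix.of.symm (σ x)) ev :=
    hasMFDerivAt_iff_hasFDerivAt.2 ev.hasFDerivAt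
  have h3 := (h2.comp x (hσ.hasMFDerivAt hx)).mfderiv
  exact congrArg (fun f : Euc d →L[ℝ] ℝ => f v) h3

/-- Near `g`, a local section through `g` sends `q k` to an element of `k V`. -/
theorem IsLocalSection.eventually_eq_mul (hs : s * s = 1) (hΓ : DiscreteTopology Γ)
    (hfree : ∀ γ ∈ Γ, ∀ g : grp n s, g⁻¹ * γ * g ∈ subSO n s → γ = 1) (hV : V ≤ subSO n s)
    (hq : IsSmoothQuotient (d := d) Γ V q) (hσ : IsLocalSection (d := d) q W σ) {g : grp n s}
    (hg : q g ∈ W) (hσg : σ (q g) = toMat g) :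
    ∀ᶠ k in 𝓝 g, ∃ h ∈ V, σ (q k) = toMat (k * h) := by
  obtain ⟨N, hN, hN1⟩ := exists_nhds_eq_one hs Γ hΓ hfree g
  obtain ⟨M, hM, hMN⟩ := (mem_nhds_induced toMat g N).1 (by rwa [← isInducing_toMat.eq_induced])
  have hc : ContinuousAt (fun k => σ (q k)) g :=
    ContinuousAt.comp (f := q) (hσ.contMDiffAt hg).continuousAt hq.continuous.continuousAt
  have hW : ∀ᶠ k in 𝓝 g, q k ∈ W := hq.continuous.continuousAt (hσ.isOpen.mem_nhds hg)
  have hM' : ∀ᶠ k in 𝓝 g, σ (q k) ∈ M := hc (by simpa only [hσg] using hM)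
  filter_upwards [hW, hM', hN] with k hkW hkM hkN
  obtain ⟨k', hk', hqk'⟩ := hσ.isSection _ hkW
  obtain ⟨γ, hγ, h, hh, e⟩ := (hq.fibres k k').1 hqk'.symm
  have h1 : k' ∈ N := hMN (by rw [Set.mem_preimage, hk']; exact hkM)
  have h2 := hN1 k hkN k' h1 γ hγ h (hV hh) e
  refine ⟨h, hh, ?_⟩
  rw [← hk', e, h2, one_mul]

/-- `D` is a differential of `q` at `g`, extended to all matrices: it inverts the differentials of the
local sections through `g`, and sends the velocities of curves in the group to those of their
projections. -/
def IsDifferentialAt (q : grp n s → X) (g : grp n s) (D : Amb n →L[ℝ] Euc d) : Prop :=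
  (∀ W σ, IsLocalSection (d := d) q W σ → q g ∈ W → σ (q g) = toMat g → ∀ v : Euc d,
    D (matDerivL (d := d) σ (q g) v) = v) ∧
  ∀ (k : ℝ → grp n s) (k' : Mat n), k 0 = g → HasDerivAt (fun t => toMat (k t)) k' 0 →
    ∃ D' : ℝ →L[ℝ] Euc d, D' 1 = D (Matrix.of.symm k') ∧
      HasMFDerivAt 𝓘(ℝ, ℝ) 𝓘(ℝ, Euc d) (fun t => q (k t)) 0 D'

theorem IsSmoothQuotient.exists_differential (hq : IsSmoothQuotient (d := d) Γ V q) (g : grp n s) :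
    ∃ D : Amb n →L[ℝ] Euc d, IsDifferentialAt q g D := by
  obtain ⟨U, Q, hU, hgU, hQ, hQq⟩ := hq.smooth g
  have hQd := ((hQ.contMDiffAt (hU.mem_nhds hgU)).mdifferentiableAt (by simp)).hasMFDerivAt
  have hqg := hQq g hgU
  let D : Amb n →L[ℝ] Euc d := mfderiv 𝓘(ℝ, Amb n) 𝓘(ℝ, Euc d) Q (Matrix.of.symm (toMat g))
  refine ⟨D, fun W σ hσ hgW hσg v => ?_, fun k k' hk0 hk => ?_⟩
  · have hD' : HasMFDerivAt 𝓘(ℝ, Amb n) 𝓘(ℝ, Euc d) Q (Matrix.of.symm (σ (q g))) D := by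
      rw [hσg]; exact hQd
    have h2 := hD'.comp (q g) (hσ.hasMFDerivAt hgW)
    have h3 : HasMFDerivAt 𝓘(ℝ, Euc d) 𝓘(ℝ, Euc d) (fun x : X => x) (q g)
        (ContinuousLinearMap.id ℝ (TangentSpace 𝓘(ℝ, Euc d) (q g))) := hasMFDerivAt_id (q g)
    have hUσ : ∀ᶠ x in 𝓝 (q g), Matrix.of.symm (σ x) ∈ U :=
      (hσ.contMDiffAt hgW).continuousAt (by rw [hσg]; exact hU.mem_nhds hgU)
    have h4 := h2.congr_of_eventuallyEq (f₁ := fun x => x) (by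
      filter_upwards [hUσ, hσ.isOpen.mem_nhds hgW] with x hxU hxW
      obtain ⟨k, hk, hqk⟩ := hσ.isSection x hxW
      rw [← hk] at hxU
      change x = Q (Matrix.of.symm (σ x))
      rw [← hk, hQq k hxU, hqk])
    have h5 := hasMFDerivAt_unique h4 h3
    exact congrArg (fun f : Euc d →L[ℝ] Euc d => f v) h5
  · have h1 : HasMFDerivAt 𝓘(ℝ, ℝ) 𝓘(ℝ, Amb n) (fun t => Matrix.of.symm (toMat (k t))) 0
        (ContinuousLinearMap.toSpanSingleton ℝ (Matrix.of.symm k')) :=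
      hasMFDerivAt_iff_hasFDerivAt.2 hk
    have hD' : HasMFDerivAt 𝓘(ℝ, Amb n) 𝓘(ℝ, Euc d) Q (Matrix.of.symm (toMat (k 0))) D := by
      rw [hk0]; exact hQd
    have h2 := hD'.comp (0 : ℝ) h1
    refine ⟨D ∘L ContinuousLinearMap.toSpanSingleton ℝ (Matrix.of.symm k'), ?_, ?_⟩
    · change D ((1 : ℝ) • Matrix.of.symm k') = D (Matrix.of.symm k')
      rw [one_smul]
    · refine h2.congr_of_eventuallyEq ?_
      have hUk : ∀ᶠ t in 𝓝 (0 : ℝ), Matrix.of.symm (toMat (k t)) ∈ U := by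
        have hc : ContinuousAt (fun t => Matrix.of.symm (toMat (k t))) 0 :=
          HasDerivAt.continuousAt (F := Amb n) hk
        refine hc (hU.mem_nhds ?_)
        simpa only [hk0] using hgU
      filter_upwards [hUk] with t ht
      exact (hQq _ ht).symm

end Quotients

section Quotients

variable {d e : ℕ} {X : Type*} [TopologicalSpace X] [ChartedSpace (Euc d) X]
  {B : Type*} [TopologicalSpace B] [ChartedSpace (Euc e) B]
  {Γ V : Subgroup (grp n s)} {q : grp n s → X} {W : Set X} {σ : X → Mat n} {g : grp n s}
  {D : Amb n →L[ℝ] Euc d}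

theorem IsLocalSection.adj_mul_self (hs : s * s = 1) (hσ : IsLocalSection (d := d) q W σ) {x : X}
    (hx : x ∈ W) : adj s (σ x) * σ x = 1 := by
  obtain ⟨k, hk, -⟩ := hσ.isSection x hx
  rw [← hk, adj_toMat_mul hs]

theorem IsLocalSection.skew_matDerivL (hs : s * s = 1) (hσ : IsLocalSection (d := d) q W σ)
    (hg : q g ∈ W) (hσg : σ (q g) = toMat g) (v : Euc d) :
    adj s (toMat g⁻¹ * Matrix.of (matDerivL (d := d) σ (q g) v))
      = -(toMat g⁻¹ * Matrix.of (matDerivL (d := d) σ (q g) v)) := by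
  let F : Mat n → Mat n := fun A => adj s A * A
  have h1 := HasFDerivAt.comp (g := fun p : Mat n × Mat n => p.1 * p.2)
    (f := fun A : Mat n => (adjL n s A, A)) (toMat g)
    (isBoundedBilinearMap_matMul.hasFDerivAt (adjL n s (toMat g), toMat g))
    ((adjL n s).hasFDerivAt.prodMk (hasFDerivAt_id (toMat g)))
  let F' : Amb n →L[ℝ] Amb n :=
    (isBoundedBilinearMap_matMul.deriv (adjL n s (toMat g), toMat g)).comp
      ((adjL n s).prod (ContinuousLinearMap.id ℝ (Mat n)))
  have h2 : HasMFDerivAt 𝓘(ℝ, Amb n) 𝓘(ℝ, Amb n)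
      (fun A : Amb n => Matrix.of.symm (F (Matrix.of A))) (Matrix.of.symm (σ (q g))) F' := by
    rw [hσg]
    exact hasMFDerivAt_iff_hasFDerivAt.2 h1
  have h3 := h2.comp (q g) (hσ.hasMFDerivAt hg)
  have h4 : HasMFDerivAt 𝓘(ℝ, Euc d) 𝓘(ℝ, Amb n) (fun _ : X => Matrix.of.symm (1 : Mat n)) (q g) _ :=
    hasMFDerivAt_const _ _
  have h5 := h4.congr_of_eventuallyEq (f₁ := (fun A : Amb n => Matrix.of.symm (F (Matrix.of A))) ∘
      fun x => Matrix.of.symm (σ x)) (by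
    filter_upwards [hσ.isOpen.mem_nhds hg] with x hx
    exact congrArg Matrix.of.symm (hσ.adj_mul_self hs hx))
  have h6 := hasMFDerivAt_unique h3 h5
  set M : Mat n := Matrix.of (matDerivL (d := d) σ (q g) v)
  have h7 : adj s (toMat g) * M + adj s M * toMat g = 0 :=
    congrArg (fun f : Euc d →L[ℝ] Amb n => Matrix.of (f v)) h6
  rw [adj_mul hs, toMat_inv hs, adj_adj hs]
  exact eq_neg_of_add_eq_zero_right h7

theorem hasDerivAt_mul_cayGrp (hs : s * s = 1) (g : grp n s) {ξ : Mat n} (hξ : adj s ξ = -ξ) :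
    HasDerivAt (fun t : ℝ => toMat (g * cayGrp hs (t • ξ))) (toMat g * ξ) 0 := by
  have := hasDerivAt_matMul (hasDerivAt_const (0 : ℝ) (toMat g)) (hasDerivAt_toMat_cayGrp hs hξ)
  rw [Matrix.zero_mul, add_zero] at this
  simpa only [toMat_mul] using this

theorem IsDifferentialAt.hasDerivAt_section (hs : s * s = 1) (hD : IsDifferentialAt q g D)
    (hσ : IsLocalSection (d := d) q W σ) (hg : q g ∈ W) {ξ : Mat n} (hξ : adj s ξ = -ξ) :
    HasDerivAt (fun t : ℝ => σ (q (g * cayGrp hs (t • ξ))))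
      (Matrix.of (matDerivL (d := d) σ (q g) (D (Matrix.of.symm (toMat g * ξ))))) 0 := by
  obtain ⟨D', hD1, hD'⟩ := hD.2 (fun t => g * cayGrp hs (t • ξ)) _ (by simp)
    (hasDerivAt_mul_cayGrp hs g hξ)
  have h1 : HasMFDerivAt 𝓘(ℝ, Euc d) 𝓘(ℝ, Amb n) (fun x => Matrix.of.symm (σ x))
      (q (g * cayGrp hs ((0 : ℝ) • ξ))) (matDerivL σ (q g)) := by
    have e : g * cayGrp hs ((0 : ℝ) • ξ) = g := by simp
    rw [e]
    exact hσ.hasMFDerivAt hg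
  have h2' := h1.comp (0 : ℝ) hD'
  have h2 : HasFDerivAt (fun t : ℝ => Matrix.of.symm (σ (q (g * cayGrp hs (t • ξ)))))
      ((matDerivL (d := d) σ (q g)).comp D') 0 := hasMFDerivAt_iff_hasFDerivAt.1 h2'
  have h3 := h2.hasDerivAt
  have e : Matrix.of.symm (Matrix.of (matDerivL (d := d) σ (q g) (D (Matrix.of.symm (toMat g * ξ)))))
      = matDerivL (d := d) σ (q g) (D' 1) := by rw [hD1]; rfl
  exact e ▸ h3

/-- The projection kills the tangent vectors of the orbits of `V`. -/
theorem IsDifferentialAt.apply_eq_zero (hs : s * s = 1) (hq : IsSmoothQuotient (d := d) Γ V q)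
    (hD : IsDifferentialAt q g D) {ξ : Mat n} (hξ : adj s ξ = -ξ)
    (hV : ∀ t : ℝ, cayGrp hs (t • ξ) ∈ V) : D (Matrix.of.symm (toMat g * ξ)) = 0 := by
  obtain ⟨D', hD1, hD'⟩ := hD.2 (fun t => g * cayGrp hs (t • ξ)) _ (by simp)
    (hasDerivAt_mul_cayGrp hs g hξ)
  have h1 : (fun t : ℝ => q (g * cayGrp hs (t • ξ))) = fun _ => q g := by
    funext t
    exact ((hq.fibres _ _).2 ⟨1, one_mem _, _, hV t, by rw [one_mul]⟩).symm
  have h2 : HasMFDerivAt 𝓘(ℝ, ℝ) 𝓘(ℝ, Euc d) (fun t : ℝ => q (g * cayGrp hs (t • ξ))) 0 _ :=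
    h1 ▸ hasMFDerivAt_const _ _
  have h3 := congrArg (fun f : ℝ →L[ℝ] Euc d => f 1) (hasMFDerivAt_unique hD' h2)
  rw [← hD1]
  exact h3

/-- The component of `g⁻¹ dσ` in the Lie algebra modulo the centralizer of `J` is determined by the
tangent vector of the quotient. -/
theorem IsDifferentialAt.commutator_section (hs : s * s = 1) (hΓ : DiscreteTopology Γ)
    (hfree : ∀ γ ∈ Γ, ∀ g : grp n s, g⁻¹ * γ * g ∈ subSO n s → γ = 1)
    (hq : IsSmoothQuotient (d := d) Γ (subU n s) q) (hD : IsDifferentialAt q g D)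
    (hσ : IsLocalSection (d := d) q W σ) (hg : q g ∈ W) (hσg : σ (q g) = toMat g)
    {ξ ξ' : Mat n} (hξ : adj s ξ = -ξ)
    (hξ' : ξ' = toMat g⁻¹ *
      Matrix.of (matDerivL (d := d) σ (q g) (D (Matrix.of.symm (toMat g * ξ))))) :
    ξ' * Jhat n - Jhat n * ξ' = ξ * Jhat n - Jhat n * ξ := by
  have hs' : adj s ξ' = -ξ' := by rw [hξ']; exact hσ.skew_matDerivL hs hg hσg _
  have hM : Matrix.of (matDerivL (d := d) σ (q g) (D (Matrix.of.symm (toMat g * ξ))))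
      = toMat g * ξ' := by
    rw [hξ', ← Matrix.mul_assoc, toMat_mul_inv, Matrix.one_mul]
  have h1 := hD.hasDerivAt_section hs hσ hg hξ
  rw [hM] at h1
  have h2 := hasDerivAt_mul_cayGrp hs g hξ
  have key : ∀ {c : ℝ → Mat n} {η : Mat n}, c 0 = toMat g → adj s η = -η →
      HasDerivAt c (toMat g * η) 0 → HasDerivAt (fun t => c t * Jhat n * adj s (c t))
        (toMat g * (η * Jhat n - Jhat n * η) * adj s (toMat g)) 0 := by
    intro c η hc hη h
    have h3 := hasDerivAt_matMul (hasDerivAt_matMul h (hasDerivAt_const (0 : ℝ) (Jhat n)))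
      (hasDerivAt_matAdj (s := s) h)
    convert h3 using 1
    rw [hc, adj_mul hs, hη]
    simp only [Matrix.mul_sub, Matrix.sub_mul, Matrix.mul_zero, Matrix.mul_neg, Matrix.neg_mul,
      Matrix.mul_assoc, zero_add]
    abel
  have e0 : g * cayGrp hs ((0 : ℝ) • ξ) = g := by simp
  have h3 := key (by simp only [e0, hσg]) hs' h1
  have h4 := key (by simp only [e0]) hξ h2
  have hev := hσ.eventually_eq_mul hs hΓ hfree subU_le_subSO hq hg hσg
  have hcont : Tendsto (fun t : ℝ => g * cayGrp hs (t • ξ)) (𝓝 0) (𝓝 g) := by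
    rw [isInducing_toMat.tendsto_nhds_iff]
    have := h2.continuousAt
    rw [ContinuousAt, e0] at this
    exact this
  have h5 := h3.congr_of_eventuallyEq (f₁ := fun t : ℝ => toMat (g * cayGrp hs (t • ξ)) * Jhat n *
      adj s (toMat (g * cayGrp hs (t • ξ)))) (by
    filter_upwards [hcont.eventually hev] with t ht
    obtain ⟨h, hh, e⟩ := ht
    set k := g * cayGrp hs (t • ξ)
    rw [e, toMat_mul k h, adj_mul hs]
    calc toMat k * Jhat n * adj s (toMat k)
        = toMat k * (Jhat n * (toMat h * adj s (toMat h))) * adj s (toMat k) := by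
          rw [toMat_mul_adj hs, Matrix.mul_one]
      _ = toMat k * (toMat h * Jhat n * adj s (toMat h)) * adj s (toMat k) := by
          rw [← Matrix.mul_assoc (Jhat n), mul_Jhat_of_mem_subU hh]
      _ = _ := by simp only [Matrix.mul_assoc])
  have h6 := h5.unique h4
  have h7 := congrArg (fun A => adj s (toMat g) * A * toMat g) h6
  have h8 : ∀ A : Mat n, adj s (toMat g) * (toMat g * A * adj s (toMat g)) * toMat g = A := by
    intro A
    calc _ = (adj s (toMat g) * toMat g) * A * (adj s (toMat g) * toMat g) := by
          simp only [Matrix.mul_assoc]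
      _ = A := by simp [adj_toMat_mul hs]
  simpa only [h8] using h7

/-- A vector that is horizontal for `q` modulo `so(2n)` and projects to zero lies in `so(2n)`. -/
theorem IsDifferentialAt.mul_lastProj_eq_zero (hs : s * s = 1) (hΓ : DiscreteTopology Γ)
    (hfree : ∀ γ ∈ Γ, ∀ g : grp n s, g⁻¹ * γ * g ∈ subSO n s → γ = 1)
    (hq : IsSmoothQuotient (d := d) Γ (subSO n s) q) (hD : IsDifferentialAt q g D)
    {ξ : Mat n} (hξ : adj s ξ = -ξ) (h0 : D (Matrix.of.symm (toMat g * ξ)) = 0) :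
    ξ * lastProj n = 0 := by
  obtain ⟨W, σ, hσ, hg, hσg⟩ := hq.sections g
  have h1 := hD.hasDerivAt_section hs hσ hg hξ
  rw [h0, map_zero] at h1
  have h2 := hasDerivAt_mul_cayGrp hs g hξ
  have h3 := hasDerivAt_matMul h1 (hasDerivAt_const (0 : ℝ) (lastProj n))
  have h4 := hasDerivAt_matMul h2 (hasDerivAt_const (0 : ℝ) (lastProj n))
  have e0 : g * cayGrp hs ((0 : ℝ) • ξ) = g := by simp
  have hcont : Tendsto (fun t : ℝ => g * cayGrp hs (t • ξ)) (𝓝 0) (𝓝 g) := by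
    rw [isInducing_toMat.tendsto_nhds_iff]
    have := h2.continuousAt
    rw [ContinuousAt, e0] at this
    exact this
  have hev := hσ.eventually_eq_mul hs hΓ hfree le_rfl hq hg hσg
  have h5 := h3.congr_of_eventuallyEq
      (f₁ := fun t : ℝ => toMat (g * cayGrp hs (t • ξ)) * lastProj n) (by
    filter_upwards [hcont.eventually hev] with t ht
    obtain ⟨h, hh, e⟩ := ht
    rw [e, toMat_mul _ h, Matrix.mul_assoc, mul_lastProj_of_mem_subSO hh])
  have h6 := h4.unique h5
  have h7 : toMat g * (ξ * lastProj n) = 0 := by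
    rw [Matrix.mul_zero, zero_add] at h6
    rw [← Matrix.mul_assoc, h6, Matrix.mul_zero, zero_add]
    exact Matrix.zero_mul _
  have h8 := congrArg (toMat g⁻¹ * ·) h7
  simpa only [← Matrix.mul_assoc, toMat_inv_mul, Matrix.one_mul, Matrix.mul_zero] using h8

end Quotients

/-! ### The coupling form on the quotient -/

/-- The value of the coupling form on the left invariant vector fields of two matrices. -/
noncomputable def kks (n : ℕ) (ξ ζ : Mat n) : ℝ :=
  -((2 * n - 1 : ℝ) * (Jhat n * (ξ * ζ - ζ * ξ)).trace)

theorem kks_eq (ξ ζ : Mat n) :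
    kks n ξ ζ = -((2 * n - 1 : ℝ) * ((Jhat n * ξ - ξ * Jhat n) * ζ).trace) := by
  rw [kks, commutator_trace]

theorem kks_swap (ξ ζ : Mat n) : kks n ξ ζ = -kks n ζ ξ := by
  rw [kks, kks, ← neg_sub (ζ * ξ), Matrix.mul_neg, Matrix.trace_neg]
  ring

/-- The value depends on `ξ` and `ζ` only modulo the centralizer of `J`. -/
theorem kks_congr {ξ ξ' ζ ζ' : Mat n} (h : ξ' * Jhat n - Jhat n * ξ' = ξ * Jhat n - Jhat n * ξ)
    (h' : ζ' * Jhat n - Jhat n * ζ' = ζ * Jhat n - Jhat n * ζ) : kks n ξ' ζ' = kks n ξ ζ := by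
  have e : ∀ {a a' : Mat n} (b : Mat n),
      a' * Jhat n - Jhat n * a' = a * Jhat n - Jhat n * a → kks n a' b = kks n a b := by
    intro a a' b h
    have h1 : Jhat n * a' - a' * Jhat n = Jhat n * a - a * Jhat n := by
      rw [← neg_sub, h, neg_sub]
    rw [kks_eq, kks_eq, h1]
  rw [e _ h, kks_swap, e _ h', kks_swap, neg_neg]

theorem kks_conj {H H' : Mat n} (h1 : H' * H = 1) (hJ : H * Jhat n = Jhat n * H) (ξ ζ : Mat n) :
    kks n (H * ξ * H') (H * ζ * H') = kks n ξ ζ := by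
  have e : H * ξ * H' * (H * ζ * H') - H * ζ * H' * (H * ξ * H') = H * (ξ * ζ - ζ * ξ) * H' := by
    have : ∀ a b : Mat n, H * a * H' * (H * b * H') = H * (a * b) * H' := by
      intro a b
      calc _ = H * a * (H' * H) * b * H' := by simp only [Matrix.mul_assoc]
        _ = _ := by rw [h1, Matrix.mul_one]; simp only [Matrix.mul_assoc]
    rw [this, this, Matrix.mul_sub, Matrix.sub_mul]
  rw [kks, kks, e]
  congr 2
  rw [← Matrix.mul_assoc, ← Matrix.mul_assoc, ← hJ, Matrix.trace_mul_comm, ← Matrix.mul_assoc,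
    ← Matrix.mul_assoc, h1, Matrix.one_mul]

/-- The bilinear form `(v, w) ↦ B(J, v* w)` on the space of matrices. -/
noncomputable def adjTraceForm (n : ℕ) (s : ℝ) : Amb n →L[ℝ] Amb n →L[ℝ] ℝ :=
  LinearMap.toContinuousBilinearMap <| LinearMap.mk₂ ℝ
    (fun v w : Amb n => (2 * n - 1 : ℝ) *
      (Jhat n * (adj s (Matrix.of v) * (Matrix.of w : Mat n))).trace)
    (fun v v' w => by
      rw [← Matrix.of_add_of, map_add, Matrix.add_mul, Matrix.mul_add, Matrix.trace_add, mul_add])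
    (fun c v w => by
      rw [← Matrix.smul_of, map_smul, Matrix.smul_mul, Matrix.mul_smul, Matrix.trace_smul, smul_eq_mul,
        smul_eq_mul]
      ring)
    (fun v w w' => by
      rw [← Matrix.of_add_of, Matrix.mul_add, Matrix.mul_add, Matrix.trace_add, mul_add])
    (fun c v w => by
      rw [← Matrix.smul_of, Matrix.mul_smul, Matrix.mul_smul, Matrix.trace_smul, smul_eq_mul,
        smul_eq_mul]
      ring)

theorem adjTraceForm_apply (v w : Amb n) : adjTraceForm n s v w = (2 * n - 1 : ℝ) *
      (Jhat n * (adj s (Matrix.of v) * (Matrix.of w : Mat n))).trace := rfl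

/-- The antisymmetrization of a bilinear form. -/
noncomputable def altForm (F : Type*) [NormedAddCommGroup F] [NormedSpace ℝ F] :
    (F →L[ℝ] F →L[ℝ] ℝ) →L[ℝ] F [⋀^Fin 2]→L[ℝ] ℝ :=
  (ContinuousAlternatingMap.alternatizeUncurryFinCLM ℝ F ℝ (n := 1)).comp
    (ContinuousLinearMap.compL ℝ F (F →L[ℝ] ℝ) (F [⋀^Fin 1]→L[ℝ] ℝ)
      ((ContinuousAlternatingMap.ofSubsingletonLIE (0 : Fin 1) :
        (F →L[ℝ] ℝ) ≃ₗᵢ[ℝ] F [⋀^Fin 1]→L[ℝ] ℝ) : (F →L[ℝ] ℝ) →L[ℝ] F [⋀^Fin 1]→L[ℝ] ℝ))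

theorem altForm_apply {F : Type*} [NormedAddCommGroup F] [NormedSpace ℝ F]
    (β : F →L[ℝ] F →L[ℝ] ℝ) (m : Fin 2 → F) :
    altForm F β m = β (m 0) (m 1) - β (m 1) (m 0) := by
  change ContinuousAlternatingMap.alternatizeUncurryFin _ m = _
  rw [ContinuousAlternatingMap.alternatizeUncurryFin_apply, Fin.sum_univ_two]
  simp [Fin.removeNth, sub_eq_add_neg]
  rfl

theorem altForm_compContinuousLinearMap {F F' : Type*} [NormedAddCommGroup F] [NormedSpace ℝ F]
    [NormedAddCommGroup F'] [NormedSpace ℝ F'] (β : F →L[ℝ] F →L[ℝ] ℝ) (A : F' →L[ℝ] F) :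
    (altForm F β).compContinuousLinearMap A =
      altForm F' (((β.comp A).flip.comp A).flip) := by
  ext m
  rw [ContinuousAlternatingMap.compContinuousLinearMap_apply, altForm_apply, altForm_apply]
  rfl

/-- The constant two-form on the space of matrices whose pull-backs by local sections are the
coupling form. -/
noncomputable def ambForm (n : ℕ) (s : ℝ) : Amb n [⋀^Fin 2]→L[ℝ] ℝ := altForm _ (adjTraceForm n s)

theorem ambForm_apply (m : Fin 2 → Amb n) :
    ambForm n s m = adjTraceForm n s (m 0) (m 1) - adjTraceForm n s (m 1) (m 0) :=
  altForm_apply _ _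

theorem ambForm_eq_kks (hs : s * s = 1) (g : grp n s) {v w : Mat n}
    (hv : adj s (toMat g⁻¹ * v) = -(toMat g⁻¹ * v)) (hw : adj s (toMat g⁻¹ * w) = -(toMat g⁻¹ * w)) :
    ambForm n s ![Matrix.of.symm v, Matrix.of.symm w] = kks n (toMat g⁻¹ * v) (toMat g⁻¹ * w) := by
  have e : ∀ {a b : Mat n}, adj s (toMat g⁻¹ * a) = -(toMat g⁻¹ * a) →
      adj s a * b = -(toMat g⁻¹ * a * (toMat g⁻¹ * b)) := by
    intro a b ha
    have h1 : a = toMat g * (toMat g⁻¹ * a) := by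
      rw [← Matrix.mul_assoc, toMat_mul_inv, Matrix.one_mul]
    nth_rewrite 1 [h1]
    rw [adj_mul hs, ha, ← toMat_inv hs, Matrix.neg_mul, Matrix.neg_mul, Matrix.mul_assoc]
  rw [ambForm_apply, adjTraceForm_apply, adjTraceForm_apply]
  change (2 * n - 1 : ℝ) * (Jhat n * (adj s v * w)).trace
    - (2 * n - 1 : ℝ) * (Jhat n * (adj s w * v)).trace = _
  rw [e hv, e hw, kks, Matrix.mul_sub, Matrix.trace_sub, Matrix.mul_neg, Matrix.mul_neg,
    Matrix.trace_neg, Matrix.trace_neg]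
  ring

section Quotients

variable {d e : ℕ} {X : Type*} [TopologicalSpace X] [ChartedSpace (Euc d) X]
  {B : Type*} [TopologicalSpace B] [ChartedSpace (Euc e) B]
  {Γ V : Subgroup (grp n s)} {q : grp n s → X} {W : Set X} {σ : X → Mat n} {g : grp n s}
  {D : Amb n →L[ℝ] Euc d}

/-- The Lie algebra component of the differential of a section through `g`. -/
noncomputable def lieComp (g : grp n s) (σ : X → Mat n) (x : X) (v : Euc d) : Mat n :=
  toMat g⁻¹ * Matrix.of (matDerivL (d := d) σ x v)

theorem toMat_mul_lieComp (x : X) (v : Euc d) :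
    toMat g * lieComp g σ x v = Matrix.of (matDerivL (d := d) σ x v) := by
  rw [lieComp, ← Matrix.mul_assoc, toMat_mul_inv, Matrix.one_mul]

theorem IsDifferentialAt.apply_lieComp (hD : IsDifferentialAt q g D)
    (hσ : IsLocalSection (d := d) q W σ) (hg : q g ∈ W) (hσg : σ (q g) = toMat g) (v : Euc d) :
    D (Matrix.of.symm (toMat g * lieComp g σ (q g) v)) = v := by
  rw [toMat_mul_lieComp]
  exact hD.1 W σ hσ hg hσg v

theorem ambForm_matDerivL (hs : s * s = 1) (hσ : IsLocalSection (d := d) q W σ) (hg : q g ∈ W)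
    (hσg : σ (q g) = toMat g) (v w : Euc d) :
    ambForm n s ![matDerivL (d := d) σ (q g) v, matDerivL (d := d) σ (q g) w]
      = kks n (lieComp g σ (q g) v) (lieComp g σ (q g) w) :=
  ambForm_eq_kks hs g (hσ.skew_matDerivL hs hg hσg v) (hσ.skew_matDerivL hs hg hσg w)

theorem IsLocalSection.couplingLift_eq (hs : s * s = 1) (hσ : IsLocalSection (d := d) q W σ)
    (hg : q g ∈ W) (hσg : σ (q g) = toMat g) (v w : Euc d) :
    couplingLift (canonicalForm n) (covec n s) (σ (q g)) (matDeriv (d := d) σ (q g) v)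
      (matDeriv (d := d) σ (q g) w) = kks n (lieComp g σ (q g) v) (lieComp g σ (q g) w) := by
  have h1 := fun v : Euc d => hσ.matDeriv_eq hg v
  refine (congrArg₂ (couplingLift (canonicalForm n) (covec n s) (σ (q g))) (h1 v) (h1 w)).trans ?_
  rw [hσg, TwistorFat.couplingLift_eq hs, kks, lieComp, lieComp]

/-- Two local sections through the same point of the group give the same form. -/
theorem kks_section_congr (hs : s * s = 1) (hΓ : DiscreteTopology Γ)
    (hfree : ∀ γ ∈ Γ, ∀ g : grp n s, g⁻¹ * γ * g ∈ subSO n s → γ = 1)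
    (hq : IsSmoothQuotient (d := d) Γ (subU n s) q) {W' : Set X} {σ' : X → Mat n}
    (hσ : IsLocalSection (d := d) q W σ) (hσ' : IsLocalSection (d := d) q W' σ')
    (hg : q g ∈ W) (hg' : q g ∈ W') (hσg : σ (q g) = toMat g) (hσg' : σ' (q g) = toMat g)
    (v w : Euc d) :
    kks n (lieComp g σ' (q g) v) (lieComp g σ' (q g) w) =
      kks n (lieComp g σ (q g) v) (lieComp g σ (q g) w) := by
  obtain ⟨D, hD⟩ := hq.exists_differential g
  have key : ∀ v : Euc d, lieComp g σ' (q g) v * Jhat n - Jhat n * lieComp g σ' (q g) v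
      = lieComp g σ (q g) v * Jhat n - Jhat n * lieComp g σ (q g) v := fun v =>
    hD.commutator_section hs hΓ hfree hq hσ' hg' hσg' (hσ.skew_matDerivL hs hg hσg v) (by
      rw [← lieComp, hD.apply_lieComp hσ hg hσg, lieComp])
  exact kks_congr (key v) (key w)

/-- The translate of a local section by elements of `Γ` and `V`. -/
theorem IsLocalSection.translate (hq : IsSmoothQuotient (d := d) Γ V q)
    (hσ : IsLocalSection (d := d) q W σ) {γ h : grp n s} (hγ : γ ∈ Γ) (hh : h ∈ V) :
    IsLocalSection (d := d) q W (fun x => toMat γ * σ x * toMat h) where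
  isOpen := hσ.isOpen
  smooth i j := by
    simp only [Matrix.mul_apply]
    refine contMDiffOn_finsetSum fun a _ => ContMDiffOn.mul ?_ contMDiffOn_const
    exact contMDiffOn_finsetSum fun b _ => contMDiffOn_const.mul (hσ.smooth b a)
  isSection x hx := by
    obtain ⟨k, hk, hkx⟩ := hσ.isSection x hx
    refine ⟨γ * k * h, by rw [toMat_mul, toMat_mul, hk], ?_⟩
    rw [← hkx]
    exact ((hq.fibres _ _).2 ⟨γ, hγ, h, hh, rfl⟩).symm

theorem IsLocalSection.matDerivL_translate (hσ : IsLocalSection (d := d) q W σ) {x : X} (hx : x ∈ W)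
    (γ h : grp n s) (v : Euc d) :
    Matrix.of (matDerivL (d := d) (fun x => toMat γ * σ x * toMat h) x v)
      = toMat γ * Matrix.of (matDerivL (d := d) σ x v) * toMat h := by
  let L : Amb n →L[ℝ] Amb n := LinearMap.toContinuousLinearMap
    ((LinearMap.mulRight ℝ (toMat h)).comp (LinearMap.mulLeft ℝ (toMat γ)) : Mat n →ₗ[ℝ] Mat n)
  have h1 : HasMFDerivAt 𝓘(ℝ, Amb n) 𝓘(ℝ, Amb n) L (Matrix.of.symm (σ x)) L :=
    hasMFDerivAt_iff_hasFDerivAt.2 L.hasFDerivAt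
  have h2 := (h1.comp x (hσ.hasMFDerivAt hx)).mfderiv
  exact congrArg (fun f : Euc d →L[ℝ] Amb n => Matrix.of (f v)) h2

/-- The form defined by a local section does not depend on it. -/
theorem ambForm_section_congr (hs : s * s = 1) (hΓ : DiscreteTopology Γ)
    (hfree : ∀ γ ∈ Γ, ∀ g : grp n s, g⁻¹ * γ * g ∈ subSO n s → γ = 1)
    (hq : IsSmoothQuotient (d := d) Γ (subU n s) q) {W' : Set X} {σ' : X → Mat n}
    (hσ : IsLocalSection (d := d) q W σ) (hσ' : IsLocalSection (d := d) q W' σ') {x : X}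
    (hx : x ∈ W) (hx' : x ∈ W') (v w : Euc d) :
    ambForm n s ![matDerivL (d := d) σ' x v, matDerivL (d := d) σ' x w] =
      ambForm n s ![matDerivL (d := d) σ x v, matDerivL (d := d) σ x w] := by
  obtain ⟨g, hσg, rfl⟩ := hσ.isSection x hx
  obtain ⟨g', hσg', hgg'⟩ := hσ'.isSection _ hx'
  obtain ⟨γ, hγ, h, hh, e⟩ := (hq.fibres g g').1 hgg'.symm
  have hτ := hσ'.translate hq (inv_mem hγ) (inv_mem hh)
  have hτg : toMat γ⁻¹ * σ' (q g) * toMat h⁻¹ = toMat g := by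
    rw [← hσg', ← toMat_mul, ← toMat_mul, e]
    congr 1; group
  rw [ambForm_matDerivL hs hσ hx hσg.symm, ← hgg', ambForm_matDerivL hs hσ' (hgg'.symm ▸ hx')
    (by rw [hgg']; exact hσg'.symm), hgg', ← kks_section_congr hs hΓ hfree hq hσ hτ hx hx' hσg.symm hτg]
  have key : ∀ v : Euc d, lieComp g (fun x => toMat γ⁻¹ * σ' x * toMat h⁻¹) (q g) v
      = toMat h * lieComp g' σ' (q g) v * toMat h⁻¹ := by
    intro v
    rw [lieComp, lieComp, hσ'.matDerivL_translate hx', ← Matrix.mul_assoc, ← Matrix.mul_assoc,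
      ← Matrix.mul_assoc, ← toMat_mul, ← toMat_mul, e]
    congr 3; group
  rw [key, key, kks_conj (toMat_inv_mul h) (mul_Jhat_of_mem_subU hh)]

end Quotients

section Quotients

variable {d e : ℕ} {X : Type*} [TopologicalSpace X] [ChartedSpace (Euc d) X]
  {B : Type*} [TopologicalSpace B] [ChartedSpace (Euc e) B]
  {Γ V : Subgroup (grp n s)} {q : grp n s → X} {p : grp n s → B} {g : grp n s}
  {D : Amb n →L[ℝ] Euc d}

theorem IsSmoothQuotient.exists_section (hq : IsSmoothQuotient (d := d) Γ V q) (x : X) :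
    ∃ W σ, IsLocalSection (d := d) q W σ ∧ x ∈ W := by
  obtain ⟨g, rfl⟩ := hq.surjective x
  obtain ⟨W, σ, hσ, hg, -⟩ := hq.sections g
  exact ⟨W, σ, hσ, hg⟩

/-- The coupling form on a quotient by `U(n)`: the pull-back of `ambForm` by local sections. -/
noncomputable def couplingForm (hq : IsSmoothQuotient (d := d) Γ V q) : TwoForm d X := fun x =>
  (ambForm n s).compContinuousLinearMap
    (matDerivL (d := d) (hq.exists_section x).choose_spec.choose x)

theorem couplingForm_apply (hs : s * s = 1) (hΓ : DiscreteTopology Γ)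
    (hfree : ∀ γ ∈ Γ, ∀ g : grp n s, g⁻¹ * γ * g ∈ subSO n s → γ = 1)
    (hq : IsSmoothQuotient (d := d) Γ (subU n s) q) {W : Set X} {σ : X → Mat n}
    (hσ : IsLocalSection (d := d) q W σ) {x : X} (hx : x ∈ W) (v w : Euc d) :
    couplingForm hq x ![v, w]
      = ambForm n s ![matDerivL (d := d) σ x v, matDerivL (d := d) σ x w] := by
  have h1 := (hq.exists_section x).choose_spec.choose_spec
  rw [← ambForm_section_congr hs hΓ hfree hq hσ h1.1 hx h1.2]
  change ambForm n s (matDerivL (d := d) (hq.exists_section x).choose_spec.choose x ∘ ![v, w]) = _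
  congr 1
  funext i
  fin_cases i <;> rfl

theorem couplingForm_eq_kks (hs : s * s = 1) (hΓ : DiscreteTopology Γ)
    (hfree : ∀ γ ∈ Γ, ∀ g : grp n s, g⁻¹ * γ * g ∈ subSO n s → γ = 1)
    (hq : IsSmoothQuotient (d := d) Γ (subU n s) q) {W : Set X} {σ : X → Mat n}
    (hσ : IsLocalSection (d := d) q W σ) (hg : q g ∈ W) (hσg : σ (q g) = toMat g) (v w : Euc d) :
    couplingForm hq (q g) ![v, w] = kks n (lieComp g σ (q g) v) (lieComp g σ (q g) w) := by
  rw [couplingForm_apply hs hΓ hfree hq hσ hg, ambForm_matDerivL hs hσ hg hσg]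

theorem isCouplingForm_couplingForm (hs : s * s = 1) (hΓ : DiscreteTopology Γ)
    (hfree : ∀ γ ∈ Γ, ∀ g : grp n s, g⁻¹ * γ * g ∈ subSO n s → γ = 1)
    (hq : IsSmoothQuotient (d := d) Γ (subU n s) q) : IsCouplingForm q (couplingForm hq) := by
  intro W σ hσ x hx v w
  obtain ⟨g, hσg, rfl⟩ := hσ.isSection x hx
  exact (couplingForm_eq_kks hs hΓ hfree hq hσ hx hσg.symm v w).trans
    (hσ.couplingLift_eq hs hx hσg.symm v w).symm

/-- In a chart, the coupling form is the pull-back of a constant form by a smooth map. -/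
theorem inChart_couplingForm (hs : s * s = 1) (hΓ : DiscreteTopology Γ)
    (hfree : ∀ γ ∈ Γ, ∀ g : grp n s, g⁻¹ * γ * g ∈ subSO n s → γ = 1)
    (hq : IsSmoothQuotient (d := d) Γ (subU n s) q) {c : OpenPartialHomeomorph X (Euc d)}
    (hc : c ∈ atlas (Euc d) X) {y₀ : Euc d} (hy₀ : y₀ ∈ c.target) :
    ∃ S : Euc d → Amb n, ContDiffAt ℝ ∞ S y₀ ∧ ∀ᶠ y in 𝓝 y₀,
      inChart (couplingForm hq) c y = (ambForm n s).compContinuousLinearMap (fderiv ℝ S y) := by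
  have := hq.isManifold
  obtain ⟨g, hgx⟩ := hq.surjective (c.symm y₀)
  obtain ⟨W, σ, hσ, hg, hσg⟩ := hq.sections g
  rw [hgx] at hg
  have hcs : ContMDiffOn 𝓘(ℝ, Euc d) 𝓘(ℝ, Euc d) ∞ c.symm c.target :=
    contMDiffOn_symm_of_mem_maximalAtlas (IsManifold.subset_maximalAtlas hc)
  have hcs' : ∀ y ∈ c.target, ContMDiffAt 𝓘(ℝ, Euc d) 𝓘(ℝ, Euc d) ∞ c.symm y := fun y hy =>
    hcs.contMDiffAt (c.open_target.mem_nhds hy)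
  refine ⟨fun y => Matrix.of.symm (σ (c.symm y)), ?_, ?_⟩
  · exact contMDiffAt_iff_contDiffAt.1 ((hσ.contMDiffAt hg).comp y₀ (hcs' y₀ hy₀))
  · have hW : ∀ᶠ y in 𝓝 y₀, c.symm y ∈ W :=
      (hcs' y₀ hy₀).continuousAt (hσ.isOpen.mem_nhds hg)
    filter_upwards [hW, c.open_target.mem_nhds hy₀] with y hyW hy
    have h1 := ((hcs' y hy).mdifferentiableAt (by simp)).hasMFDerivAt
    let T : Euc d →L[ℝ] Euc d := mfderiv 𝓘(ℝ, Euc d) 𝓘(ℝ, Euc d) c.symm y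
    have h2' := (hσ.hasMFDerivAt hyW).comp y h1
    have h2 : HasFDerivAt (fun y => Matrix.of.symm (σ (c.symm y)))
      ((matDerivL (d := d) σ (c.symm y)).comp T) y := hasMFDerivAt_iff_hasFDerivAt.1 h2'
    have h4 := fun m : Fin 2 → Euc d =>
      couplingForm_apply hs hΓ hfree hq hσ hyW (T (m 0)) (T (m 1))
    rw [h2.fderiv]
    ext m
    change couplingForm hq (c.symm y) (T ∘ m)
      = ambForm n s (((matDerivL (d := d) σ (c.symm y)).comp T) ∘ m)
    refine Eq.trans (congrArg (couplingForm hq (c.symm y)) ?_)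
      ((h4 m).trans (congrArg (ambForm n s) ?_)) <;>
    · funext i
      fin_cases i <;> rfl

theorem contDiffAt_flip {F G H : Type*} [NormedAddCommGroup F] [NormedSpace ℝ F]
    [NormedAddCommGroup G] [NormedSpace ℝ G] [NormedAddCommGroup H] [NormedSpace ℝ H]
    {β : F → G →L[ℝ] H →L[ℝ] ℝ} {y : F} (hβ : ContDiffAt ℝ ∞ β y) :
    ContDiffAt ℝ ∞ (fun y => (β y).flip) y := by
  have h : ContDiff ℝ ∞ (ContinuousLinearMap.flipₗᵢ ℝ G H ℝ) :=
    LinearIsometryEquiv.contDiff (F := H →L[ℝ] G →L[ℝ] ℝ) _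
  exact h.contDiffAt.comp y hβ

theorem contDiffAt_pullback {F : Type*} [NormedAddCommGroup F] [NormedSpace ℝ F]
    {S : F → Amb n} {y : F} (hS : ContDiffAt ℝ ∞ S y) :
    ContDiffAt ℝ ∞ (fun y => (ambForm n s).compContinuousLinearMap (fderiv ℝ S y)) y := by
  have h1 : ContDiffAt ℝ ∞ (fderiv ℝ S) y := hS.fderiv_right (m := ∞) (by simp)
  simp only [ambForm, altForm_compContinuousLinearMap]
  refine (altForm F).contDiff.contDiffAt.comp y (contDiffAt_flip ?_)
  exact (contDiffAt_flip ((contDiffAt_const (c := adjTraceForm n s)).clm_comp h1)).clm_comp h1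

/-- The radical is the centralizer of `J`. -/
theorem kks_nondegenerate (hs : s * s = 1) (hn : 1 ≤ n) {ξ : Mat n} (hξ : adj s ξ = -ξ)
    (h : ∀ ζ : Mat n, adj s ζ = -ζ → kks n ξ ζ = 0) : ξ * Jhat n = Jhat n * ξ := by
  have h1 := eq_zero_of_trace_mul (adj_commutator hs (adj_Jhat hs) hξ) fun ζ hζ => by
    have := h ζ hζ
    rw [kks_eq, neg_eq_zero] at this
    exact (mul_eq_zero.1 this).resolve_left (covec_const_ne_zero hn)
  exact (sub_eq_zero.1 h1).symm

/-- On `so(2n)` too, the radical is the centralizer of `J`: for `η = [J, ξ]`, pair `ξ` with `ηᵀ`. -/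
theorem kks_nondegenerate_fibre (hs : s * s = 1) (hn : 1 ≤ n) {ξ : Mat n} (hξ : adj s ξ = -ξ)
    (hξE : ξ * lastProj n = 0)
    (h : ∀ ζ : Mat n, adj s ζ = -ζ → ζ * lastProj n = 0 → kks n ξ ζ = 0) :
    ξ * Jhat n = Jhat n * ξ := by
  set η := Jhat n * ξ - ξ * Jhat n with hη
  have hsk : adj s η = -η := adj_commutator hs (adj_Jhat hs) hξ
  have hEξ : lastProj n * ξ = 0 := by
    have := congrArg (adj s) hξE
    rw [adj_mul hs, adj_lastProj hs, hξ, Matrix.mul_neg, map_zero, neg_eq_zero] at this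
    exact this
  have hEη : lastProj n * η = 0 := by
    rw [hη, Matrix.mul_sub, ← Matrix.mul_assoc, lastProj_mul_Jhat, ← Matrix.mul_assoc, hEξ]
    simp
  have hE : (lastProj n)ᵀ = lastProj n := by
    rw [lastProj, Matrix.fromBlocks_transpose]; simp
  have h1 := h ηᵀ (adj_transpose hsk) (by
    rw [← hE, ← Matrix.transpose_mul, hEη, Matrix.transpose_zero])
  rw [kks_eq, neg_eq_zero] at h1
  have h2 := (mul_eq_zero.1 h1).resolve_left (covec_const_ne_zero hn)
  exact (sub_eq_zero.1 (eq_zero_of_trace_mul_transpose h2)).symm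

/-- The coupling form pairs a vector `v` with the projection of `gζ` to the value at `ζ` of the
linear form defined by the commutator with `J` of the Lie algebra component of `v`. -/
theorem couplingForm_apply_differential (hs : s * s = 1) (hΓ : DiscreteTopology Γ)
    (hfree : ∀ γ ∈ Γ, ∀ g : grp n s, g⁻¹ * γ * g ∈ subSO n s → γ = 1)
    (hq : IsSmoothQuotient (d := d) Γ (subU n s) q) (hD : IsDifferentialAt q g D)
    {W : Set X} {σ : X → Mat n}
    (hσ : IsLocalSection (d := d) q W σ) (hg : q g ∈ W) (hσg : σ (q g) = toMat g) (v : Euc d)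
    {ζ : Mat n} (hζ : adj s ζ = -ζ) :
    couplingForm hq (q g) ![v, D (Matrix.of.symm (toMat g * ζ))]
      = kks n (lieComp g σ (q g) v) ζ := by
  refine (couplingForm_eq_kks hs hΓ hfree hq hσ hg hσg v _).trans (kks_congr rfl ?_)
  exact hD.commutator_section hs hΓ hfree hq hσ hg hσg hζ rfl

theorem cayGrp_smul_mem_subU (hs : s * s = 1) {ξ : Mat n} (h : ξ * Jhat n = Jhat n * ξ) (t : ℝ) :
    cayGrp hs (t • ξ) ∈ subU n s :=
  cayGrp_mem_subU hs (by rw [Matrix.smul_mul, h, Matrix.mul_smul])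

theorem cayGrp_smul_mem_subSO (hs : s * s = 1) {ξ : Mat n} (h : ξ * lastProj n = 0) (t : ℝ) :
    cayGrp hs (t • ξ) ∈ subSO n s :=
  cayGrp_mem_subSO hs (by rw [Matrix.smul_mul, h, smul_zero])

theorem isSymplecticForm_couplingForm (hn : 1 ≤ n) (hs : s * s = 1) (hΓ : DiscreteTopology Γ)
    (hfree : ∀ γ ∈ Γ, ∀ g : grp n s, g⁻¹ * γ * g ∈ subSO n s → γ = 1)
    (hq : IsSmoothQuotient (d := d) Γ (subU n s) q) : IsSymplecticForm (couplingForm hq) where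
  smooth c hc y₀ hy₀ := by
    obtain ⟨S, hS, hev⟩ := inChart_couplingForm hs hΓ hfree hq hc hy₀
    exact ((contDiffAt_pullback hS).congr_of_eventuallyEq hev).contDiffWithinAt
  closed c hc y₀ hy₀ := by
    obtain ⟨S, hS, hev⟩ := inChart_couplingForm hs hΓ hfree hq hc hy₀
    rw [Filter.EventuallyEq.extDeriv_eq hev]
    have h1 := extDeriv_pullback (differentiableAt_const (ambForm n s)) hS
      (by simpa using WithTop.coe_le_coe.2 (le_top : (2 : ℕ∞) ≤ ⊤))
    rw [h1]
    have h2 : extDeriv (fun _ : Amb n => ambForm n s) (S y₀) = 0 := by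
      rw [extDeriv, fderiv_fun_const]
      exact map_zero (ContinuousAlternatingMap.alternatizeUncurryFinCLM ℝ (Amb n) ℝ)
    rw [h2]
    ext m
    simp
  nondegenerate x v h := by
    obtain ⟨g, rfl⟩ := hq.surjective x
    obtain ⟨W, σ, hσ, hg, hσg⟩ := hq.sections g
    obtain ⟨D, hD⟩ := hq.exists_differential g
    have hv := hD.apply_lieComp hσ hg hσg v
    have hξ : adj s (lieComp g σ (q g) v) = -lieComp g σ (q g) v :=
      hσ.skew_matDerivL hs hg hσg v
    have h1 := kks_nondegenerate hs hn hξ fun ζ hζ =>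
      (couplingForm_apply_differential hs hΓ hfree hq hD hσ hg hσg v hζ).symm.trans (h _)
    exact hv.symm.trans (hD.apply_eq_zero hs hq hξ (cayGrp_smul_mem_subU hs h1))

/-- The projection between quotients intertwines the differentials. -/
theorem IsDifferentialAt.mfderiv_proj (hs : s * s = 1) {π : X → B} (hπ : ∀ g, π (q g) = p g)
    {D' : Amb n →L[ℝ] Euc e} (hD : IsDifferentialAt q g D) (hD' : IsDifferentialAt p g D')
    (hd : MDifferentiableAt 𝓘(ℝ, Euc d) 𝓘(ℝ, Euc e) π (q g)) {ζ : Mat n} (hζ : adj s ζ = -ζ) :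
    (mfderiv 𝓘(ℝ, Euc d) 𝓘(ℝ, Euc e) π (q g) (D (Matrix.of.symm (toMat g * ζ))) : Euc e)
      = D' (Matrix.of.symm (toMat g * ζ)) := by
  have e0 : g * cayGrp hs ((0 : ℝ) • ζ) = g := by simp
  obtain ⟨E, hE1, hE⟩ := hD.2 (fun t => g * cayGrp hs (t • ζ)) _ e0 (hasDerivAt_mul_cayGrp hs g hζ)
  obtain ⟨E', hE1', hE'⟩ :=
    hD'.2 (fun t => g * cayGrp hs (t • ζ)) _ e0 (hasDerivAt_mul_cayGrp hs g hζ)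
  let T : Euc d →L[ℝ] Euc e := mfderiv 𝓘(ℝ, Euc d) 𝓘(ℝ, Euc e) π (q g)
  have h1 : HasMFDerivAt 𝓘(ℝ, Euc d) 𝓘(ℝ, Euc e) π (q (g * cayGrp hs ((0 : ℝ) • ζ))) T := by
    rw [e0]
    exact hd.hasMFDerivAt
  have h2 := h1.comp (0 : ℝ) hE
  have h3 : HasMFDerivAt 𝓘(ℝ, ℝ) 𝓘(ℝ, Euc e) (fun t : ℝ => p (g * cayGrp hs (t • ζ))) 0 (T.comp E) :=
    h2.congr_of_eventuallyEq (Eventually.of_forall fun t => (hπ _).symm)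
  have h4 := congrArg (fun f : ℝ →L[ℝ] Euc e => f 1) (hasMFDerivAt_unique h3 hE')
  have h5 : T (E 1) = E' 1 := h4
  rw [hE1, hE1'] at h5
  exact h5

theorem contMDiffAt_proj {π : X → B} (hπ : ∀ g, π (q g) = p g)
    (hq : IsSmoothQuotient (d := d) Γ (subU n s) q)
    (hp : IsSmoothQuotient (d := e) Γ (subSO n s) p) (x : X) :
    ContMDiffAt 𝓘(ℝ, Euc d) 𝓘(ℝ, Euc e) ∞ π x := by
  obtain ⟨g, rfl⟩ := hq.surjective x
  obtain ⟨W, σ, hσ, hg, hσg⟩ := hq.sections g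
  obtain ⟨U, P, hU, hgU, hP, hPp⟩ := hp.smooth g
  have hPat : ContMDiffAt 𝓘(ℝ, Amb n) 𝓘(ℝ, Euc e) ∞ P (Matrix.of.symm (σ (q g))) := by
    rw [hσg]
    exact hP.contMDiffAt (hU.mem_nhds hgU)
  have h1 := hPat.comp (q g) (hσ.contMDiffAt hg)
  refine h1.congr_of_eventuallyEq ?_
  have hUσ : ∀ᶠ x in 𝓝 (q g), Matrix.of.symm (σ x) ∈ U :=
    (hσ.contMDiffAt hg).continuousAt (by rw [hσg]; exact hU.mem_nhds hgU)
  filter_upwards [hUσ, hσ.isOpen.mem_nhds hg] with x hxU hxW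
  obtain ⟨k, hk, rfl⟩ := hσ.isSection x hxW
  change π (q k) = P (Matrix.of.symm (σ (q k)))
  rw [hπ, ← hk, hPp k (by rw [hk]; exact hxU)]

/-- The coupling form is fibrewise symplectic on every smooth quotient by `U(n)` that fibres over a
smooth quotient by `SO(2n)`. -/
theorem isSymplecticallyFat_of_isSmoothQuotient (hn : 1 ≤ n) (hs : s * s = 1)
    (hΓ : DiscreteTopology Γ)
    (hfree : ∀ γ ∈ Γ, ∀ g : grp n s, g⁻¹ * γ * g ∈ subSO n s → γ = 1)
    (hq : IsSmoothQuotient (d := d) Γ (subU n s) q)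
    (hp : IsSmoothQuotient (d := e) Γ (subSO n s) p) :
    IsSymplecticallyFat (d := d) (e := e) q p := by
  let π : X → B := fun x => p (hq.surjective x).choose
  have hπ : ∀ g, π (q g) = p g := by
    intro g
    obtain ⟨γ, hγ, h, hh, e⟩ := (hq.fibres _ _).1 (hq.surjective (q g)).choose_spec
    exact (hp.fibres _ _).2 ⟨γ, hγ, h, subU_le_subSO hh, e⟩
  have hsm := contMDiffAt_proj hπ hq hp
  have hdiff := fun x => (hsm x).mdifferentiableAt (by simp : (∞ : WithTop ℕ∞) ≠ 0)
  refine ⟨π, hπ, couplingForm hq, ⟨hsm, ?_, ?_, isSymplecticForm_couplingForm hn hs hΓ hfree hq, ?_⟩,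
    isCouplingForm_couplingForm hs hΓ hfree hq⟩
  · intro b
    obtain ⟨g, rfl⟩ := hp.surjective b
    exact ⟨q g, hπ g⟩
  · intro x b
    obtain ⟨g, rfl⟩ := hq.surjective x
    obtain ⟨D, hD⟩ := hq.exists_differential g
    obtain ⟨D', hD'⟩ := hp.exists_differential g
    obtain ⟨W, τ, hτ, hg, hτg⟩ := hp.sections g
    have hb := hD'.apply_lieComp hτ hg hτg b
    refine ⟨D (Matrix.of.symm (toMat g * lieComp g τ (p g) b)), ?_⟩
    exact (hD.mfderiv_proj hs hπ hD' (hdiff _) (hτ.skew_matDerivL hs hg hτg b)).trans hb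
  · intro x v hv h
    obtain ⟨g, rfl⟩ := hq.surjective x
    obtain ⟨W, σ, hσ, hg, hσg⟩ := hq.sections g
    obtain ⟨D, hD⟩ := hq.exists_differential g
    obtain ⟨D', hD'⟩ := hp.exists_differential g
    have hvξ := hD.apply_lieComp hσ hg hσg v
    have hξ : adj s (lieComp g σ (q g) v) = -lieComp g σ (q g) v :=
      hσ.skew_matDerivL hs hg hσg v
    have h0 := hD.mfderiv_proj hs hπ hD' (hdiff _) hξ
    have h0' : D' (Matrix.of.symm (toMat g * lieComp g σ (q g) v)) = 0 :=
      h0.symm.trans ((congrArg (fun w : Euc d =>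
        (mfderiv 𝓘(ℝ, Euc d) 𝓘(ℝ, Euc e) π (q g) w : Euc e)) hvξ).trans hv)
    have hξE := hD'.mul_lastProj_eq_zero hs hΓ hfree hp hξ h0'
    have h1 := kks_nondegenerate_fibre hs hn hξ hξE fun ζ hζ hζE =>
      (couplingForm_apply_differential hs hΓ hfree hq hD hσ hg hσg v hζ).symm.trans
        (h _ ((hD.mfderiv_proj hs hπ hD' (hdiff _) hζ).trans
          (hD'.apply_eq_zero hs hp hζ (cayGrp_smul_mem_subSO hs hζE))))
    exact hvξ.symm.trans (hD.apply_eq_zero hs hq hξ (cayGrp_smul_mem_subU hs h1))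

end Quotients

/-! ### The smooth structure of a double coset space -/

/-- A slice for the right action of `V` near the identity: a smooth map `c` to the group that is
transverse to the cosets of `V`, with a smooth map `r`, defined on an open set `T` of matrices, that
sends a group element to the parameter of the point of the slice in its coset. -/
structure CosetSlice (V : Subgroup (grp n s)) (d : ℕ) where
  c : Euc d → grp n s
  S : Set (Euc d)
  T : Set (Mat n)
  r : Mat n → Euc d
  isOpen_S : IsOpen S
  zero_mem : (0 : Euc d) ∈ S
  c_zero : c 0 = 1
  c_smooth : ∀ y ∈ S, ContDiffAt ℝ ∞ (fun y => toMat (c y)) y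
  isOpen_T : IsOpen T
  r_smooth : ∀ a ∈ T, ContDiffAt ℝ ∞ r a
  c_mem : ∀ y ∈ S, toMat (c y) ∈ T
  r_c : ∀ y ∈ S, r (toMat (c y)) = y
  decomp : ∀ a : grp n s, toMat a ∈ T → ∃ h ∈ V, a = c (r (toMat a)) * h
  inj : ∀ᶠ p : Euc d × Euc d in 𝓝 0 ×ˢ 𝓝 0, ∀ h ∈ V, c p.1 * h = c p.2 → p.1 = p.2

namespace CosetSlice

variable {V : Subgroup (grp n s)} {d : ℕ} (P : CosetSlice V d) (Γ : Subgroup (grp n s))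

theorem continuousAt_c {y : Euc d} (hy : y ∈ P.S) : ContinuousAt P.c y :=
  isInducing_toMat.continuousAt_iff.2 (P.c_smooth y hy).continuousAt

/-- The inverse of the chart centred at the class of `g`. -/
def param (g : grp n s) (y : Euc d) : Biquotient Γ V := biquotientMk Γ V (g * P.c y)

end CosetSlice

section Biquotient

variable {Γ V : Subgroup (grp n s)} {d : ℕ}

theorem biquotientMk_eq_iff {g g' : grp n s} :
    biquotientMk Γ V g = biquotientMk Γ V g' ↔ ∃ γ ∈ Γ, ∃ h ∈ V, g' = γ * g * h :=
  Quotient.eq.trans DoubleCoset.rel_iff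

theorem isQuotientMap_biquotientMk : IsQuotientMap (biquotientMk Γ V) := isQuotientMap_quotient_mk'

theorem biquotientMk_surjective : Function.Surjective (biquotientMk Γ V) :=
  isQuotientMap_biquotientMk.surjective

end Biquotient

namespace CosetSlice

variable {V : Subgroup (grp n s)} {d : ℕ} (P : CosetSlice V d) {Γ : Subgroup (grp n s)}

theorem continuousAt_param (g : grp n s) {y : Euc d} (hy : y ∈ P.S) :
    ContinuousAt (P.param Γ g) y :=
  ContinuousAt.comp (g := biquotientMk Γ V) isQuotientMap_biquotientMk.continuous.continuousAt
    (continuousAt_const.mul (P.continuousAt_c hy))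

/-- By proper discontinuity, two points of a small slice that have the same class in `Γ \ G / V` lie in
the same coset of `V`. -/
theorem exists_injOn_param (hs : s * s = 1) (hΓ : DiscreteTopology Γ)
    (hfree : ∀ γ ∈ Γ, ∀ g : grp n s, g⁻¹ * γ * g ∈ subSO n s → γ = 1) (hV : V ≤ subSO n s)
    (g : grp n s) :
    ∃ O : Set (Euc d), IsOpen O ∧ 0 ∈ O ∧ O ⊆ P.S ∧ Set.InjOn (P.param Γ g) O := by
  obtain ⟨N, hN, hN1⟩ := exists_nhds_eq_one hs Γ hΓ hfree g
  have hc : ContinuousAt (fun y => g * P.c y) 0 :=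
    continuousAt_const.mul (P.continuousAt_c P.zero_mem)
  have h1 : ∀ᶠ y in 𝓝 (0 : Euc d), g * P.c y ∈ N :=
    hc (by simpa only [P.c_zero, mul_one] using hN)
  obtain ⟨t, ht, htinj⟩ := (eventually_prod_self_iff (r := fun y y' => ∀ h ∈ V,
    P.c y * h = P.c y' → y = y')).1 P.inj
  obtain ⟨O, hO, hOo, hO0⟩ := mem_nhds_iff.1
    (inter_mem (inter_mem ht h1) (P.isOpen_S.mem_nhds P.zero_mem))
  refine ⟨O, hOo, hO0, fun y hy => (hO hy).2, fun y hy y' hy' e => ?_⟩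
  obtain ⟨γ, hγ, h, hh, e'⟩ := biquotientMk_eq_iff.1 e
  have hγ1 := hN1 _ (hO hy).1.2 _ (hO hy').1.2 γ hγ h (hV hh) e'
  rw [hγ1, one_mul, mul_assoc, mul_left_cancel_iff] at e'
  exact htinj y (hO hy).1.1 y' (hO hy').1.1 h hh e'.symm

/-- Near a point of the slice through `g`, the projection is `param` composed with the smooth map
`r`. -/
theorem param_r {g a : grp n s} (ha : toMat a ∈ P.T) :
    P.param Γ g (P.r (toMat a)) = biquotientMk Γ V (g * a) := by
  obtain ⟨h, hh, e⟩ := P.decomp a ha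
  refine biquotientMk_eq_iff.2 ⟨1, one_mem _, h, hh, ?_⟩
  rw [one_mul, mul_assoc, ← e]

theorem isOpen_image_param (g : grp n s) {O : Set (Euc d)} (hO : IsOpen O) (hOS : O ⊆ P.S) :
    IsOpen (P.param Γ g '' O) := by
  rw [← isQuotientMap_biquotientMk.isOpen_preimage, isOpen_iff_mem_nhds]
  rintro k ⟨y, hy, hky⟩
  obtain ⟨γ, hγ, h, hh, rfl⟩ := biquotientMk_eq_iff.1 hky
  have hcont : Continuous fun k : grp n s => g⁻¹ * γ⁻¹ * k * h⁻¹ :=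
    (continuous_const.mul continuous_id).mul continuous_const
  have e : g⁻¹ * γ⁻¹ * (γ * (g * P.c y) * h) * h⁻¹ = P.c y := by group
  have h0 := P.c_mem y (hOS hy)
  have hc : ContinuousAt (fun k : grp n s => toMat (g⁻¹ * γ⁻¹ * k * h⁻¹)) (γ * (g * P.c y) * h) :=
    (continuous_toMat.comp hcont).continuousAt
  have h1 : ∀ᶠ k in 𝓝 (γ * (g * P.c y) * h), toMat (g⁻¹ * γ⁻¹ * k * h⁻¹) ∈ P.T :=
    hc (by simpa only [e] using P.isOpen_T.mem_nhds h0)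
  have h2 : ∀ᶠ k in 𝓝 (γ * (g * P.c y) * h), P.r (toMat (g⁻¹ * γ⁻¹ * k * h⁻¹)) ∈ O := by
    have hr : ContinuousAt P.r (toMat (g⁻¹ * γ⁻¹ * (γ * (g * P.c y) * h) * h⁻¹)) := by
      rw [e]; exact (P.r_smooth _ h0).continuousAt
    refine (ContinuousAt.comp (f := fun k : grp n s => toMat (g⁻¹ * γ⁻¹ * k * h⁻¹)) hr hc)
      (hO.mem_nhds ?_)
    simpa only [Function.comp_apply, e, P.r_c y (hOS hy)] using hy
  filter_upwards [h1, h2] with k hk1 hk2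
  refine ⟨_, hk2, ?_⟩
  rw [P.param_r hk1]
  refine biquotientMk_eq_iff.2 ⟨γ, hγ, h, hh, ?_⟩
  group

section Charts

variable (hs : s * s = 1) (hΓ : DiscreteTopology Γ)
  (hfree : ∀ γ ∈ Γ, ∀ g : grp n s, g⁻¹ * γ * g ∈ subSO n s → γ = 1) (hV : V ≤ subSO n s)

/-- The domain of parameters of the chart centred at the class of `g`. -/
noncomputable def dom (g : grp n s) : Set (Euc d) := (P.exists_injOn_param hs hΓ hfree hV g).choose

theorem dom_spec (g : grp n s) : IsOpen (P.dom hs hΓ hfree hV g) ∧ 0 ∈ P.dom hs hΓ hfree hV g ∧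
    P.dom hs hΓ hfree hV g ⊆ P.S ∧ Set.InjOn (P.param Γ g) (P.dom hs hΓ hfree hV g) :=
  (P.exists_injOn_param hs hΓ hfree hV g).choose_spec

/-- The chart of the double coset space centred at the class of `g`. -/
noncomputable def chart (g : grp n s) : OpenPartialHomeomorph (Biquotient Γ V) (Euc d) :=
  (OpenPartialHomeomorph.ofContinuousOpenRestrict
    ((P.dom_spec hs hΓ hfree hV g).2.2.2.toPartialEquiv (P.param Γ g) (P.dom hs hΓ hfree hV g))
    (fun _ hy => (P.continuousAt_param g ((P.dom_spec hs hΓ hfree hV g).2.2.1 hy)).continuousWithinAt)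
    (by
      intro U hU
      obtain ⟨O, hO, rfl⟩ := isOpen_induced_iff.1 hU
      have h := P.dom_spec hs hΓ hfree hV g
      have e : (P.dom hs hΓ hfree hV g).domRestrict (P.param Γ g) '' (Subtype.val ⁻¹' O)
          = P.param Γ g '' (P.dom hs hΓ hfree hV g ∩ O) := by
        ext x
        constructor
        · rintro ⟨y, hy, rfl⟩
          exact ⟨y, ⟨y.2, hy⟩, rfl⟩
        · rintro ⟨y, ⟨hy, hyO⟩, rfl⟩
          exact ⟨⟨y, hy⟩, hyO, rfl⟩
      exact e ▸ P.isOpen_image_param g (h.1.inter hO) (Set.inter_subset_left.trans h.2.2.1))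
    (P.dom_spec hs hΓ hfree hV g).1).symm

theorem chart_param (g : grp n s) {y : Euc d} (hy : y ∈ P.dom hs hΓ hfree hV g) :
    P.chart hs hΓ hfree hV g (P.param Γ g y) = y :=
  (P.chart hs hΓ hfree hV g).right_inv hy

theorem param_mem_source (g : grp n s) {y : Euc d} (hy : y ∈ P.dom hs hΓ hfree hV g) :
    P.param Γ g y ∈ (P.chart hs hΓ hfree hV g).source :=
  (P.chart hs hΓ hfree hV g).map_target hy

theorem param_zero (g : grp n s) : P.param Γ g 0 = biquotientMk Γ V g := by
  rw [param, P.c_zero, mul_one]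

theorem mk_mem_source (g : grp n s) : biquotientMk Γ V g ∈ (P.chart hs hΓ hfree hV g).source := by
  rw [← P.param_zero]
  exact P.param_mem_source hs hΓ hfree hV g (P.dom_spec hs hΓ hfree hV g).2.1

theorem mem_source_of_mk_eq {g : grp n s} {x : Biquotient Γ V} (h : biquotientMk Γ V g = x) :
    x ∈ (P.chart hs hΓ hfree hV g).source :=
  h ▸ P.mk_mem_source hs hΓ hfree hV g

/-- The smooth structure of the double coset space. -/
@[reducible] noncomputable def chartedSpace : ChartedSpace (Euc d) (Biquotient Γ V) where
  atlas := Set.range (P.chart hs hΓ hfree hV)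
  chartAt x := P.chart hs hΓ hfree hV (biquotientMk_surjective x).choose
  mem_chart_source x := P.mem_source_of_mk_eq hs hΓ hfree hV (biquotientMk_surjective x).choose_spec
  chart_mem_atlas _ := Set.mem_range_self _

/-- The coordinate changes are `y ↦ r (g₁⁻¹ γ g c(y) h)` with locally constant `γ` and `h`. -/
theorem contDiffOn_transition (g g₁ : grp n s) :
    ContDiffOn ℝ ∞ (fun y => P.chart hs hΓ hfree hV g₁ (P.param Γ g y))
      {y | y ∈ P.dom hs hΓ hfree hV g ∧ P.param Γ g y ∈ (P.chart hs hΓ hfree hV g₁).source} := by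
  rintro y₀ ⟨hy₀, hsrc⟩
  refine ContDiffAt.contDiffWithinAt ?_
  have hd := P.dom_spec hs hΓ hfree hV g
  have hd₁ := P.dom_spec hs hΓ hfree hV g₁
  obtain ⟨y₁, hy₁, e₁⟩ : ∃ y₁ ∈ P.dom hs hΓ hfree hV g₁, P.param Γ g₁ y₁ = P.param Γ g y₀ :=
    ⟨_, (P.chart hs hΓ hfree hV g₁).map_source hsrc, (P.chart hs hΓ hfree hV g₁).left_inv hsrc⟩
  obtain ⟨γ, hγ, h, hh, e⟩ := biquotientMk_eq_iff.1 e₁.symm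
  let a : Euc d → grp n s := fun y => g₁⁻¹ * γ * g * P.c y * h
  have ha₀ : a y₀ = P.c y₁ := by
    have : g₁⁻¹ * (g₁ * P.c y₁) = g₁⁻¹ * (γ * (g * P.c y₀) * h) := by rw [e]
    rw [inv_mul_cancel_left] at this
    rw [this]; simp only [a, mul_assoc]
  have hT := P.c_mem y₁ (hd₁.2.2.1 hy₁)
  have hasm : ContDiffAt ℝ ∞ (fun y => toMat (a y)) y₀ := by
    have : ContDiffAt ℝ ∞ (fun y => toMat (g₁⁻¹ * γ * g) * toMat (P.c y) * toMat h) y₀ :=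
      contDiffAt_matMul (contDiffAt_matMul contDiffAt_const (P.c_smooth y₀ (hd.2.2.1 hy₀)))
        contDiffAt_const
    simpa only [a, toMat_mul] using this
  have hrsm : ContDiffAt ℝ ∞ (fun y => P.r (toMat (a y))) y₀ :=
    ContDiffAt.comp (g := P.r) y₀ (P.r_smooth _ (by rw [ha₀]; exact hT)) hasm
  refine hrsm.congr_of_eventuallyEq ?_
  have h1 : ∀ᶠ y in 𝓝 y₀, toMat (a y) ∈ P.T :=
    hasm.continuousAt (P.isOpen_T.mem_nhds (by rw [ha₀]; exact hT))
  have h2 : ∀ᶠ y in 𝓝 y₀, P.r (toMat (a y)) ∈ P.dom hs hΓ hfree hV g₁ :=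
    hrsm.continuousAt (hd₁.1.mem_nhds (by rw [ha₀, P.r_c _ (hd₁.2.2.1 hy₁)]; exact hy₁))
  filter_upwards [h1, h2] with y hy1 hy2
  have h3 : P.param Γ g y = P.param Γ g₁ (P.r (toMat (a y))) := by
    rw [P.param_r hy1]
    refine biquotientMk_eq_iff.2 ⟨γ, hγ, h, hh, ?_⟩
    simp only [a]; group
  rw [h3, P.chart_param hs hΓ hfree hV g₁ hy2]

theorem isManifold : letI := P.chartedSpace hs hΓ hfree hV
    IsManifold 𝓘(ℝ, Euc d) ∞ (Biquotient Γ V) := by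
  let _ := P.chartedSpace hs hΓ hfree hV
  refine isManifold_of_contDiffOn _ _ _ ?_
  rintro _ _ ⟨g, rfl⟩ ⟨g₁, rfl⟩
  refine (P.contDiffOn_transition hs hΓ hfree hV g g₁).mono ?_
  rintro y ⟨⟨hy1, hy2⟩, -⟩
  exact ⟨hy1, hy2⟩

theorem isSmoothQuotient : letI := P.chartedSpace hs hΓ hfree hV
    IsSmoothQuotient (d := d) Γ V (biquotientMk Γ V) := by
  let _ := P.chartedSpace hs hΓ hfree hV
  have hM := P.isManifold hs hΓ hfree hV
  refine ⟨hM, biquotientMk_surjective, fun g g' => biquotientMk_eq_iff, fun g => ?_, fun g => ?_⟩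
  · have hd := P.dom_spec hs hΓ hfree hV g
    have hT1 : (1 : Mat n) ∈ P.T := by
      have := P.c_mem 0 P.zero_mem
      rwa [P.c_zero, toMat_one] at this
    have hr1 : P.r 1 = 0 := by
      have := P.r_c 0 P.zero_mem
      rwa [P.c_zero, toMat_one] at this
    have hat : (P.chart hs hΓ hfree hV g) ∈ atlas (Euc d) (Biquotient Γ V) := Set.mem_range_self g
    have hsymm : ContMDiffOn 𝓘(ℝ, Euc d) 𝓘(ℝ, Euc d) ∞ (P.chart hs hΓ hfree hV g).symm
        (P.dom hs hΓ hfree hV g) :=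
      contMDiffOn_symm_of_mem_maximalAtlas (IsManifold.subset_maximalAtlas hat)
    let f : Amb n → Mat n := fun A => toMat g⁻¹ * Matrix.of A
    have hf : ContDiff ℝ ∞ f := contDiff_iff_contDiffAt.2 fun A =>
      contDiffAt_matMul contDiffAt_const (contDiff_id.contDiffAt (x := A))
    have hgood : {A : Mat n | A ∈ P.T ∧ P.r A ∈ P.dom hs hΓ hfree hV g} ∈ 𝓝 (1 : Mat n) := by
      refine inter_mem (P.isOpen_T.mem_nhds hT1) ?_
      exact (P.r_smooth 1 hT1).continuousAt (hd.1.mem_nhds (by rw [hr1]; exact hd.2.1))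
    obtain ⟨O, hO, hOo, hO1⟩ := mem_nhds_iff.1 hgood
    refine ⟨f ⁻¹' O, fun A => P.param Γ g (P.r (f A)), hOo.preimage hf.continuous, ?_, ?_, ?_⟩
    · change toMat g⁻¹ * toMat g ∈ O
      rw [toMat_inv_mul]; exact hO1
    · intro A hA
      have h1 : ContDiffAt ℝ ∞ (fun A => P.r (f A)) A :=
        ContDiffAt.comp (g := P.r) A (P.r_smooth _ (hO hA).1) hf.contDiffAt
      have h2 := (hsymm.contMDiffAt (hd.1.mem_nhds (hO hA).2)).comp A h1.contMDiffAt
      exact h2.contMDiffWithinAt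
    · intro g' hg'
      have e : f (Matrix.of.symm (toMat g')) = toMat (g⁻¹ * g') := (toMat_mul _ _).symm
      have h1 : toMat (g⁻¹ * g') ∈ P.T := by
        rw [← e]; exact (hO hg').1
      change P.param Γ g (P.r (f (Matrix.of.symm (toMat g')))) = _
      rw [e, P.param_r h1, mul_inv_cancel_left]
  · have hd := P.dom_spec hs hΓ hfree hV g
    have hat : (P.chart hs hΓ hfree hV g) ∈ atlas (Euc d) (Biquotient Γ V) := Set.mem_range_self g
    have hch : ContMDiffOn 𝓘(ℝ, Euc d) 𝓘(ℝ, Euc d) ∞ (P.chart hs hΓ hfree hV g)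
        (P.chart hs hΓ hfree hV g).source :=
      contMDiffOn_of_mem_maximalAtlas (IsManifold.subset_maximalAtlas hat)
    refine ⟨(P.chart hs hΓ hfree hV g).source,
      fun x => toMat (g * P.c (P.chart hs hΓ hfree hV g x)),
      ⟨(P.chart hs hΓ hfree hV g).open_source, fun i j x hx => ?_, fun x hx => ?_⟩,
      P.mk_mem_source hs hΓ hfree hV g, ?_⟩
    · have hy : P.chart hs hΓ hfree hV g x ∈ P.S :=
        hd.2.2.1 ((P.chart hs hΓ hfree hV g).map_source hx)
      have h1 : ContDiffAt ℝ ∞ (fun y => toMat (g * P.c y)) (P.chart hs hΓ hfree hV g x) := by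
        have := contDiffAt_matMul (contDiffAt_const (c := toMat g)) (P.c_smooth _ hy)
        simpa only [toMat_mul] using this
      have h2 := contDiffAt_mat_iff.1 h1 i j
      exact (h2.contMDiffAt.comp x (hch.contMDiffAt
        ((P.chart hs hΓ hfree hV g).open_source.mem_nhds hx))).contMDiffWithinAt
    · exact ⟨_, rfl, (P.chart hs hΓ hfree hV g).left_inv hx⟩
    · have h1 : P.chart hs hΓ hfree hV g (biquotientMk Γ V g) = 0 := by
        rw [← P.param_zero, P.chart_param hs hΓ hfree hV g hd.2.1]
      change toMat (g * P.c (P.chart hs hΓ hfree hV g (biquotientMk Γ V g))) = toMat g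
      rw [h1, P.c_zero, mul_one]

end Charts

end CosetSlice

/-! ### Slices from the inverse function theorem -/

/-- `C` projects the matrices onto a subspace whose skew part is the Lie algebra of `V`, near the
identity and by means of the Cayley transform. -/
structure IsSliceProjection (hs : s * s = 1) (V : Subgroup (grp n s)) (C : Mat n →ₗ[ℝ] Mat n) :
    Prop where
  idem : ∀ A, C (C A) = C A
  adj_comm : ∀ A, adj s (C A) = C (adj s A)
  cay_mem : ∀ X, adj s X = -X → C X = X → cayGrp hs X ∈ V
  fixed : ∀ X, adj s X = -X → X ∈ cayDom n → cayGrp hs X ∈ V → C X = X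

/-- The skew part of a matrix. -/
noncomputable def skewPart (s : ℝ) : Mat n →ₗ[ℝ] Mat n := (1 / 2 : ℝ) • (LinearMap.id - adj s)

/-- The symmetric part of a matrix. -/
noncomputable def symPart (s : ℝ) : Mat n →ₗ[ℝ] Mat n := (1 / 2 : ℝ) • (LinearMap.id + adj s)

theorem skewPart_add_symPart (A : Mat n) : skewPart s A + symPart s A = A := by
  simp only [skewPart, symPart, LinearMap.smul_apply, LinearMap.sub_apply, LinearMap.add_apply,
    LinearMap.id_apply]
  module

theorem adj_skewPart (hs : s * s = 1) (A : Mat n) : adj s (skewPart s A) = -skewPart s A := by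
  simp only [skewPart, LinearMap.smul_apply, LinearMap.sub_apply, LinearMap.id_apply, map_smul,
    map_sub, adj_adj hs]
  module

theorem adj_symPart (hs : s * s = 1) (A : Mat n) : adj s (symPart s A) = symPart s A := by
  simp only [symPart, LinearMap.smul_apply, LinearMap.add_apply, LinearMap.id_apply, map_smul,
    map_add, adj_adj hs]
  module

theorem skewPart_of_skew {X : Mat n} (h : adj s X = -X) : skewPart s X = X := by
  simp only [skewPart, LinearMap.smul_apply, LinearMap.sub_apply, LinearMap.id_apply, h]
  module

theorem symPart_of_skew {X : Mat n} (h : adj s X = -X) : symPart s X = 0 := by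
  simp only [symPart, LinearMap.smul_apply, LinearMap.add_apply, LinearMap.id_apply, h]
  module

/-- The part of a skew matrix along the directions transverse to `V`. -/
noncomputable def transPart (s : ℝ) (C : Mat n →ₗ[ℝ] Mat n) : Mat n →ₗ[ℝ] Mat n :=
  (LinearMap.id - C).comp (skewPart s)

/-- The part of a skew matrix along `V`. -/
noncomputable def vertPart (s : ℝ) (C : Mat n →ₗ[ℝ] Mat n) : Mat n →ₗ[ℝ] Mat n :=
  C.comp (skewPart s)

theorem transPart_add_vertPart_add_symPart (C : Mat n →ₗ[ℝ] Mat n) (A : Mat n) :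
    transPart s C A + vertPart s C A + symPart s A = A := by
  have h : transPart s C A + vertPart s C A = skewPart s A := by simp [transPart, vertPart]
  rw [h, skewPart_add_symPart]

/-- The space of matrices near `1` as a product of the slice, the group `V` and the symmetric
matrices. -/
noncomputable def sliceMap (s : ℝ) (C : Mat n →ₗ[ℝ] Mat n) (A : Mat n) : Mat n :=
  cay (transPart s C A) * cay (vertPart s C A) * (1 + symPart s A)

theorem contDiff_linear (f : Mat n →ₗ[ℝ] Mat n) {k : WithTop ℕ∞} : ContDiff ℝ k f :=
  f.toContinuousLinearMap.contDiff

theorem contDiffAt_sliceMap (C : Mat n →ₗ[ℝ] Mat n) {k : WithTop ℕ∞} :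
    ContDiffAt ℝ k (sliceMap s C) 0 := by
  have h : ∀ f : Mat n →ₗ[ℝ] Mat n, ContDiffAt ℝ k (fun A => cay (f A)) 0 := fun f =>
    ContDiffAt.comp (g := cay) 0 (contDiffAt_cay (by rw [map_zero]; exact zero_mem_cayDom))
      (contDiff_linear f).contDiffAt
  exact contDiffAt_matMul (contDiffAt_matMul (h _) (h _))
    (contDiffAt_const.add (contDiff_linear _).contDiffAt)

theorem sliceMap_zero (C : Mat n →ₗ[ℝ] Mat n) : sliceMap s C 0 = 1 := by simp [sliceMap]

theorem hasFDerivAt_sliceMap (C : Mat n →ₗ[ℝ] Mat n) :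
    HasFDerivAt (sliceMap s C) (ContinuousLinearEquiv.refl ℝ (Mat n) : Mat n →L[ℝ] Mat n) 0 := by
  have h := ((contDiffAt_sliceMap (s := s) C (k := 1)).differentiableAt one_ne_zero).hasFDerivAt
  suffices e : fderiv ℝ (sliceMap s C) 0 = ContinuousLinearEquiv.refl ℝ (Mat n) from e ▸ h
  refine ContinuousLinearMap.ext fun A => ?_
  have h1 : HasDerivAt (fun t : ℝ => t • A) A 0 := by
    simpa using hasDerivAt_add_smul (0 : Mat n) A 0
  have h0 : HasFDerivAt (sliceMap s C) (fderiv ℝ (sliceMap s C) 0) ((0 : ℝ) • A) := by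
    rw [zero_smul]; exact h
  have h2 : HasDerivAt (fun t : ℝ => sliceMap s C (t • A)) (fderiv ℝ (sliceMap s C) 0 A) 0 :=
    HasFDerivAt.comp_hasDerivAt (l := sliceMap s C) (0 : ℝ) h0 h1
  have h3 := hasDerivAt_matMul (hasDerivAt_matMul (hasDerivAt_cay_smul (transPart s C A))
    (hasDerivAt_cay_smul (vertPart s C A))) (hasDerivAt_add_smul 1 (symPart s A) 0)
  have h4 := h2.unique (h3.congr_of_eventuallyEq (Eventually.of_forall fun t => by
    simp only [sliceMap, map_smul]))
  rw [h4]
  simp only [zero_smul, cay_zero, Matrix.one_mul, Matrix.mul_one, add_zero]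
  refine Eq.trans ?_ (transPart_add_vertPart_add_symPart (s := s) C A)
  abel

namespace IsSliceProjection

variable {hs : s * s = 1} {V : Subgroup (grp n s)} {C : Mat n →ₗ[ℝ] Mat n}
  (hC : IsSliceProjection hs V C)

include hC

theorem adj_vertPart (A : Mat n) : adj s (vertPart s C A) = -vertPart s C A := by
  rw [vertPart, LinearMap.comp_apply, hC.adj_comm, adj_skewPart hs, map_neg]

theorem adj_transPart (A : Mat n) : adj s (transPart s C A) = -transPart s C A := by
  simp only [transPart, LinearMap.comp_apply, LinearMap.sub_apply, LinearMap.id_apply, map_sub,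
    hC.adj_comm, adj_skewPart hs, map_neg]
  abel

theorem proj_vertPart (A : Mat n) : C (vertPart s C A) = vertPart s C A := hC.idem _

theorem proj_transPart (A : Mat n) : C (transPart s C A) = 0 := by
  simp only [transPart, LinearMap.comp_apply, LinearMap.sub_apply, LinearMap.id_apply, map_sub,
    hC.idem, sub_self]

theorem transPart_vertPart (A : Mat n) : transPart s C (vertPart s C A) = 0 := by
  rw [transPart, LinearMap.comp_apply, skewPart_of_skew (hC.adj_vertPart A), LinearMap.sub_apply,
    LinearMap.id_apply, hC.proj_vertPart, sub_self]

theorem vertPart_vertPart (A : Mat n) : vertPart s C (vertPart s C A) = vertPart s C A := by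
  rw [vertPart, LinearMap.comp_apply, ← vertPart, skewPart_of_skew (hC.adj_vertPart A),
    hC.proj_vertPart]

/-- A group element in the image of `sliceMap` is the product of a point of the slice and an element
of `V`: the symmetric factor `1 + Z` satisfies `(1 + Z)² = 1`, so that it is `1` if `Z` is small. -/
theorem toMat_eq_of_sliceMap {A : Mat n} (h1 : transPart s C A ∈ cayDom n)
    (h2 : vertPart s C A ∈ cayDom n) (h3 : (2 + symPart s A).det ≠ 0) {g : grp n s}
    (h : sliceMap s C A = toMat g) :
    g = cayGrp hs (transPart s C A) * cayGrp hs (vertPart s C A) := by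
  apply toMat_injective
  rw [toMat_mul, toMat_cayGrp hs (hC.adj_transPart A) h1, toMat_cayGrp hs (hC.adj_vertPart A) h2,
    ← h, sliceMap]
  set k := cayGrp hs (transPart s C A) * cayGrp hs (vertPart s C A) with hk
  have hkm : cay (transPart s C A) * cay (vertPart s C A) = toMat k := by
    rw [hk, toMat_mul, toMat_cayGrp hs (hC.adj_transPart A) h1,
      toMat_cayGrp hs (hC.adj_vertPart A) h2]
  rw [sliceMap, hkm] at h
  have h4 : (1 + symPart s A) * (1 + symPart s A) = 1 := by
    have h5 := adj_toMat_mul hs g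
    rw [← h, adj_mul hs, Matrix.mul_assoc, ← Matrix.mul_assoc (adj s (toMat k)),
      adj_toMat_mul hs, Matrix.one_mul, map_add, adj_one hs, adj_symPart hs] at h5
    exact h5
  have h6 : (2 + symPart s A) * symPart s A = (2 + symPart s A) * 0 := by
    have : (2 + symPart s A) * symPart s A = (1 + symPart s A) * (1 + symPart s A) - 1 := by
      noncomm_ring
    rw [this, h4, Matrix.mul_zero, sub_self]
  have h7 := (Matrix.isUnit_iff_isUnit_det _ |>.2 (isUnit_iff_ne_zero.2 h3)).mul_left_cancel h6
  rw [h7, add_zero, Matrix.mul_one]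

end IsSliceProjection

/-- The tangent space of the slice. -/
def transSpace (s : ℝ) (C : Mat n →ₗ[ℝ] Mat n) : Submodule ℝ (Mat n) :=
  LinearMap.ker (LinearMap.id + adj s) ⊓ LinearMap.ker C

theorem mem_transSpace {C : Mat n →ₗ[ℝ] Mat n} {X : Mat n} :
    X ∈ transSpace s C ↔ adj s X = -X ∧ C X = 0 := by
  rw [transSpace, Submodule.mem_inf, LinearMap.mem_ker, LinearMap.mem_ker, LinearMap.add_apply,
    LinearMap.id_apply, add_eq_zero_iff_neg_eq, eq_comm]

/-- The inverse function theorem for `sliceMap` gives a slice, of the dimension of the complement of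
the Lie algebra of `V`. -/
theorem IsSliceProjection.nonempty_cosetSlice {hs : s * s = 1} {V : Subgroup (grp n s)}
    {C : Mat n →ₗ[ℝ] Mat n} (hC : IsSliceProjection hs V C) {d : ℕ}
    (hd : Module.finrank ℝ (transSpace s C) = d) : Nonempty (CosetSlice V d) := by
  let ℓ : Euc d ≃ₗ[ℝ] transSpace s C :=
    LinearEquiv.ofFinrankEq _ _ (by rw [hd, finrank_euclideanSpace_fin])
  let ι : Euc d →ₗ[ℝ] Mat n := (transSpace s C).subtype.comp ℓ.toLinearMap
  have hιsk : ∀ y, adj s (ι y) = -ι y := fun y => (mem_transSpace.1 (ℓ y).2).1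
  have hιC : ∀ y, C (ι y) = 0 := fun y => (mem_transSpace.1 (ℓ y).2).2
  let ρ : Mat n →ₗ[ℝ] Euc d := ℓ.symm.toLinearMap.comp
    ((transPart s C).codRestrict (transSpace s C)
      fun A => mem_transSpace.2 ⟨hC.adj_transPart A, hC.proj_transPart A⟩)
  have hιρ : ∀ A, ι (ρ A) = transPart s C A := fun A => by simp [ι, ρ]
  have htι : ∀ y, transPart s C (ι y) = ι y := fun y => by
    rw [transPart, LinearMap.comp_apply, skewPart_of_skew (hιsk y), LinearMap.sub_apply,
      LinearMap.id_apply, hιC, sub_zero]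
  have hvι : ∀ y, vertPart s C (ι y) = 0 := fun y => by
    rw [vertPart, LinearMap.comp_apply, skewPart_of_skew (hιsk y), hιC]
  have hιinj : Function.Injective ι := Subtype.val_injective.comp ℓ.injective
  have hρι : ∀ y, ρ (ι y) = y := fun y => hιinj (by rw [hιρ, htι])
  have hιc : Continuous ι := ι.continuous_of_finiteDimensional
  have hιsm : ContDiff ℝ ∞ ι := ι.toContinuousLinearMap.contDiff
  have hρsm : ContDiff ℝ ∞ ρ := ρ.toContinuousLinearMap.contDiff
  have hsl : ContDiffAt ℝ ω (sliceMap s C) 0 := contDiffAt_sliceMap C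
  let e := hsl.toOpenPartialHomeomorph _ (hasFDerivAt_sliceMap C) (by simp)
  have he : ∀ A, e A = sliceMap s C A := fun A => rfl
  have h0 : (0 : Mat n) ∈ e.source :=
    ContDiffAt.mem_toOpenPartialHomeomorph_source hsl (hasFDerivAt_sliceMap C) (by simp)
  have he0 : e 0 = 1 := sliceMap_zero C
  have h1t : (1 : Mat n) ∈ e.target := he0 ▸ e.map_source h0
  have hes1 : e.symm 1 = 0 := by rw [← he0, e.left_inv h0]
  have hsymm : ∀ᶠ a in 𝓝 (1 : Mat n), ContDiffAt ℝ ω e.symm a := by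
    have := hsl.to_localInverse (hasFDerivAt_sliceMap C) (by simp)
    rw [sliceMap_zero] at this
    exact this.eventually (by simp)
  have hcd : ∀ f : Mat n →ₗ[ℝ] Mat n, ∀ᶠ A in 𝓝 (0 : Mat n), f A ∈ cayDom n := fun f =>
    f.continuous_of_finiteDimensional.continuousAt
      (isOpen_cayDom.mem_nhds (by rw [map_zero]; exact zero_mem_cayDom))
  have hdet : ∀ᶠ A in 𝓝 (0 : Mat n), (2 + symPart s A).det ≠ 0 := by
    have hc : ContinuousAt (fun A : Mat n => (2 + symPart s A).det) 0 :=
      (contDiffAt_det (k := 0) (contDiffAt_mat_iff.1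
        (contDiffAt_const.add (contDiff_linear (symPart s)).contDiffAt))).continuousAt
    refine hc.eventually_ne ?_
    have : (2 : Mat n) = (2 : ℝ) • (1 : Mat n) := by rw [two_smul, one_add_one_eq_two]
    rw [map_zero, add_zero, this, Matrix.det_smul, Matrix.det_one, mul_one]
    positivity
  have hgood : ∀ᶠ A in 𝓝 (0 : Mat n), transPart s C A ∈ cayDom n ∧ vertPart s C A ∈ cayDom n ∧
      (2 + symPart s A).det ≠ 0 := (hcd _).and ((hcd _).and hdet)
  have hsc : Tendsto e.symm (𝓝 1) (𝓝 0) := by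
    have := (hsymm.self_of_nhds).continuousAt
    rwa [ContinuousAt, hes1] at this
  have htgt : ∀ᶠ a in 𝓝 (1 : Mat n), a ∈ e.target := e.open_target.mem_nhds h1t
  have hsrc : ∀ᶠ A in 𝓝 (0 : Mat n), A ∈ e.source := e.open_source.mem_nhds h0
  obtain ⟨T, hT, hTo, h1T⟩ := mem_nhds_iff.1 (htgt.and (hsymm.and (hsc.eventually hgood)))
  -- every group element in `T` is a point of the slice times an element of `V`
  have hdec : ∀ a : grp n s, toMat a ∈ T →
      a = cayGrp hs (transPart s C (e.symm (toMat a))) *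
        cayGrp hs (vertPart s C (e.symm (toMat a))) := fun a ha =>
    hC.toMat_eq_of_sliceMap (hT ha).2.2.1 (hT ha).2.2.2.1 (hT ha).2.2.2.2
      ((he _).symm.trans (e.right_inv (hT ha).1))
  have hι0 : Tendsto ι (𝓝 0) (𝓝 0) := by
    have := hιc.tendsto 0
    rwa [map_zero] at this
  have hιS : ∀ᶠ y in 𝓝 (0 : Euc d), ι y ∈ e.source ∧ ι y ∈ cayDom n :=
    hι0.eventually (hsrc.and (isOpen_cayDom.mem_nhds zero_mem_cayDom))
  have hcT : ∀ᶠ y in 𝓝 (0 : Euc d), cay (ι y) ∈ T := by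
    have hc := (contDiffAt_cay (n := n) zero_mem_cayDom (k := 1)).continuousAt
    rw [ContinuousAt, cay_zero] at hc
    exact (hc.comp hι0).eventually (hTo.mem_nhds h1T)
  obtain ⟨S, hS, hSo, h0S⟩ := mem_nhds_iff.1 (hιS.and hcT)
  have hc : ∀ y ∈ S, toMat (cayGrp hs (ι y)) = cay (ι y) := fun y hy =>
    toMat_cayGrp hs (hιsk y) (hS hy).1.2
  have heι : ∀ y, e (ι y) = cay (ι y) := fun y => by
    rw [he, sliceMap, htι, hvι, symPart_of_skew (hιsk y), cay_zero, add_zero, Matrix.mul_one,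
      Matrix.mul_one]
  have hcsm : ∀ y ∈ S, ContDiffAt ℝ ∞ (fun y => toMat (cayGrp hs (ι y))) y := fun y hy => by
    have h1 : ContDiffAt ℝ ∞ (fun y => cay (ι y)) y :=
      ContDiffAt.comp (g := cay) y (contDiffAt_cay (hS hy).1.2) hιsm.contDiffAt
    refine h1.congr_of_eventuallyEq ?_
    filter_upwards [hSo.mem_nhds hy] with z hz using hc z hz
  refine ⟨{
    c := fun y => cayGrp hs (ι y)
    S := S
    T := T
    r := fun a => ρ (e.symm a)
    isOpen_S := hSo
    zero_mem := h0S
    c_zero := by rw [map_zero, cayGrp_zero]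
    c_smooth := hcsm
    isOpen_T := hTo
    r_smooth := fun a ha => ContDiffAt.comp (g := ρ) a hρsm.contDiffAt ((hT ha).2.1.of_le le_top)
    c_mem := fun y hy => by rw [hc y hy]; exact (hS hy).2
    r_c := fun y hy => by
      rw [hc y hy, ← heι, e.left_inv (hS hy).1.1, hρι]
    decomp := fun a ha => ⟨_, hC.cay_mem _ (hC.adj_vertPart _) (hC.proj_vertPart _), by
      rw [hιρ]; exact hdec a ha⟩
    inj := ?_ }⟩
  -- if `c y * h = c y'` with `h ∈ V` then `h` is close to `1`, so that it is the Cayley transform of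
  -- a small vertical matrix, and `sliceMap` is injective
  have hcc : ContinuousAt (fun y => cayGrp hs (ι y)) 0 :=
    isInducing_toMat.continuousAt_iff.2 (hcsm 0 h0S).continuousAt
  let k : Euc d × Euc d → Mat n := fun p => toMat ((cayGrp hs (ι p.1))⁻¹ * cayGrp hs (ι p.2))
  have hk : Tendsto k (𝓝 0 ×ˢ 𝓝 0) (𝓝 1) := by
    rw [← nhds_prod_eq]
    have h1 : ContinuousAt (fun p : Euc d × Euc d => (cayGrp hs (ι p.1))⁻¹ * cayGrp hs (ι p.2))
        (0, 0) :=
      (ContinuousAt.comp (f := Prod.fst) (x := ((0 : Euc d), (0 : Euc d))) hcc continuousAt_fst).inv.mul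
        (ContinuousAt.comp (f := Prod.snd) (x := ((0 : Euc d), (0 : Euc d))) hcc continuousAt_snd)
    have h2 := ContinuousAt.comp (g := toMat) (x := ((0 : Euc d), (0 : Euc d)))
      continuous_toMat.continuousAt h1
    have h3 := h2.tendsto
    simpa only [Function.comp_def, map_zero, cayGrp_zero, inv_one, mul_one, toMat_one] using h3
  have hsum : Tendsto (fun p : Euc d × Euc d => ι p.1 + vertPart s C (e.symm (k p)))
      (𝓝 0 ×ˢ 𝓝 0) (𝓝 0) := by
    have h1 : Tendsto (vertPart s C) (𝓝 0) (𝓝 0) := by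
      have := (vertPart s C).continuous_of_finiteDimensional.tendsto (0 : Mat n)
      rwa [map_zero] at this
    have := (hι0.comp tendsto_fst).add (h1.comp (hsc.comp hk))
    rwa [add_zero] at this
  filter_upwards [hk.eventually (hTo.mem_nhds h1T), hsum.eventually (e.open_source.mem_nhds h0),
    prod_mem_prod (hSo.mem_nhds h0S) (hSo.mem_nhds h0S)] with p hp1 hp2 hp3 h hh hch
  have hkh : (cayGrp hs (ι p.1))⁻¹ * cayGrp hs (ι p.2) = h := by rw [← hch, inv_mul_cancel_left]
  have hkp : k p = toMat h := by simp only [k, hkh]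
  rw [hkp] at hp1 hp2
  have hd1 := hdec h hp1
  set A := e.symm (toMat h) with hA
  have hm : cayGrp hs (transPart s C A) ∈ V := by
    have : cayGrp hs (transPart s C A) = h * (cayGrp hs (vertPart s C A))⁻¹ := by
      rw [hd1, mul_inv_cancel_right]
    rw [this]
    exact mul_mem hh (inv_mem (hC.cay_mem _ (hC.adj_vertPart _) (hC.proj_vertPart _)))
  have hm0 : transPart s C A = 0 := by
    rw [← hC.fixed _ (hC.adj_transPart A) (hT hp1).2.2.1 hm, hC.proj_transPart]
  rw [hm0, cayGrp_zero, one_mul] at hd1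
  have hhc : toMat h = cay (vertPart s C A) := by
    rw [hd1, toMat_cayGrp hs (hC.adj_vertPart A) (hT hp1).2.2.2.1]
  have heq : e (ι p.1 + vertPart s C A) = e (ι p.2) := by
    rw [heι, he, sliceMap, map_add, map_add, map_add, htι, hvι, symPart_of_skew (hιsk _),
      hC.transPart_vertPart, hC.vertPart_vertPart, symPart_of_skew (hC.adj_vertPart A), add_zero,
      zero_add, add_zero, add_zero, Matrix.mul_one, ← hhc, ← hc _ hp3.1, ← toMat_mul, hch,
      hc _ hp3.2]
  have h8 := congrArg (transPart s C) (e.injOn hp2 (hS hp3.2).1.1 heq)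
  rw [map_add, htι, htι, hC.transPart_vertPart, add_zero] at h8
  exact hιinj h8

/-! ### The slices for `SO(2n)` and `U(n)` -/

/-- The projection of a matrix onto its upper left block. -/
noncomputable def projSO (n : ℕ) : Mat n →ₗ[ℝ] Mat n :=
  (LinearMap.mulLeft ℝ (1 - lastProj n)).comp (LinearMap.mulRight ℝ (1 - lastProj n))

theorem projSO_apply (A : Mat n) : projSO n A = (1 - lastProj n) * (A * (1 - lastProj n)) := rfl

/-- The projection of a matrix onto the part of its upper left block that commutes with the complex
structure. -/
noncomputable def projU (n : ℕ) : Mat n →ₗ[ℝ] Mat n :=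
  (1 / 2 : ℝ) • (projSO n -
    (LinearMap.mulLeft ℝ (Jhat n)).comp (LinearMap.mulRight ℝ (Jhat n)))

theorem projU_apply (A : Mat n) :
    projU n A = (1 / 2 : ℝ) • ((1 - lastProj n) * (A * (1 - lastProj n)) - Jhat n * (A * Jhat n)) :=
  rfl

theorem cay_mul_comm {X : Mat n} (hX : X ∈ cayDom n) :
    (1 - (1 / 2 : ℝ) • X) * cay X = 1 + (1 / 2 : ℝ) • X := by
  have hu := Matrix.isUnit_iff_isUnit_det _ |>.2 (isUnit_iff_ne_zero.2 hX)
  refine hu.mul_right_cancel ?_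
  rw [Matrix.mul_assoc, cay_mul hX]
  simp only [Matrix.mul_add, Matrix.add_mul, Matrix.mul_sub, Matrix.sub_mul, Matrix.one_mul,
    Matrix.mul_one]
  abel

theorem mul_lastProj_eq_zero_of_cayGrp_mem (hs : s * s = 1) {X : Mat n} (h : adj s X = -X)
    (hX : X ∈ cayDom n) (hV : cayGrp hs X ∈ subSO n s) : X * lastProj n = 0 := by
  have h1 := mul_lastProj_of_mem_subSO hV
  rw [toMat_cayGrp hs h hX] at h1
  have h2 := congrArg ((1 - (1 / 2 : ℝ) • X) * ·) h1
  simp only [← Matrix.mul_assoc, cay_mul_comm hX, Matrix.add_mul, Matrix.sub_mul, Matrix.one_mul,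
    Matrix.smul_mul] at h2
  have h3 : X * lastProj n = (lastProj n + (1 / 2 : ℝ) • (X * lastProj n)) -
      (lastProj n - (1 / 2 : ℝ) • (X * lastProj n)) := by module
  rw [h3, h2, sub_self]

theorem commute_Jhat_of_cayGrp_mem (hs : s * s = 1) {X : Mat n} (h : adj s X = -X)
    (hX : X ∈ cayDom n) (hV : cayGrp hs X ∈ subU n s) : X * Jhat n = Jhat n * X := by
  have h1 := mul_Jhat_of_mem_subU hV
  rw [toMat_cayGrp hs h hX] at h1
  -- `1 - X / 2` is twice the inverse of `1 + cay X`
  set N := 1 - (1 / 2 : ℝ) • X with hN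
  have h2 : (cay X + 1) * N = (2 : ℝ) • 1 := by
    rw [Matrix.add_mul, cay_mul hX, hN, Matrix.one_mul]; module
  have h3 : N * (cay X + 1) = (2 : ℝ) • 1 := by
    rw [Matrix.mul_add, cay_mul_comm hX, hN, Matrix.mul_one]; module
  have h4 : (cay X + 1) * Jhat n = Jhat n * (cay X + 1) := by
    rw [Matrix.add_mul, Matrix.mul_add, h1, Matrix.one_mul, Matrix.mul_one]
  have h5 : (2 : ℝ) • (Jhat n * N) = (2 : ℝ) • (N * Jhat n) := by
    calc (2 : ℝ) • (Jhat n * N) = N * (cay X + 1) * (Jhat n * N) := by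
          rw [h3, Matrix.smul_mul, Matrix.one_mul]
      _ = N * ((cay X + 1) * Jhat n) * N := by simp only [Matrix.mul_assoc]
      _ = N * Jhat n * ((cay X + 1) * N) := by rw [h4]; simp only [Matrix.mul_assoc]
      _ = (2 : ℝ) • (N * Jhat n) := by rw [h2, Matrix.mul_smul, Matrix.mul_one]
  have h6 := smul_right_injective _ (two_ne_zero' ℝ) h5
  simp only [hN, Matrix.mul_sub, Matrix.sub_mul, Matrix.mul_smul, Matrix.smul_mul, Matrix.mul_one,
    Matrix.one_mul] at h6
  have h7 : (1 / 2 : ℝ) • (Jhat n * X) = (1 / 2 : ℝ) • (X * Jhat n) := sub_right_injective h6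
  exact (smul_right_injective _ (by norm_num : (1 / 2 : ℝ) ≠ 0) h7).symm

theorem lastProj_mul_eq_zero (hs : s * s = 1) {X : Mat n} (h : adj s X = -X)
    (hX : X * lastProj n = 0) : lastProj n * X = 0 := by
  have := congrArg (adj s) hX
  rwa [adj_mul hs, adj_lastProj hs, h, Matrix.mul_neg, map_zero, neg_eq_zero] at this

theorem projSO_eq_self {X : Mat n} (h1 : X * lastProj n = 0) (h2 : lastProj n * X = 0) :
    projSO n X = X := by
  rw [projSO_apply, Matrix.mul_sub, h1, Matrix.mul_one, sub_zero, Matrix.sub_mul, h2,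
    Matrix.one_mul, sub_zero]

theorem compl_mul_self : (1 - lastProj n) * (1 - lastProj n) = 1 - lastProj n := by
  rw [Matrix.mul_sub, Matrix.mul_one, Matrix.sub_mul, Matrix.one_mul, lastProj_mul_self, sub_self,
    sub_zero]

theorem Jhat_mul_compl : Jhat n * (1 - lastProj n) = Jhat n := by
  rw [Matrix.mul_sub, Jhat_mul_lastProj, Matrix.mul_one, sub_zero]

theorem compl_mul_Jhat : (1 - lastProj n) * Jhat n = Jhat n := by
  rw [Matrix.sub_mul, lastProj_mul_Jhat, Matrix.one_mul, sub_zero]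

theorem Jhat_sq : Jhat n * Jhat n = -(1 - lastProj n) := by rw [Jhat_mul_Jhat, neg_sub]

theorem isSliceProjection_projSO (hs : s * s = 1) :
    IsSliceProjection hs (subSO n s) (projSO n) where
  idem A := by
    have h : ∀ Q : Mat n, Q * Q = Q → Q * (Q * (A * Q) * Q) = Q * (A * Q) := fun Q hQ => by
      rw [Matrix.mul_assoc, Matrix.mul_assoc, hQ, ← Matrix.mul_assoc, hQ]
    exact h _ compl_mul_self
  adj_comm A := by
    have h : adj s (1 - lastProj n) = 1 - lastProj n := by
      rw [map_sub, adj_one hs, adj_lastProj hs]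
    rw [projSO_apply, projSO_apply, adj_mul hs, adj_mul hs, h, Matrix.mul_assoc]
  cay_mem X _ hX := by
    refine cayGrp_mem_subSO hs ?_
    have h : (1 - lastProj n) * lastProj n = 0 := by
      rw [Matrix.sub_mul, lastProj_mul_self, Matrix.one_mul, sub_self]
    rw [← hX, projSO_apply, Matrix.mul_assoc, Matrix.mul_assoc, h, Matrix.mul_zero, Matrix.mul_zero]
  fixed X h hX hV := by
    have h1 := mul_lastProj_eq_zero_of_cayGrp_mem hs h hX hV
    exact projSO_eq_self h1 (lastProj_mul_eq_zero hs h h1)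

theorem projU_mul_Jhat (A : Mat n) : projU n A * Jhat n = Jhat n * projU n A := by
  have key : ∀ Q J : Mat n, Q * J = J → J * Q = J → J * J = -Q →
      (Q * (A * Q) - J * (A * J)) * J = J * (Q * (A * Q) - J * (A * J)) := by
    intro Q J h1 h2 h3
    have a1 : Q * (A * Q) * J = Q * (A * J) := by rw [Matrix.mul_assoc, Matrix.mul_assoc, h1]
    have a2 : J * (A * J) * J = -(J * (A * Q)) := by
      rw [Matrix.mul_assoc, Matrix.mul_assoc, h3, Matrix.mul_neg, Matrix.mul_neg]
    have a3 : J * (Q * (A * Q)) = J * (A * Q) := by rw [← Matrix.mul_assoc, h2]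
    have a4 : J * (J * (A * J)) = -(Q * (A * J)) := by rw [← Matrix.mul_assoc, h3, Matrix.neg_mul]
    rw [Matrix.sub_mul, Matrix.mul_sub, a1, a2, a3, a4]
    abel
  rw [projU_apply, Matrix.smul_mul, Matrix.mul_smul, key _ _ compl_mul_Jhat Jhat_mul_compl Jhat_sq]

theorem projU_eq_self {X : Mat n} (h1 : projSO n X = X) (h2 : X * Jhat n = Jhat n * X) :
    projU n X = X := by
  have h3 : Jhat n * (X * Jhat n) = -X := by
    rw [h2, ← Matrix.mul_assoc, Jhat_sq, Matrix.neg_mul, ← h1, projSO_apply, ← Matrix.mul_assoc,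
      compl_mul_self]
  rw [projU_apply, h3, ← projSO_apply, h1]
  module

theorem projSO_projU (A : Mat n) : projSO n (projU n A) = projU n A := by
  rw [projU_apply, map_smul, map_sub]
  congr 1
  simp only [projSO_apply, Matrix.mul_assoc, Jhat_mul_compl, compl_mul_self]
  simp only [← Matrix.mul_assoc, compl_mul_Jhat, compl_mul_self]

theorem isSliceProjection_projU (hs : s * s = 1) :
    IsSliceProjection hs (subU n s) (projU n) where
  idem A := projU_eq_self (projSO_projU A) (projU_mul_Jhat A)
  adj_comm A := by
    have h := (isSliceProjection_projSO hs).adj_comm A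
    rw [projSO_apply, projSO_apply] at h
    rw [projU_apply, projU_apply, map_smul, map_sub, h, adj_mul hs, adj_mul hs, adj_Jhat hs,
      Matrix.neg_mul, Matrix.mul_neg, Matrix.neg_mul, neg_neg, Matrix.mul_assoc]
  cay_mem X _ hX := cayGrp_mem_subU hs (by rw [← hX]; exact projU_mul_Jhat X)
  fixed X h hX hV := by
    have h1 := mul_lastProj_eq_zero_of_cayGrp_mem hs h hX (subU_le_subSO hV)
    exact projU_eq_self (projSO_eq_self h1 (lastProj_mul_eq_zero hs h h1))
      (commute_Jhat_of_cayGrp_mem hs h hX hV)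

/-! ### The dimensions of the slices -/

theorem projSO_fromBlocks (A : Matrix (Idx n) (Idx n) ℝ) (B : Matrix (Idx n) Unit ℝ)
    (C : Matrix Unit (Idx n) ℝ) (D : Matrix Unit Unit ℝ) :
    projSO n (Matrix.fromBlocks A B C D) = Matrix.fromBlocks A 0 0 0 := by
  have h : 1 - lastProj n = Matrix.fromBlocks 1 0 0 0 := by
    rw [lastProj, ← Matrix.fromBlocks_one, sub_eq_add_neg, Matrix.fromBlocks_neg,
      Matrix.fromBlocks_add]
    simp
  rw [projSO_apply, h]
  simp [Matrix.fromBlocks_multiply]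

theorem projU_fromBlocks (A : Matrix (Idx n) (Idx n) ℝ) (B : Matrix (Idx n) Unit ℝ)
    (C : Matrix Unit (Idx n) ℝ) (D : Matrix Unit Unit ℝ) :
    projU n (Matrix.fromBlocks A B C D) =
      Matrix.fromBlocks ((1 / 2 : ℝ) • (A - matJ n * A * matJ n)) 0 0 0 := by
  rw [projU_apply, ← projSO_apply, projSO_fromBlocks, Jhat, Matrix.fromBlocks_multiply,
    Matrix.fromBlocks_multiply, sub_eq_add_neg, Matrix.fromBlocks_neg, Matrix.fromBlocks_add,
    Matrix.fromBlocks_smul]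
  simp [Matrix.mul_assoc, sub_eq_add_neg]

theorem skew_fromBlocks_iff (hs : s * s = 1) {A : Matrix (Idx n) (Idx n) ℝ}
    {B : Matrix (Idx n) Unit ℝ} {C : Matrix Unit (Idx n) ℝ} {D : Matrix Unit Unit ℝ} :
    adj s (Matrix.fromBlocks A B C D) = -Matrix.fromBlocks A B C D ↔
      Aᵀ = -A ∧ C = -(s • Bᵀ) ∧ D = 0 := by
  rw [adj_fromBlocks _ _ _ _ hs, Matrix.fromBlocks_neg, Matrix.fromBlocks_inj]
  have hD : Dᵀ = -D ↔ D = 0 := by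
    constructor
    · intro h
      ext i j
      have := congrFun (congrFun h i) j
      rw [Matrix.transpose_apply, Matrix.neg_apply, Subsingleton.elim j i] at this
      rw [Matrix.zero_apply, Subsingleton.elim j i]
      linarith
    · rintro rfl; simp
  have h1 : s • Bᵀ = -C ↔ C = -(s • Bᵀ) := by
    rw [eq_neg_iff_add_eq_zero, eq_neg_iff_add_eq_zero, add_comm]
  have h2 : s • Cᵀ = -B ↔ C = -(s • Bᵀ) := by
    constructor
    · intro h
      have := congrArg (fun M => s • Mᵀ) h
      simp only [Matrix.transpose_smul, Matrix.transpose_transpose, smul_smul, hs, one_smul,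
        Matrix.transpose_neg, smul_neg] at this
      exact this
    · rintro rfl
      simp [smul_smul, hs]
  rw [h1, h2, hD]
  tauto

theorem finrank_transSpace_projSO (hs : s * s = 1) :
    Module.finrank ℝ (transSpace s (projSO n)) = 2 * n := by
  let f : transSpace s (projSO n) →ₗ[ℝ] Matrix (Idx n) Unit ℝ :=
    { toFun := fun X => (X : Mat n).toBlocks₁₂
      map_add' := fun _ _ => rfl
      map_smul' := fun _ _ => rfl }
  have hf : Function.Bijective f := by
    constructor
    · refine (injective_iff_map_eq_zero f).2 fun ⟨X, hX⟩ h => Subtype.ext ?_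
      obtain ⟨A, B, C, D, rfl⟩ : ∃ A B C D, X = Matrix.fromBlocks A B C D :=
        ⟨_, _, _, _, (Matrix.fromBlocks_toBlocks X).symm⟩
      obtain ⟨h1, h2⟩ := mem_transSpace.1 hX
      obtain ⟨-, rfl, rfl⟩ := (skew_fromBlocks_iff hs).1 h1
      rw [projSO_fromBlocks, ← Matrix.fromBlocks_zero, Matrix.fromBlocks_inj] at h2
      have hB : B = 0 := h
      simp [hB, h2.1]
    · intro B
      refine ⟨⟨Matrix.fromBlocks 0 B (-(s • Bᵀ)) 0, mem_transSpace.2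
        ⟨(skew_fromBlocks_iff hs).2 ⟨by simp, rfl, rfl⟩, by rw [projSO_fromBlocks]; simp⟩⟩, rfl⟩
  rw [(LinearEquiv.ofBijective f hf).finrank_eq, Module.finrank_matrix]
  simp

theorem matJ_mul_mul_matJ (A : Matrix (Idx n) (Idx n) ℝ) (k l : Fin n) :
    (matJ n * A * matJ n) (0, k) (0, l) = -A (1, k) (1, l) ∧
    (matJ n * A * matJ n) (0, k) (1, l) = A (1, k) (0, l) ∧
    (matJ n * A * matJ n) (1, k) (0, l) = A (0, k) (1, l) ∧
    (matJ n * A * matJ n) (1, k) (1, l) = -A (0, k) (0, l) := by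
  refine ⟨?_, ?_, ?_, ?_⟩ <;>
  simp [Matrix.mul_apply, Fintype.sum_prod_type, Fin.sum_univ_two, matJ,
    Matrix.blockDiagonal_apply, Finset.sum_ite_eq]

/-- A skew matrix that anticommutes with the complex structure consists of two skew blocks, each of
which occurs twice. -/
theorem skew_anticommuting_blocks {A : Matrix (Idx n) (Idx n) ℝ} (hA : Aᵀ = -A)
    (hJ : A = matJ n * A * matJ n) (k l : Fin n) :
    A (1, k) (1, l) = -A (0, k) (0, l) ∧ A (1, k) (0, l) = A (0, k) (1, l) ∧
      A (0, l) (0, k) = -A (0, k) (0, l) ∧ A (0, l) (1, k) = -A (0, k) (1, l) := by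
  obtain ⟨-, -, h3, h4⟩ := matJ_mul_mul_matJ A k l
  rw [← hJ] at h3 h4
  have h5 : ∀ i j, A j i = -A i j := fun i j => congrFun (congrFun hA i) j
  exact ⟨h4, h3, h5 _ _, by rw [h5 (1, k) (0, l), h3]⟩

/-- The skew matrix that anticommutes with the complex structure and whose independent entries are
`f`: the entries with `k < l` fill the diagonal blocks, and those with `l < k` the others. -/
noncomputable def antiMat (f : Fin n → Fin n → ℝ) : Matrix (Idx n) (Idx n) ℝ :=
  Matrix.of fun i j =>
    if i.1 = j.1 then
      (if i.1 = 0 then 1 else -1) *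
        (if i.2 < j.2 then f i.2 j.2 else if j.2 < i.2 then -f j.2 i.2 else 0)
    else if j.2 < i.2 then f i.2 j.2 else if i.2 < j.2 then -f j.2 i.2 else 0

theorem antiMat_transpose (f : Fin n → Fin n → ℝ) : (antiMat f)ᵀ = -antiMat f := by
  ext ⟨a, k⟩ ⟨b, l⟩
  simp only [antiMat, Matrix.transpose_apply, Matrix.of_apply, Matrix.neg_apply]
  rcases lt_trichotomy k l with h | rfl | h
  · fin_cases a <;> fin_cases b <;> simp [h, h.not_gt]
  · fin_cases a <;> fin_cases b <;> simp
  · fin_cases a <;> fin_cases b <;> simp [h, h.not_gt]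

theorem antiMat_anticommute (f : Fin n → Fin n → ℝ) :
    antiMat f = matJ n * antiMat f * matJ n := by
  ext ⟨a, k⟩ ⟨b, l⟩
  obtain ⟨h1, h2, h3, h4⟩ := matJ_mul_mul_matJ (antiMat f) k l
  fin_cases a <;> fin_cases b
  · exact Eq.trans (by simp only [antiMat]; simp; split_ifs <;> simp) h1.symm
  · exact Eq.trans (by simp [antiMat]) h2.symm
  · exact Eq.trans (by simp [antiMat]) h3.symm
  · exact Eq.trans (by simp only [antiMat]; simp; split_ifs <;> simp) h4.symm

/-- The dimension `2n + n(n - 1)`: the last column, and the skew matrices of size `2n` that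
anticommute with the complex structure. -/
theorem finrank_transSpace_projU (hs : s * s = 1) :
    Module.finrank ℝ (transSpace s (projU n)) = n * (n + 1) := by
  let f : transSpace s (projU n) →ₗ[ℝ]
      Matrix (Idx n) Unit ℝ × ({p : Fin n × Fin n // p.1 ≠ p.2} → ℝ) :=
    { toFun := fun X => ((X : Mat n).toBlocks₁₂, fun p => if p.1.1 < p.1.2 then
        (X : Mat n).toBlocks₁₁ (0, p.1.1) (0, p.1.2) else
        (X : Mat n).toBlocks₁₁ (0, p.1.1) (1, p.1.2))
      map_add' := fun X Y => by
        refine Prod.ext rfl (funext fun p => ?_)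
        by_cases h : p.1.1 < p.1.2 <;> simp [h, Matrix.toBlocks₁₁]
      map_smul' := fun c X => by
        refine Prod.ext rfl (funext fun p => ?_)
        by_cases h : p.1.1 < p.1.2 <;> simp [h, Matrix.toBlocks₁₁] }
  have hf : Function.Bijective f := by
    constructor
    · refine (injective_iff_map_eq_zero f).2 fun ⟨X, hX⟩ h => Subtype.ext ?_
      obtain ⟨A, B, C, D, rfl⟩ : ∃ A B C D, X = Matrix.fromBlocks A B C D :=
        ⟨_, _, _, _, (Matrix.fromBlocks_toBlocks X).symm⟩
      obtain ⟨h1, h2⟩ := mem_transSpace.1 hX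
      obtain ⟨hA, rfl, rfl⟩ := (skew_fromBlocks_iff hs).1 h1
      rw [projU_fromBlocks, ← Matrix.fromBlocks_zero, Matrix.fromBlocks_inj] at h2
      have hJ : A = matJ n * A * matJ n :=
        sub_eq_zero.1 ((smul_eq_zero_iff_right (by norm_num)).1 h2.1)
      have hB : B = 0 := congrArg Prod.fst h
      have hp : ∀ k l : Fin n, k ≠ l →
          (if k < l then A (0, k) (0, l) else A (0, k) (1, l)) = 0 := fun k l hkl =>
        congrFun (congrArg Prod.snd h) ⟨(k, l), hkl⟩
      have h00 : ∀ k l, A (0, k) (0, l) = 0 := fun k l => by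
        have e := (skew_anticommuting_blocks hA hJ k l).2.2.1
        rcases lt_trichotomy k l with h | rfl | h
        · simpa [h] using hp k l h.ne
        · linarith
        · have := hp l k h.ne
          rw [if_pos h] at this
          linarith
      have h01 : ∀ k l, A (0, k) (1, l) = 0 := fun k l => by
        have e := (skew_anticommuting_blocks hA hJ k l).2.2.2
        rcases lt_trichotomy k l with h | rfl | h
        · have := hp l k h.ne'
          rw [if_neg h.not_gt] at this
          linarith
        · linarith
        · simpa [h.not_gt] using hp k l h.ne'
      have hA0 : A = 0 := by
        ext ⟨a, k⟩ ⟨b, l⟩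
        obtain ⟨e1, e2, -, -⟩ := skew_anticommuting_blocks hA hJ k l
        fin_cases a <;> fin_cases b
        · exact h00 k l
        · exact h01 k l
        · exact e2.trans (h01 k l)
        · exact e1.trans (by rw [h00 k l, neg_zero]; rfl)
      simp [hB, hA0]
    · rintro ⟨B, g⟩
      let g' : Fin n → Fin n → ℝ := fun k l => if h : k ≠ l then g ⟨(k, l), h⟩ else 0
      refine ⟨⟨Matrix.fromBlocks (antiMat g') B (-(s • Bᵀ)) 0, mem_transSpace.2
        ⟨(skew_fromBlocks_iff hs).2 ⟨antiMat_transpose g', rfl, rfl⟩, ?_⟩⟩, ?_⟩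
      · rw [projU_fromBlocks, ← antiMat_anticommute, sub_self, smul_zero, Matrix.fromBlocks_zero]
      · refine Prod.ext rfl (funext fun ⟨⟨k, l⟩, hkl⟩ => ?_)
        change (if k < l then antiMat g' (0, k) (0, l) else antiMat g' (0, k) (1, l)) = _
        have hg : g' k l = g ⟨(k, l), hkl⟩ := dif_pos hkl
        rcases lt_or_gt_of_ne hkl with h | h
        · simp [antiMat, h, hg]
        · simp [antiMat, h, h.not_gt, hg]
  have hcard : Fintype.card {p : Fin n × Fin n // p.1 ≠ p.2} = n * n - n := by
    rw [Fintype.card_subtype]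
    have : (Finset.univ.filter fun p : Fin n × Fin n => p.1 ≠ p.2) = Finset.univ.offDiag := by
      ext; simp
    rw [this, Finset.offDiag_card]
    simp
  rw [(LinearEquiv.ofBijective f hf).finrank_eq, Module.finrank_prod, Module.finrank_matrix,
    Module.finrank_fintype_fun_eq_card, hcard]
  have : n ≤ n * n := Nat.le_mul_self n
  simp only [Fintype.card_prod, Fintype.card_fin, Fintype.card_unit, Module.finrank_self]
  rw [mul_add]
  omega

theorem nonempty_cosetSlice_subSO (hs : s * s = 1) : Nonempty (CosetSlice (subSO n s) (2 * n)) :=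
  (isSliceProjection_projSO hs).nonempty_cosetSlice (finrank_transSpace_projSO hs)

theorem nonempty_cosetSlice_subU (hs : s * s = 1) :
    Nonempty (CosetSlice (subU n s) (n * (n + 1))) :=
  (isSliceProjection_projU hs).nonempty_cosetSlice (finrank_transSpace_projU hs)

/-! ### Rotations from pairs of reflections -/

section Reflection

variable {ι : Type*} [Fintype ι] [DecidableEq ι]

/-- The reflection in the hyperplane orthogonal to `w`. -/
noncomputable def reflMat (w : ι → ℝ) : Matrix ι ι ℝ := 1 - (2 / (w ⬝ᵥ w)) • Matrix.vecMulVec w w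

theorem reflMat_transpose (w : ι → ℝ) : (reflMat w)ᵀ = reflMat w := by
  rw [reflMat, Matrix.transpose_sub, Matrix.transpose_smul, Matrix.transpose_vecMulVec,
    Matrix.transpose_one]

theorem reflMat_mulVec (w x : ι → ℝ) :
    reflMat w *ᵥ x = x - (2 * (w ⬝ᵥ x) / (w ⬝ᵥ w)) • w := by
  rw [reflMat, Matrix.sub_mulVec, Matrix.one_mulVec, Matrix.smul_mulVec, Matrix.vecMulVec_mulVec]
  ext i
  simp
  ring

theorem reflMat_mul_self {w : ι → ℝ} (hw : w ⬝ᵥ w ≠ 0) : reflMat w * reflMat w = 1 := by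
  have h : Matrix.vecMulVec w w * Matrix.vecMulVec w w = (w ⬝ᵥ w) • Matrix.vecMulVec w w := by
    rw [Matrix.vecMulVec_mul_vecMulVec]
    ext i j
    simp [Matrix.vecMulVec_apply]
    ring
  rw [reflMat, Matrix.sub_mul, Matrix.mul_sub, Matrix.mul_sub, Matrix.one_mul, Matrix.mul_one,
    Matrix.one_mul, Matrix.smul_mul, Matrix.mul_smul, h, smul_smul, smul_smul]
  have e : 2 / (w ⬝ᵥ w) * (2 / (w ⬝ᵥ w)) * (w ⬝ᵥ w) = 2 * (2 / (w ⬝ᵥ w)) := by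
    field_simp
  rw [e]
  module

theorem det_reflMat {w : ι → ℝ} (hw : w ⬝ᵥ w ≠ 0) : (reflMat w).det = -1 := by
  have h : reflMat w = 1 + Matrix.replicateCol Unit ((-(2 / (w ⬝ᵥ w))) • w) *
      Matrix.replicateRow Unit w := by
    rw [reflMat, ← Matrix.vecMulVec_eq, sub_eq_add_neg, Matrix.smul_vecMulVec, neg_smul]
  rw [h, Matrix.det_one_add_replicateCol_mul_replicateRow, dotProduct_smul, smul_eq_mul]
  field_simp
  norm_num

/-- For distinct and not opposite unit vectors, the rotation that takes `x` to `y` in the plane of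
`x` and `y` and fixes the orthogonal complement of that plane. -/
noncomputable def rotMat (x y : ι → ℝ) : Matrix ι ι ℝ := reflMat (y + x) * reflMat x

theorem rotMat_self {x : ι → ℝ} (hx : x ⬝ᵥ x = 1) : rotMat x x = 1 := by
  have h : reflMat (x + x) = reflMat x := by
    have e : (x + x) ⬝ᵥ (x + x) = 4 := by simp [hx]; norm_num
    rw [reflMat, reflMat, hx, e]
    ext i j
    simp [Matrix.vecMulVec_apply]
    ring
  rw [rotMat, h, reflMat_mul_self (by rw [hx]; exact one_ne_zero)]

theorem rotMat_mulVec {x y : ι → ℝ} (hx : x ⬝ᵥ x = 1) (hy : y ⬝ᵥ y = 1)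
    (h : (y + x) ⬝ᵥ (y + x) ≠ 0) : rotMat x y *ᵥ x = y := by
  have h1 : reflMat x *ᵥ x = -x := by
    rw [reflMat_mulVec, hx]
    ext i
    simp
    ring
  have h2 : (y + x) ⬝ᵥ (y + x) = 2 * ((y + x) ⬝ᵥ x) := by
    simp [hx, hy, dotProduct_comm x y]
    ring
  rw [rotMat, ← Matrix.mulVec_mulVec, h1, Matrix.mulVec_neg, reflMat_mulVec, ← h2, div_self h]
  simp

theorem rotMat_transpose_mul {x y : ι → ℝ} (hx : x ⬝ᵥ x = 1) (h : (y + x) ⬝ᵥ (y + x) ≠ 0) :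
    (rotMat x y)ᵀ * rotMat x y = 1 := by
  rw [rotMat, Matrix.transpose_mul, reflMat_transpose, reflMat_transpose, Matrix.mul_assoc,
    ← Matrix.mul_assoc (reflMat (y + x)), reflMat_mul_self h, Matrix.one_mul,
    reflMat_mul_self (by rw [hx]; exact one_ne_zero)]

theorem det_rotMat {x y : ι → ℝ} (hx : x ⬝ᵥ x = 1) (h : (y + x) ⬝ᵥ (y + x) ≠ 0) :
    (rotMat x y).det = 1 := by
  rw [rotMat, Matrix.det_mul, det_reflMat h, det_reflMat (by rw [hx]; exact one_ne_zero)]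
  norm_num

end Reflection

theorem gram_one : gram n 1 = 1 := by rw [gram_eq_fromBlocks, one_smul, Matrix.fromBlocks_one]

theorem exists_grp_rotMat {x y : Idx n ⊕ Unit → ℝ} (hx : x ⬝ᵥ x = 1)
    (h : (y + x) ⬝ᵥ (y + x) ≠ 0) : ∃ g : grp n 1, toMat g = rotMat x y :=
  ⟨mkGrp (one_mul 1) (rotMat x y)
    (by rw [adj_apply, gram_one, Matrix.one_mul, Matrix.mul_one, rotMat_transpose_mul hx h])
    (det_rotMat hx h), toMat_mkGrp _ _ _ _⟩

/-! ### The sphere as a quotient of the rotation group -/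

/-- The last vector of the standard basis. -/
def lastVec (n : ℕ) : Idx n ⊕ Unit → ℝ := Pi.single (Sum.inr ()) 1

theorem ofLp_toSphere (g : grp n 1) : (toSphere n g).1.ofLp = toMat g *ᵥ lastVec n := by
  rw [lastVec, Matrix.mulVec_single_one]; rfl

theorem dotProduct_self_of_mem_sphere (x : Sph n) : x.1.ofLp ⬝ᵥ x.1.ofLp = 1 := by
  have h : ‖x.1‖ = 1 := by simp
  rw [EuclideanSpace.norm_eq, Real.sqrt_eq_one] at h
  refine Eq.trans (Finset.sum_congr rfl fun i _ => ?_) h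
  rw [Real.norm_eq_abs, sq_abs, sq]

theorem toSphere_eq_iff {g : grp n 1} {x : Sph n} :
    toSphere n g = x ↔ toMat g *ᵥ lastVec n = x.1.ofLp := by
  rw [← ofLp_toSphere, Subtype.ext_iff]
  exact (WithLp.ofLp_injective 2).eq_iff.symm

theorem toSphere_mul_eq {g k : grp n 1} {x : Sph n}
    (h : toMat k *ᵥ (toSphere n g).1.ofLp = x.1.ofLp) : toSphere n (k * g) = x := by
  rw [toSphere_eq_iff, toMat_mul, ← Matrix.mulVec_mulVec, ← ofLp_toSphere, h]

theorem lastProj_eq_vecMulVec : lastProj n = Matrix.vecMulVec (lastVec n) (lastVec n) := by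
  ext i j
  rcases i with i | i <;> rcases j with j | j <;>
    simp [lastProj, lastVec, Matrix.vecMulVec_apply]

theorem toSphere_eq_toSphere_iff {g g' : grp n 1} :
    toSphere n g = toSphere n g' ↔ toMat g * lastProj n = toMat g' * lastProj n := by
  rw [toSphere_eq_iff, ofLp_toSphere, lastProj_eq_vecMulVec, Matrix.mul_vecMulVec,
    Matrix.mul_vecMulVec]
  refine ⟨fun h => by rw [h], fun h => ?_⟩
  ext i
  have := congrFun (congrFun h i) (Sum.inr ())
  simpa only [Matrix.vecMulVec_apply, lastVec, Pi.single_eq_same, mul_one] using this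

theorem exists_toSphere_mul {g : grp n 1} {x : Sph n}
    (h : (x.1.ofLp + (toSphere n g).1.ofLp) ⬝ᵥ (x.1.ofLp + (toSphere n g).1.ofLp) ≠ 0) :
    ∃ k : grp n 1, toMat k = rotMat (toSphere n g).1.ofLp x.1.ofLp ∧ toSphere n (k * g) = x := by
  obtain ⟨k, hk⟩ := exists_grp_rotMat (dotProduct_self_of_mem_sphere (toSphere n g)) h
  exact ⟨k, hk, toSphere_mul_eq (by rw [hk, rotMat_mulVec (dotProduct_self_of_mem_sphere _)
    (dotProduct_self_of_mem_sphere _) h])⟩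

/-- The hypothesis `1 ≤ n` gives a second point of the orbit, so that some rotation reaches the point
opposite to the last basis vector. -/
theorem toSphere_surjective (hn : 1 ≤ n) : Function.Surjective (toSphere n) := by
  intro x
  have hne : ∀ v : Idx n ⊕ Unit → ℝ, ∀ i, v i ≠ 0 → v ⬝ᵥ v ≠ 0 := fun v i hi h =>
    hi (congrFun (dotProduct_self_eq_zero.1 h) i)
  let i₀ : Idx n := (0, ⟨0, hn⟩)
  -- a point of the orbit that is not opposite to `x`
  obtain ⟨g, hg⟩ : ∃ g : grp n 1,
      (x.1.ofLp + (toSphere n g).1.ofLp) ⬝ᵥ (x.1.ofLp + (toSphere n g).1.ofLp) ≠ 0 := by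
    by_cases hx : x.1.ofLp + lastVec n = 0
    · let u : Sph n := ⟨EuclideanSpace.single (Sum.inl i₀) 1, by simp⟩
      obtain ⟨k, -, hk⟩ := exists_toSphere_mul (g := 1) (x := u) (hne _ (Sum.inl i₀) (by
        rw [ofLp_toSphere, toMat_one, Matrix.one_mulVec]
        simp [u, lastVec]))
      refine ⟨k * 1, hne _ (Sum.inl i₀) ?_⟩
      rw [hk, eq_neg_of_add_eq_zero_left hx]
      simp [u, lastVec]
    · refine ⟨1, fun h => hx ?_⟩
      rw [ofLp_toSphere, toMat_one, Matrix.one_mulVec] at h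
      exact dotProduct_self_eq_zero.1 h
  obtain ⟨k, -, hk⟩ := exists_toSphere_mul hg
  exact ⟨_, hk⟩

theorem contDiffAt_reflMat {E : Type*} [NormedAddCommGroup E] [NormedSpace ℝ E]
    {f : E → Idx n ⊕ Unit → ℝ} {x : E} (hf : ContDiffAt ℝ ∞ f x) (hx : f x ⬝ᵥ f x ≠ 0) :
    ContDiffAt ℝ ∞ (fun y => (reflMat (f y) : Mat n)) x := by
  have h := contDiffAt_pi.1 hf
  have hd : ContDiffAt ℝ ∞ (fun y => f y ⬝ᵥ f y) x :=
    ContDiffAt.sum fun i _ => (h i).mul (h i)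
  refine contDiffAt_mat_iff.2 fun i j => ?_
  exact contDiffAt_const.sub ((contDiffAt_const.div hd hx).mul ((h i).mul (h j)))

/-- A local section through `g`, on the complement of the point opposite to the image of `g`: the
rotations that take the image of `g` to a given point. -/
theorem exists_isLocalSection_toSphere (g : grp n 1) :
    ∃ W σ, IsLocalSection (d := 2 * n) (toSphere n) W σ ∧ toSphere n g ∈ W ∧
      σ (toSphere n g) = toMat g := by
  set x₀ := (toSphere n g).1.ofLp with hx₀'
  have hx₀ : x₀ ⬝ᵥ x₀ = 1 := dotProduct_self_of_mem_sphere _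
  let w : EuclideanSpace ℝ (Idx n ⊕ Unit) → Idx n ⊕ Unit → ℝ := fun y => y.ofLp + x₀
  have hw : ContDiff ℝ ∞ w := by
    refine contDiff_pi.2 fun i => ?_
    exact (EuclideanSpace.proj (𝕜 := ℝ) i).contDiff.add contDiff_const
  have hw0 : IsOpen {y | w y ⬝ᵥ w y ≠ 0} := by
    have : Continuous fun y => w y ⬝ᵥ w y := hw.continuous.dotProduct hw.continuous
    exact isOpen_ne.preimage this
  refine ⟨{x | w x.1 ⬝ᵥ w x.1 ≠ 0}, fun x => rotMat x₀ x.1.ofLp * toMat g,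
    ⟨hw0.preimage continuous_subtype_val, fun i j x hx => ?_, fun x hx => ?_⟩, ?_, ?_⟩
  · have h1 : ContDiffAt ℝ ∞ (fun y : EuclideanSpace ℝ (Idx n ⊕ Unit) =>
        rotMat x₀ y.ofLp * toMat g) x.1 :=
      contDiffAt_matMul (contDiffAt_matMul (contDiffAt_reflMat hw.contDiffAt hx) contDiffAt_const)
        contDiffAt_const
    have h2 := contDiffAt_mat_iff.1 h1 i j
    exact (h2.contMDiffAt.comp x contMDiff_coe_sphere.contMDiffAt).contMDiffWithinAt
  · obtain ⟨k, hk, hkx⟩ := exists_toSphere_mul (g := g) hx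
    exact ⟨k * g, by rw [toMat_mul, hk], hkx⟩
  · have h1 : (x₀ + x₀) ⬝ᵥ (x₀ + x₀) = 4 := by
      rw [add_dotProduct, dotProduct_add, hx₀]; norm_num
    change (x₀ + x₀) ⬝ᵥ (x₀ + x₀) ≠ 0
    rw [h1]; norm_num
  · change rotMat x₀ x₀ * toMat g = toMat g
    rw [rotMat_self hx₀, Matrix.one_mul]

/-- The sphere, with its stereographic charts, is the quotient of the rotation group by `SO(2n)`. -/
theorem isSmoothQuotient_toSphere (hn : 1 ≤ n) :
    IsSmoothQuotient (d := 2 * n) ⊥ (subSO n 1) (toSphere n) := by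
  have hM : IsManifold 𝓘(ℝ, Euc (2 * n)) ω (Sph n) := EuclideanSpace.instIsManifoldSphere
  have hM' : IsManifold 𝓘(ℝ, Euc (2 * n)) ∞ (Sph n) := IsManifold.of_le le_top
  refine ⟨hM', toSphere_surjective hn, fun g g' => ?_, fun g => ?_, exists_isLocalSection_toSphere⟩
  · rw [toSphere_eq_toSphere_iff]
    constructor
    · intro h
      refine ⟨1, one_mem _, g⁻¹ * g', mem_subSO_of_fix (one_mul 1) _ ?_, by group⟩
      rw [toMat_mul, Matrix.mul_assoc, ← h, ← Matrix.mul_assoc, toMat_inv_mul, Matrix.one_mul]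
    · rintro ⟨γ, hγ, h, hh, rfl⟩
      rw [Subgroup.mem_bot.1 hγ, one_mul, toMat_mul, Matrix.mul_assoc,
        mul_lastProj_of_mem_subSO hh]
  · -- in the chart opposite to the image of `g` the map is the stereographic projection of the last
    -- column, which extends to nearby matrices
    let v : Sph n := -toSphere n g
    let c : OpenPartialHomeomorph (Sph n) (Euc (2 * n)) := stereographic' (2 * n) v
    let U := (OrthonormalBasis.fromOrthogonalSpanSingleton (𝕜 := ℝ) (2 * n)
      (ne_zero_of_mem_unit_sphere v)).repr
    let col : Amb n → EuclideanSpace ℝ (Idx n ⊕ Unit) := fun A =>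
      WithLp.toLp 2 fun i => A i (Sum.inr ())
    have hcol : ContDiff ℝ ∞ col := by
      refine (contDiff_euclidean (n := ∞)).2 fun i => ?_
      exact contDiff_pi.1 (contDiff_pi.1 contDiff_id i) (Sum.inr ())
    let D : Set (EuclideanSpace ℝ (Idx n ⊕ Unit)) := {x | innerSL ℝ v.1 x ≠ 1}
    have hD : IsOpen D := isOpen_ne.preimage (innerSL ℝ v.1).continuous
    have hst : ContDiffOn ℝ ∞ (fun A => U (stereoToFun v.1 (col A))) (col ⁻¹' D) :=
      U.contDiff.comp_contDiffOn
        (contDiffOn_stereoToFun.comp hcol.contDiffOn fun _ h => h)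
    have hc : ContMDiffOn 𝓘(ℝ, Euc (2 * n)) 𝓘(ℝ, Euc (2 * n)) ∞ c.symm c.target :=
      contMDiffOn_symm_of_mem_maximalAtlas (IsManifold.subset_maximalAtlas ⟨v, rfl⟩)
    refine ⟨col ⁻¹' D, fun A => c.symm (U (stereoToFun v.1 (col A))), hD.preimage hcol.continuous,
      ?_, hc.comp hst.contMDiffOn fun A _ => ?_, fun g' hg' => ?_⟩
    · change innerSL ℝ (-(toSphere n g).1) (toSphere n g).1 ≠ 1
      have h1 : ‖(toSphere n g).1‖ = 1 := by simp
      rw [innerSL_apply_apply, inner_neg_left, real_inner_self_eq_norm_sq, h1]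
      norm_num
    · simp [c]
    · have h1 : toSphere n g' ∈ c.source := by
        rw [stereographic'_source]
        intro h
        refine hg' ?_
        have h2 : col (Matrix.of.symm (toMat g')) = v.1 := congrArg Subtype.val h
        rw [h2, innerSL_apply_apply, real_inner_self_eq_norm_sq]
        simp
      have h3 : c (toSphere n g') = U (stereoToFun v.1 (col (Matrix.of.symm (toMat g')))) := rfl
      change c.symm (U (stereoToFun v.1 (col (Matrix.of.symm (toMat g'))))) = _
      rw [← h3]
      exact c.left_inv h1

end TwistorFat

open TwistorFat in
theorem propositionP (n : ℕ) (hn : 1 ≤ n) :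
    (∀ s : ℝ, s = 1 ∨ s = -1 →
      IsCanonicalConnection n s (canonicalForm n) ∧
        IsFat (grpSet n s) (canonicalForm n) (covec n s)) ∧
    (∃ _ : ChartedSpace (Euc (n * (n + 1))) (Biquotient (⊥ : Subgroup (grp n 1)) (subU n 1)),
      IsSmoothQuotient (d := n * (n + 1)) ⊥ (subU n 1) (biquotientMk ⊥ (subU n 1)) ∧
      IsSmoothQuotient (d := 2 * n) ⊥ (subSO n 1) (toSphere n) ∧
      IsSymplecticallyFat (d := n * (n + 1)) (e := 2 * n)
        (biquotientMk ⊥ (subU n 1)) (toSphere n)) ∧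
    (∀ Γ : Subgroup (grp n (-1)), DiscreteTopology Γ →
      (∀ γ ∈ Γ, ∀ g : grp n (-1), g⁻¹ * γ * g ∈ subSO n (-1) → γ = 1) →
      ∃ (_ : ChartedSpace (Euc (n * (n + 1))) (Biquotient Γ (subU n (-1))))
        (_ : ChartedSpace (Euc (2 * n)) (Biquotient Γ (subSO n (-1)))),
        IsSmoothQuotient (d := n * (n + 1)) Γ (subU n (-1)) (biquotientMk Γ (subU n (-1))) ∧
        IsSmoothQuotient (d := 2 * n) Γ (subSO n (-1)) (biquotientMk Γ (subSO n (-1))) ∧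
        IsSymplecticallyFat (d := n * (n + 1)) (e := 2 * n)
          (biquotientMk Γ (subU n (-1))) (biquotientMk Γ (subSO n (-1)))) := by
  have h1 : (1 : ℝ) * 1 = 1 := one_mul 1
  have h2 : (-1 : ℝ) * (-1) = 1 := by norm_num
  refine ⟨?_, ?_, ?_⟩
  · rintro s hs
    have hs' : s * s = 1 := by rcases hs with rfl | rfl <;> norm_num
    exact ⟨isCanonicalConnection_canonicalForm hn hs', isFat_covec hn hs'⟩
  · have hΓ : DiscreteTopology (⊥ : Subgroup (grp n 1)) := inferInstance
    have hfree : ∀ γ ∈ (⊥ : Subgroup (grp n 1)), ∀ g : grp n 1,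
        g⁻¹ * γ * g ∈ subSO n 1 → γ = 1 := fun γ hγ _ _ => Subgroup.mem_bot.1 hγ
    obtain ⟨P⟩ := nonempty_cosetSlice_subU (n := n) h1
    let _ := P.chartedSpace h1 hΓ hfree subU_le_subSO
    have hq := P.isSmoothQuotient h1 hΓ hfree subU_le_subSO
    have hp := isSmoothQuotient_toSphere hn
    exact ⟨_, hq, hp, isSymplecticallyFat_of_isSmoothQuotient hn h1 hΓ hfree hq hp⟩
  · intro Γ hΓ hfree
    obtain ⟨P⟩ := nonempty_cosetSlice_subU (n := n) h2
    obtain ⟨Q⟩ := nonempty_cosetSlice_subSO (n := n) h2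
    let _ := P.chartedSpace h2 hΓ hfree subU_le_subSO
    let _ := Q.chartedSpace h2 hΓ hfree le_rfl
    have hq := P.isSmoothQuotient h2 hΓ hfree subU_le_subSO
    have hp := Q.isSmoothQuotient h2 hΓ hfree le_rfl
    exact ⟨_, _, hq, hp, isSymplecticallyFat_of_isSmoothQuotient hn h2 hΓ hfree hq hp⟩
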